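/- Let $n\ge 1$. An instance of the Boolean hidden shift problem (BHSP) is a pair of functions $f,g:\mathbb{Z}_2^n\to\mathbb{Z}_2$ such that (i) $f(x)=f(x+t)$ for all $x$ only if $t=0$, and (ii) for some $s\in\mathbb{Z}_2^n$, called the solution, $g(x)=f(x+s)$ for all $x$. The functions are accessible through the oracles $O_f:|b\rangle|x\rangle\mapsto|b\oplus f(x)\rangle|x\rangle$ and $O_g:|b\rangle|x\rangle\mapsto|b\oplus g(x)\rangle|x\rangle$. The minimum influence of $f$ is $\gamma_f=\min_{v\ne 0}\Pr_x[f(x)\ne f(x+v)]$, where $x\in\mathbb{Z}_2^n$ is uniformly random. A quantum algorithm is a single finite program for a classical random access machine that controls a row of qubits, initially all $|0\rangle$. In one unit of time the machine carries out one step of control flow, adds or subtracts two numbers, reads or writes a memory cell, applies a gate ($H$, $X$, $Z$, $T$, CNOT or Toffoli), measures a qubit in the computational basis, or queries $O_f$ or $O_g$ on $n+1$ consecutive qubits. There are a quantum algorithm $P$, a constant $C$ and a polynomial $p$ such that the following holds for all $n\ge1$, every BHSP instance $(f,g)$ on $n$ bits with solution $s$, every real $\delta>0$ with $\gamma_f\ge\delta$,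 and every real $0<\varepsilon<1$. The algorithm $P$, on input $n$, $\lceil 1/\delta\rceil$ and $\lceil 1/\varepsilon\rceil$ and with access to $O_f$ and $O_g$, halts with output $s$ with probability at least $1-\varepsilon$. The maximum number $q$ of oracle queries that it makes (over all outcomes of its measurements that have nonzero probability) is finite and satisfies $$q\;\le\; C\,\frac{n\,\max\{1,\log(1/\varepsilon)\}}{\sqrt{\delta}},$$ and its expected running time is at most $p(q)$. -/

import Mathlib

open scoped ENNReal NNReal

noncomputable section

namespace HiddenShift

/-! ### The Boolean hidden shift problem -/

/-- `(f, g)` is an instance of the Boolean hidden shift problem with solution `s`. -/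
structure IsInstance {n : ℕ} (f g : (Fin n → ZMod 2) → ZMod 2) (s : Fin n → ZMod 2) : Prop where
  /-- `f` is invariant under no nonzero shift. -/
  shift_free : ∀ t : Fin n → ZMod 2, (∀ x, f x = f (x + t)) → t = 0
  /-- `g` is `f` shifted by `s`. -/
  shift : ∀ x, g x = f (x + s)

/-- `γ_{f,v}`: the probability that `f x ≠ f (x + v)`, for uniformly random `x`. -/
def influence {n : ℕ} (f : (Fin n → ZMod 2) → ZMod 2) (v : Fin n → ZMod 2) : ℝ :=
  ((Finset.univ.filter fun x => f x ≠ f (x + v)).card : ℝ) /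
    (Fintype.card (Fin n → ZMod 2) : ℝ)

/-- `γ_f`: the minimum of `γ_{f,v}` over the nonzero `v` (a minimum over a finite set, which is
nonempty for `1 ≤ n`). -/
def minInfluence {n : ℕ} (f : (Fin n → ZMod 2) → ZMod 2) : ℝ :=
  ⨅ v : {v : Fin n → ZMod 2 // v ≠ 0}, influence f v

/-! ### Quantum memory

The quantum memory is an unbounded row of qubits `0, 1, 2, …`. A computational basis state with
finitely many ones is the finite set of those qubits whose value is `1`. -/

/-- A (possibly unnormalized) state vector: a finite superposition of basis states. -/
abbrev QState : Type := Finset ℕ →₀ ℂ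

/-- The basis vector `|x⟩`. -/
def ket (x : Finset ℕ) : QState := Finsupp.single x 1

/-- The squared norm of a state vector. -/
def weight (ψ : QState) : ℝ≥0 := ψ.sum fun _ a => ‖a‖₊ ^ 2

/-- The linear map that sends each basis vector `|x⟩` to `φ x`. -/
def ofBasis (φ : Finset ℕ → QState) : QState →ₗ[ℂ] QState := Finsupp.linearCombination ℂ φ

/-- The basis state `x` with qubit `i` negated. -/
def flip (i : ℕ) (x : Finset ℕ) : Finset ℕ := if i ∈ x then x.erase i else insert i x

/-- The one-qubit gates: Hadamard, NOT, the sign flip `Z`, and the phase gate `T`. -/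
inductive Gate : Type
  | H
  | X
  | Z
  | T

/-- The action of a one-qubit gate on qubit `i`. -/
def Gate.apply (i : ℕ) : Gate → QState →ₗ[ℂ] QState
  | .H => ofBasis fun x =>
      ((1 / Real.sqrt 2 : ℝ) : ℂ) •
        (ket (x.erase i) + (if i ∈ x then (-1 : ℂ) else 1) • ket (insert i x))
  | .X => ofBasis fun x => ket (flip i x)
  | .Z => ofBasis fun x => (if i ∈ x then (-1 : ℂ) else 1) • ket x
  | .T => ofBasis fun x =>
      (if i ∈ x then Complex.exp (Complex.I * (Real.pi / 4 : ℝ)) else 1) • ket x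

/-- Controlled NOT with control `c` and target `t` (the identity if the two coincide). -/
def cnotGate (c t : ℕ) : QState →ₗ[ℂ] QState :=
  ofBasis fun x => ket (if c ≠ t ∧ c ∈ x then flip t x else x)

/-- Toffoli gate with controls `c`, `c'` and target `t` (the identity if the target is one of the
controls). -/
def toffoliGate (c c' t : ℕ) : QState →ₗ[ℂ] QState :=
  ofBasis fun x => ket (if c ≠ t ∧ c' ≠ t ∧ c ∈ x ∧ c' ∈ x then flip t x else x)

/-- The content of the qubits `a, a + 1, …, a + n - 1` in the basis state `x`. -/
def readBlock (n a : ℕ) (x : Finset ℕ) : Fin n → ZMod 2 :=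
  fun i => if a + (i : ℕ) ∈ x then 1 else 0

/-- The oracle `|b⟩|y⟩ ↦ |b ⊕ h y⟩|y⟩`, acting on the `n + 1` consecutive qubits
`a, a + 1, …, a + n`: qubit `a` holds `b`, the others hold `y`. -/
def oracleGate {n : ℕ} (h : (Fin n → ZMod 2) → ZMod 2) (a : ℕ) : QState →ₗ[ℂ] QState :=
  ofBasis fun x => ket (if h (readBlock n (a + 1) x) = 1 then flip a x else x)

/-- The unnormalized state after measuring qubit `i` with outcome `1` (if `b` is true)
or `0` (if `b` is false); its weight is the probability of that outcome, multiplied by the weight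
of `ψ`. -/
def project (i : ℕ) (b : Bool) (ψ : QState) : QState :=
  ψ.filter fun x => (i ∈ x ↔ b = true)

/-! ### Quantum algorithms

A quantum algorithm is a fixed finite program for a classical random access machine that controls
the quantum memory. The machine has registers and a memory, whose cells hold natural numbers, and
its only arithmetic is addition and truncated subtraction. The same program serves all inputs. -/

/-- Programs. Lower case letters `r a b c` denote register numbers. -/
inductive Program : Type
  /-- do nothing -/
  | skip
  /-- register `r` := the constant `k` -/
  | const (r k : ℕ)
  /-- register `r` := register `a` + register `b` -/
  | add (r a b : ℕ)
  /-- register `r` := register `a` - register `b`, or `0` if this is negative -/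
  | sub (r a b : ℕ)
  /-- register `r` := the memory cell whose address is in register `a` -/
  | load (r a : ℕ)
  /-- the memory cell whose address is in register `a` := register `b` -/
  | store (a b : ℕ)
  /-- apply the gate `G` to the qubit whose number is in register `a` -/
  | gate (G : Gate) (a : ℕ)
  /-- apply a controlled NOT to the qubits whose numbers are in registers `a`, `b` -/
  | cnot (a b : ℕ)
  /-- apply a Toffoli gate to the qubits whose numbers are in registers `a`, `b`, `c` -/
  | toffoli (a b c : ℕ)
  /-- query the oracle of `f` on the block that starts at the qubit in register `a` -/
  | queryF (a : ℕ)
  /-- query the oracle of `g` on the block that starts at the qubit in register `a` -/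
  | queryG (a : ℕ)
  /-- measure the qubit whose number is in register `a`; register `r` := the outcome -/
  | measure (r a : ℕ)
  /-- run `p`, then `q` -/
  | seq (p q : Program)
  /-- run `p` if register `r` is nonzero, and `q` otherwise -/
  | ite (r : ℕ) (p q : Program)
  /-- run `p` as long as register `r` is nonzero -/
  | loop (r : ℕ) (p : Program)

/-- A configuration on one branch of the computation. -/
structure Config : Type where
  /-- the programs that remain to be run, in this order -/
  todo : List Program
  /-- the registers -/
  regs : ℕ → ℕ
  /-- the classical memory -/
  mem : ℕ → ℕ
  /-- the unnormalized quantum state: the weight is the probability of this branch -/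
  qubits : QState
  /-- the number of oracle queries made so far -/
  queries : ℕ

/-- One step of time: the possible successors of a configuration. There are two after
a measurement and one otherwise. A configuration with nothing left to do is halted. -/
def step {n : ℕ} (f g : (Fin n → ZMod 2) → ZMod 2) (c : Config) : Multiset Config :=
  match c.todo with
  | [] => {c}
  | .skip :: K => {{ c with todo := K }}
  | .const r k :: K => {{ c with todo := K, regs := Function.update c.regs r k }}
  | .add r a b :: K =>
      {{ c with todo := K, regs := Function.update c.regs r (c.regs a + c.regs b) }}
  | .sub r a b :: K =>
      {{ c with todo := K, regs := Function.update c.regs r (c.regs a - c.regs b) }}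
  | .load r a :: K =>
      {{ c with todo := K, regs := Function.update c.regs r (c.mem (c.regs a)) }}
  | .store a b :: K =>
      {{ c with todo := K, mem := Function.update c.mem (c.regs a) (c.regs b) }}
  | .gate G a :: K => {{ c with todo := K, qubits := G.apply (c.regs a) c.qubits }}
  | .cnot a b :: K =>
      {{ c with todo := K, qubits := cnotGate (c.regs a) (c.regs b) c.qubits }}
  | .toffoli a b d :: K =>
      {{ c with
          todo := K
          qubits := toffoliGate (c.regs a) (c.regs b) (c.regs d) c.qubits }}
  | .queryF a :: K =>
      {{ c with
          todo := K
          qubits := oracleGate f (c.regs a) c.qubits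
          queries := c.queries + 1 }}
  | .queryG a :: K =>
      {{ c with
          todo := K
          qubits := oracleGate g (c.regs a) c.qubits
          queries := c.queries + 1 }}
  | .measure r a :: K =>
      {{ c with
          todo := K
          regs := Function.update c.regs r 0
          qubits := project (c.regs a) false c.qubits },
       { c with
          todo := K
          regs := Function.update c.regs r 1
          qubits := project (c.regs a) true c.qubits }}
  | .seq p q :: K => {{ c with todo := p :: q :: K }}
  | .ite r p q :: K => {{ c with todo := (if c.regs r ≠ 0 then p else q) :: K }}
  | .loop r p :: K =>
      {{ c with todo := if c.regs r ≠ 0 then p :: .loop r p :: K else K }}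

/-- The initial configuration of `P`: the three inputs are in the registers `0`, `1` and `2`, all
other registers and all memory cells are zero, and all qubits are in the state `|0⟩`. -/
def Program.start (P : Program) (n D E : ℕ) : Config where
  todo := [P]
  regs := fun r => if r = 0 then n else if r = 1 then D else if r = 2 then E else 0
  mem := fun _ => 0
  qubits := ket ∅
  queries := 0

/-- All branches of the computation of `P`, with oracles `f` and `g` on `n` bits and with the
inputs `n`, `D`, `E`, after a given number of steps. -/
def Program.branches (P : Program) {n : ℕ} (f g : (Fin n → ZMod 2) → ZMod 2) (D E : ℕ) :
    ℕ → Multiset Config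
  | 0 => {P.start n D E}
  | t + 1 => (P.branches f g D E t).bind (step f g)

open Classical in
/-- The total probability of those branches in `B` that satisfy `p`. -/
def probability (B : Multiset Config) (p : Config → Prop) : ℝ≥0∞ :=
  ((B.filter p).map fun c => (weight c.qubits : ℝ≥0∞)).sum

/-- The configuration is halted. -/
def Config.Halted (c : Config) : Prop := c.todo = []

/-- The output `s` is written in the memory cells `0, …, n - 1`, one bit in each. -/
def Config.Outputs {n : ℕ} (c : Config) (s : Fin n → ZMod 2) : Prop :=
  ∀ i : Fin n, c.mem i = (s i).val

/-- The probability that `P` halts with output `s`. (The probability that it does so within `t`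
steps increases with `t`.) -/
def Program.successProbability (P : Program) {n : ℕ} (f g : (Fin n → ZMod 2) → ZMod 2)
    (D E : ℕ) (s : Fin n → ZMod 2) : ℝ≥0∞ :=
  ⨆ t : ℕ, probability (P.branches f g D E t) fun c => c.Halted ∧ c.Outputs s

/-- The expected number of steps until `P` halts, `𝔼 τ = ∑ t, Pr (t < τ)`. -/
def Program.expectedTime (P : Program) {n : ℕ} (f g : (Fin n → ZMod 2) → ZMod 2)
    (D E : ℕ) : ℝ≥0∞ :=
  ∑' t : ℕ, probability (P.branches f g D E t) fun c => ¬ c.Halted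

/-- The maximum number of queries that `P` makes on a branch of nonzero probability. -/
def Program.maxQueries (P : Program) {n : ℕ} (f g : (Fin n → ZMod 2) → ZMod 2)
    (D E : ℕ) : ℕ∞ :=
  ⨆ (t : ℕ) (c ∈ P.branches f g D E t) (_ : weight c.qubits ≠ 0), (c.queries : ℕ∞)

end HiddenShift

end

/-! Glue `f` and `g` to one function on `n + 1` bits, equal to `f` where the last bit is `0` and to
`g` where it is `1`. It is invariant under translation by `(s, 1)` (`phase_add_extend`). Hadamard
gates, the phase oracle of this function and Hadamard gates again turn `|0⟩` into the state whose
amplitudes are the Fourier coefficients of the phases. By the invariance these vanish off the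
orthogonal complement of `(s, 1)` (`psi_eq_zero`), so each measured vector `u` is a linear equation
for the solution.

The candidates for `(s, 1)` form an affine space `R 0 + span (R 1, …, R k)`, at first all vectors
with last bit `1`. A sample with `u ⬝ᵥ R k = 1` removes the direction `R k` (`Sound.elim`); at `k =
0` row `0` is `(s, 1)`. Such a sample has probability equal to the influence of `f` at the first `n`
bits of `R k`, hence at least `γ_f` (`goodProb_phase`, `Sound.goodProb_ge`). If this probability is
`sin² θ`, then `J` steps of amplitude amplification raise it to `sin² ((2J + 1) θ)`
(`sum_grover_good`), and they leave the support of the state unchanged.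

As `θ` is unknown, a sweep tries `J = 0, 1, 3, 7, …` below `M ≈ 1 / √δ`. The angle `(2J + 1) θ`
starts at most at `π / 2`, at most triples from one trial to the next, and ends above `π / 6`. So,
unless a success comes earlier, some trial of the sweep has its angle in `[π / 6, π / 2]` and
succeeds with probability at least `1 / 4`. The query counts grow geometrically, so a sweep costs
only `O(M)` queries.

The progress is measured by the potential: the sum over the branches of their weight times `2 ^ k -
1`. A success at least halves it, so a sweep multiplies it by at most `7 / 8` (`sweepLoop_runs`).
After `6 (n + l)` sweeps, where `2 ^ l ≥ 1 / ε`, it has fallen from `2 ^ n - 1` to at most `ε`, and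
it bounds the probability of failure (`Valid.weight_le_pot`). The schedule of trials does not depend
on the outcomes, so all branches make the same number of queries and the running time has a bound
that is not only in expectation.

The program is verified in a big-step semantics: `Runs` describes the finite multiset of end states
of a program, whatever remains to be run afterwards. The gates act on amplitude functions through
`vec`, and this links the machine to the Fourier analysis. -/

open scoped ENNReal NNReal

noncomputable section

namespace HiddenShift

section

/-! ### Big-step semantics -/

/-- A configuration without its stack of programs. -/
@[ext]
structure St : Type where
  regs : ℕ → ℕ
  mem : ℕ → ℕ
  qubits : QState
  queries : ℕ

/-- The configuration in the state `σ` that still has to run `K`. -/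
def St.push (K : List Program) (σ : St) : Config := ⟨K, σ.regs, σ.mem, σ.qubits, σ.queries⟩

/-- The state of a configuration. -/
def Config.st (c : Config) : St := ⟨c.regs, c.mem, c.qubits, c.queries⟩

variable {n : ℕ} {f g : (Fin n → ZMod 2) → ZMod 2}

/-- The configuration `c` runs along a tree of depth at most `t` whose leaves are `B`. -/
inductive Tree (f g : (Fin n → ZMod 2) → ZMod 2) : ℕ → Config → Multiset Config → Prop
  | leaf (t : ℕ) (c : Config) : Tree f g t c {c}
  | one {t : ℕ} {c c' : Config} {B : Multiset Config} :
      step f g c = {c'} → Tree f g t c' B → Tree f g (t + 1) c B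
  | two {t : ℕ} {c c₁ c₂ : Config} {B₁ B₂ : Multiset Config} :
      step f g c = {c₁, c₂} → Tree f g t c₁ B₁ → Tree f g t c₂ B₂ → Tree f g (t + 1) c (B₁ + B₂)

theorem Tree.mono {t t' : ℕ} {c : Config} {B : Multiset Config} (h : Tree f g t c B)
    (ht : t ≤ t') : Tree f g t' c B := by
  induction h generalizing t' with
  | leaf t c => exact .leaf _ _
  | one h _ ih =>
    obtain ⟨k, rfl⟩ := Nat.exists_eq_add_of_le' (show 1 ≤ t' by omega)
    exact .one h (ih (by omega))
  | two h _ _ ih₁ ih₂ =>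
    obtain ⟨k, rfl⟩ := Nat.exists_eq_add_of_le' (show 1 ≤ t' by omega)
    exact .two h (ih₁ (by omega)) (ih₂ (by omega))

theorem Tree.bind {t t' : ℕ} {c : Config} {B : Multiset Config} (h : Tree f g t c B)
    {F : Config → Multiset Config} (hF : ∀ b ∈ B, Tree f g t' b (F b)) :
    Tree f g (t + t') c (B.bind F) := by
  induction h with
  | leaf t c =>
    rw [Multiset.singleton_bind]
    exact (hF c (Multiset.mem_singleton_self c)).mono (by omega)
  | one h _ ih => rw [Nat.add_right_comm]; exact .one h (ih hF)
  | two h _ _ ih₁ ih₂ =>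
    rw [Nat.add_right_comm, Multiset.add_bind]
    exact .two h (ih₁ fun b hb => hF b (Multiset.mem_add.2 (.inl hb)))
      (ih₂ fun b hb => hF b (Multiset.mem_add.2 (.inr hb)))

/-- Run from the state `σ`, the program `p` halts within `t` steps on all branches, in the
states `B`. -/
def Runs (f g : (Fin n → ZMod 2) → ZMod 2) (p : Program) (σ : St) (t : ℕ) (B : Multiset St) :
    Prop :=
  ∀ K, Tree f g t (σ.push (p :: K)) (B.map (St.push K))

theorem Runs.mono {p : Program} {σ : St} {t t' : ℕ} {B : Multiset St} (h : Runs f g p σ t B)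
    (ht : t ≤ t') : Runs f g p σ t' B := fun K => (h K).mono ht

/-- Because `Runs` quantifies over the continuation `K`, the leaves of the tree of `p` are roots of
trees of `q`, and the trees can be grafted. The extra step unfolds `seq`. -/
theorem Runs.seq {p q : Program} {σ : St} {t t' : ℕ} {B : Multiset St} (h : Runs f g p σ t B)
    {F : St → Multiset St} (hF : ∀ b ∈ B, Runs f g q b t' (F b)) :
    Runs f g (.seq p q) σ (t + t' + 1) (B.bind F) := by
  intro K
  refine .one (c' := σ.push (p :: q :: K)) rfl ?_
  have := (h (q :: K)).bind (t' := t') (F := fun c => (F c.st).map (St.push K)) ?_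
  · rwa [Multiset.bind_map, ← Multiset.map_bind] at this
  · intro b hb
    obtain ⟨σ', hσ', rfl⟩ := Multiset.mem_map.1 hb
    exact hF σ' hσ' K

theorem Runs.seq_det {p q : Program} {σ σ' : St} {t t' : ℕ} {B : Multiset St}
    (h : Runs f g p σ t {σ'}) (hq : Runs f g q σ' t' B) :
    Runs f g (.seq p q) σ (t + t' + 1) B := by
  have := h.seq (F := fun _ => B) (q := q) (t' := t') (by
    intro b hb; rw [Multiset.mem_singleton.1 hb]; exact hq)
  rwa [Multiset.singleton_bind] at this

theorem Runs.ite_pos {r : ℕ} {p q : Program} {σ : St} {t : ℕ} {B : Multiset St}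
    (hr : σ.regs r ≠ 0) (h : Runs f g p σ t B) : Runs f g (.ite r p q) σ (t + 1) B := by
  intro K
  refine .one (c' := σ.push (p :: K)) ?_ (h K)
  simp [step, St.push, hr]

theorem Runs.ite_neg {r : ℕ} {p q : Program} {σ : St} {t : ℕ} {B : Multiset St}
    (hr : σ.regs r = 0) (h : Runs f g q σ t B) : Runs f g (.ite r p q) σ (t + 1) B := by
  intro K
  refine .one (c' := σ.push (q :: K)) ?_ (h K)
  simp [step, St.push, hr]

theorem Runs.loop_done {r : ℕ} {p : Program} {σ : St} (hr : σ.regs r = 0) (t : ℕ) :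
    Runs f g (.loop r p) σ (t + 1) {σ} := by
  intro K
  refine .one (c' := σ.push K) ?_ ?_
  · simp [step, St.push, hr]
  · exact .leaf _ _

theorem Runs.loop_step {r : ℕ} {p : Program} {σ : St} {t t' : ℕ} {B : Multiset St}
    (hr : σ.regs r ≠ 0) (h : Runs f g p σ t B) {F : St → Multiset St}
    (hF : ∀ b ∈ B, Runs f g (.loop r p) b t' (F b)) :
    Runs f g (.loop r p) σ (t + t' + 1) (B.bind F) := by
  intro K
  refine .one (c' := σ.push (p :: .loop r p :: K)) (by simp [step, St.push, hr]) ?_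
  have := (h (.loop r p :: K)).bind (t' := t') (F := fun c => (F c.st).map (St.push K)) ?_
  · rwa [Multiset.bind_map, ← Multiset.map_bind] at this
  · intro b hb
    obtain ⟨σ', hσ', rfl⟩ := Multiset.mem_map.1 hb
    exact hF σ' hσ' K

/-- Run from the state `σ`, the program `p` reaches within `t` steps, without branching, a state
that satisfies `Q`. -/
def Reaches (f g : (Fin n → ZMod 2) → ZMod 2) (p : Program) (σ : St) (t : ℕ) (Q : St → Prop) :
    Prop :=
  ∃ σ', Runs f g p σ t {σ'} ∧ Q σ'

theorem Reaches.mono {p : Program} {σ : St} {t t' : ℕ} {Q Q' : St → Prop}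
    (h : Reaches f g p σ t Q) (ht : t ≤ t') (hQ : ∀ σ', Q σ' → Q' σ') :
    Reaches f g p σ t' Q' := by
  obtain ⟨σ', h, hσ'⟩ := h
  exact ⟨σ', h.mono ht, hQ _ hσ'⟩

theorem Reaches.seq {p q : Program} {σ : St} {t t' : ℕ} {Q Q' : St → Prop}
    (h : Reaches f g p σ t Q) (hq : ∀ σ', Q σ' → Reaches f g q σ' t' Q') :
    Reaches f g (.seq p q) σ (t + t' + 1) Q' := by
  obtain ⟨σ', h, hσ'⟩ := h
  obtain ⟨τ, hτ, hQ⟩ := hq σ' hσ'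
  exact ⟨τ, h.seq_det hτ, hQ⟩

/-- A loop whose body is run `m` times. The state before the last `i` runs satisfies `I i`. -/
theorem Reaches.loop {r : ℕ} {p : Program} {t : ℕ} (I : ℕ → St → Prop)
    (hbody : ∀ i σ, I (i + 1) σ → σ.regs r ≠ 0 ∧ Reaches f g p σ t (I i))
    (hdone : ∀ σ, I 0 σ → σ.regs r = 0) (m : ℕ) (σ : St) (hσ : I m σ) :
    Reaches f g (.loop r p) σ (m * (t + 1) + 1) (I 0) := by
  induction m generalizing σ with
  | zero => exact ⟨σ, Runs.loop_done (hdone σ hσ) _, hσ⟩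
  | succ m ih =>
    obtain ⟨hr, σ', h, hσ'⟩ := hbody m σ hσ
    obtain ⟨τ, hτ, hI⟩ := ih σ' hσ'
    refine ⟨τ, ?_, hI⟩
    have := Runs.loop_step hr h (F := fun _ => {τ}) (t' := m * (t + 1) + 1) (by
      intro b hb; rw [Multiset.mem_singleton.1 hb]; exact hτ)
    rw [Multiset.singleton_bind] at this
    exact this.mono (le_of_eq (by ring))

/-! ### Programs without loops and measurements -/

/-- The program contains no loop and no measurement. -/
def Program.simple : Program → Bool
  | .measure _ _ => false
  | .loop _ _ => false
  | .seq p q => p.simple && q.simple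
  | .ite _ p q => p.simple && q.simple
  | _ => true

/-- A bound on the running time of a simple program. -/
def Program.cost : Program → ℕ
  | .seq p q => p.cost + q.cost + 1
  | .ite _ p q => p.cost + q.cost + 1
  | _ => 1

/-- The final state of a simple program. -/
def Program.run (f g : (Fin n → ZMod 2) → ZMod 2) : Program → St → St
  | .skip, σ => σ
  | .const r k, σ => { σ with regs := Function.update σ.regs r k }
  | .add r a b, σ => { σ with regs := Function.update σ.regs r (σ.regs a + σ.regs b) }
  | .sub r a b, σ => { σ with regs := Function.update σ.regs r (σ.regs a - σ.regs b) }
  | .load r a, σ => { σ with regs := Function.update σ.regs r (σ.mem (σ.regs a)) }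
  | .store a b, σ => { σ with mem := Function.update σ.mem (σ.regs a) (σ.regs b) }
  | .gate G a, σ => { σ with qubits := G.apply (σ.regs a) σ.qubits }
  | .cnot a b, σ => { σ with qubits := cnotGate (σ.regs a) (σ.regs b) σ.qubits }
  | .toffoli a b d, σ =>
      { σ with qubits := toffoliGate (σ.regs a) (σ.regs b) (σ.regs d) σ.qubits }
  | .queryF a, σ =>
      { σ with qubits := oracleGate f (σ.regs a) σ.qubits, queries := σ.queries + 1 }
  | .queryG a, σ =>
      { σ with qubits := oracleGate g (σ.regs a) σ.qubits, queries := σ.queries + 1 }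
  | .measure _ _, σ => σ
  | .seq p q, σ => q.run f g (p.run f g σ)
  | .ite r p q, σ => if σ.regs r ≠ 0 then p.run f g σ else q.run f g σ
  | .loop _ _, σ => σ

/-- Straight-line code is thus verified by evaluating `Program.run`, which reduces the bodies of
most loops to `simp`. -/
theorem Runs.of_simple {p : Program} (hp : p.simple = true) (σ : St) :
    Runs f g p σ p.cost {p.run f g σ} := by
  induction p generalizing σ with
  | seq p q ihp ihq =>
    simp only [Program.simple, Bool.and_eq_true] at hp
    exact (ihp hp.1 σ).seq_det (ihq hp.2 _)
  | ite r p q ihp ihq =>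
    simp only [Program.simple, Bool.and_eq_true] at hp
    by_cases hr : σ.regs r = 0
    · have := Runs.ite_neg (p := p) hr (ihq hp.2 σ)
      simp only [Program.run, hr, ne_eq, not_true_eq_false, if_false]
      exact this.mono (by simp only [Program.cost]; omega)
    · have := Runs.ite_pos (q := q) hr (ihp hp.1 σ)
      simp only [Program.run, hr, ne_eq, not_false_eq_true, if_true]
      exact this.mono (by simp only [Program.cost]; omega)
  | measure => simp [Program.simple] at hp
  | loop => simp [Program.simple] at hp
  | _ => exact fun K => .one rfl (.leaf _ _)

theorem Reaches.of_simple {p : Program} (hp : p.simple = true) {σ : St} {Q : St → Prop}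
    (hQ : Q (p.run f g σ)) : Reaches f g p σ p.cost Q :=
  ⟨_, Runs.of_simple hp σ, hQ⟩

/-- The sequential composition of a list of programs. -/
def Program.block : List Program → Program
  | [] => .skip
  | [p] => p
  | p :: q :: l => .seq p (Program.block (q :: l))

/-! ### From the big-step semantics to the branches of a computation -/

/-- The branches of the computation that starts in `c`, after `t` steps. -/
def iter (f g : (Fin n → ZMod 2) → ZMod 2) : ℕ → Config → Multiset Config
  | 0, c => {c}
  | t + 1, c => (step f g c).bind (iter f g t)

theorem iter_succ' (t : ℕ) (c : Config) :
    iter f g (t + 1) c = (iter f g t c).bind (step f g) := by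
  induction t generalizing c with
  | zero =>
    rw [iter, iter, Multiset.singleton_bind]
    exact (Multiset.bind_singleton _ id).trans (Multiset.map_id _)
  | succ t ih =>
    rw [iter, iter, Multiset.bind_assoc]
    exact Multiset.bind_congr fun a _ => ih a

theorem branches_eq_iter (P : Program) (D E t : ℕ) :
    P.branches f g D E t = iter f g t (P.start n D E) := by
  induction t with
  | zero => rfl
  | succ t ih => rw [iter_succ', Program.branches, ih]

theorem step_of_halted {c : Config} (h : c.Halted) : step f g c = {c} := by
  obtain ⟨K, _⟩ := c
  obtain rfl : K = [] := h
  rfl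

theorem iter_of_halted {c : Config} (h : c.Halted) (t : ℕ) : iter f g t c = {c} := by
  induction t with
  | zero => rfl
  | succ t ih => rw [iter, step_of_halted h, Multiset.singleton_bind, ih]

/-- Branches may stop at different times, so `t` is only an upper bound; halted leaves are fixed by
`step` and persist at all later times. -/
theorem Tree.iter_eq {t : ℕ} {c : Config} {B : Multiset Config} (h : Tree f g t c B)
    (hB : ∀ b ∈ B, b.Halted) {t' : ℕ} (ht : t ≤ t') : iter f g t' c = B := by
  induction h generalizing t' with
  | leaf t c => exact iter_of_halted (hB c (Multiset.mem_singleton_self c)) _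
  | one h _ ih =>
    obtain ⟨k, rfl⟩ := Nat.exists_eq_add_of_le' (show 1 ≤ t' by omega)
    rw [iter, h, Multiset.singleton_bind]
    exact ih hB (by omega)
  | @two t c c₁ c₂ B₁ B₂ h _ _ ih₁ ih₂ =>
    obtain ⟨k, rfl⟩ := Nat.exists_eq_add_of_le' (show 1 ≤ t' by omega)
    rw [iter, h, Multiset.insert_eq_cons, Multiset.cons_bind, Multiset.singleton_bind,
      ih₁ (fun b hb => hB b (Multiset.mem_add.2 (.inl hb))) (by omega),
      ih₂ (fun b hb => hB b (Multiset.mem_add.2 (.inr hb))) (by omega)]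

/-- The initial state of a computation. -/
def startSt (n D E : ℕ) : St :=
  ⟨fun r => if r = 0 then n else if r = 1 then D else if r = 2 then E else 0, fun _ => 0, ket ∅, 0⟩

theorem Runs.branches_eq {P : Program} {D E T : ℕ} {B : Multiset St}
    (h : Runs f g P (startSt n D E) T B) {t : ℕ} (ht : T ≤ t) :
    P.branches f g D E t = B.map (St.push []) := by
  rw [branches_eq_iter]
  refine (h []).iter_eq ?_ ht
  intro b hb
  obtain ⟨σ, -, rfl⟩ := Multiset.mem_map.1 hb
  rfl

/-- At a measurement either outcome would do, since only the query count matters. Iterated, this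
prolongs any branch to the end of the run. -/
theorem exists_mem_step (c : Config) : ∃ c' ∈ step f g c, c.queries ≤ c'.queries := by
  obtain ⟨K, r, m, q, k⟩ := c
  cases K with
  | nil => exact ⟨_, Multiset.mem_singleton_self _, le_rfl⟩
  | cons p K =>
    cases p with
    | measure i a =>
      refine ⟨⟨K, Function.update r i 0, m, project (r a) false q, k⟩, ?_, le_rfl⟩
      simp [step]
    | _ => exact ⟨_, Multiset.mem_singleton_self _, by simp⟩

theorem exists_mem_branches {P : Program} {D E t : ℕ} {c : Config}
    (hc : c ∈ P.branches f g D E t) (k : ℕ) :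
    ∃ c' ∈ P.branches f g D E (t + k), c.queries ≤ c'.queries := by
  induction k with
  | zero => exact ⟨c, hc, le_rfl⟩
  | succ k ih =>
    obtain ⟨c', hc', h⟩ := ih
    obtain ⟨c'', hc'', h'⟩ := exists_mem_step (f := f) (g := g) c'
    exact ⟨c'', Multiset.mem_bind.2 ⟨c', hc', hc''⟩, h.trans h'⟩

end

section

/-! ### Conservation of weight -/

/-- The inner product of two state vectors. -/
def ip (ψ φ : QState) : ℂ := ψ.sum fun x a => starRingEnd ℂ a * φ x

theorem ip_add_left (ψ ψ' φ : QState) : ip (ψ + ψ') φ = ip ψ φ + ip ψ' φ :=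
  Finsupp.sum_add_index' (by simp) (by intros; simp [add_mul])

theorem ip_single_left (x : Finset ℕ) (a : ℂ) (φ : QState) :
    ip (Finsupp.single x a) φ = starRingEnd ℂ a * φ x :=
  Finsupp.sum_single_index (by simp)

theorem ip_smul_left (a : ℂ) (ψ φ : QState) : ip (a • ψ) φ = starRingEnd ℂ a * ip ψ φ := by
  rw [ip, Finsupp.sum_smul_index' (by simp), ip, Finsupp.mul_sum]
  simp [mul_assoc]

theorem ip_add_right (ψ φ φ' : QState) : ip ψ (φ + φ') = ip ψ φ + ip ψ φ' := by
  simp [ip, mul_add, Finsupp.sum_add]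

theorem ip_smul_right (a : ℂ) (ψ φ : QState) : ip ψ (a • φ) = a * ip ψ φ := by
  rw [ip, ip, Finsupp.mul_sum]
  simp [mul_left_comm]

theorem ip_zero_left (φ : QState) : ip 0 φ = 0 := Finsupp.sum_zero_index

theorem ip_zero_right (φ : QState) : ip φ 0 = 0 := by simp [ip]

theorem ip_ket (x y : Finset ℕ) : ip (ket x) (ket y) = if x = y then 1 else 0 := by
  rw [ket, ip_single_left, ket, Finsupp.single_apply]
  simp [eq_comm]

theorem ip_self (ψ : QState) : ip ψ ψ = ((weight ψ : ℝ) : ℂ) := by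
  rw [ip, weight, Finsupp.sum, Finsupp.sum]
  push_cast
  refine Finset.sum_congr rfl fun x _ => ?_
  rw [mul_comm, Complex.mul_conj, Complex.normSq_eq_norm_sq]
  simp

theorem ofBasis_single (φ : Finset ℕ → QState) (x : Finset ℕ) (a : ℂ) :
    ofBasis φ (Finsupp.single x a) = a • φ x := by
  simp [ofBasis]

@[simp] theorem ofBasis_ket (φ : Finset ℕ → QState) (x : Finset ℕ) :
    ofBasis φ (ket x) = φ x := by
  simp [ket, ofBasis_single]

/-- Gates are given by the images of the basis vectors; if these are orthonormal, sesquilinearity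
makes the gate an isometry. -/
theorem ip_ofBasis {φ : Finset ℕ → QState}
    (h : ∀ x y, ip (φ x) (φ y) = if x = y then 1 else 0) (ψ ψ' : QState) :
    ip (ofBasis φ ψ) (ofBasis φ ψ') = ip ψ ψ' := by
  induction ψ using Finsupp.induction_linear with
  | zero => simp [ip_zero_left]
  | add ψ₁ ψ₂ h₁ h₂ => rw [map_add, ip_add_left, ip_add_left, h₁, h₂]
  | single x a =>
    induction ψ' using Finsupp.induction_linear with
    | zero => simp [ip_zero_right]
    | add ψ₁ ψ₂ h₁ h₂ => rw [map_add, ip_add_right, ip_add_right, h₁, h₂]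
    | single y b =>
      rw [ofBasis_single, ofBasis_single, ip_smul_left, ip_smul_right, h, ip_single_left,
        Finsupp.single_apply]
      simp [eq_comm]

theorem weight_ofBasis {φ : Finset ℕ → QState}
    (h : ∀ x y, ip (φ x) (φ y) = if x = y then 1 else 0) (ψ : QState) :
    weight (ofBasis φ ψ) = weight ψ := by
  have := ip_ofBasis h ψ ψ
  rw [ip_self, ip_self] at this
  exact_mod_cast this

theorem weight_ofBasis_ket {e : Finset ℕ → Finset ℕ} (he : Function.Injective e) (ψ : QState) :
    weight (ofBasis (fun x => ket (e x)) ψ) = weight ψ :=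
  weight_ofBasis (fun x y => by rw [ip_ket]; simp [he.eq_iff]) ψ

theorem weight_ofBasis_phase {c : Finset ℕ → ℂ} (hc : ∀ x, ‖c x‖ = 1) (ψ : QState) :
    weight (ofBasis (fun x => c x • ket x) ψ) = weight ψ := by
  refine weight_ofBasis (fun x y => ?_) ψ
  rw [ip_smul_left, ip_smul_right, ip_ket]
  split_ifs with h
  · rw [h, mul_one, mul_comm, Complex.mul_conj, Complex.normSq_eq_norm_sq, hc]; simp
  · simp

theorem mem_flip {i j : ℕ} {x : Finset ℕ} :
    j ∈ flip i x ↔ if j = i then i ∉ x else j ∈ x := by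
  unfold flip; split_ifs <;> simp_all

theorem flip_flip (i : ℕ) (x : Finset ℕ) : flip i (flip i x) = x := by
  ext j; simp only [mem_flip]; split_ifs <;> simp_all

/-- A controlled negation whose control ignores its target is an involution. This covers CNOT,
Toffoli and the oracles. -/
theorem injective_flip_if {i : ℕ} {p : Finset ℕ → Prop} [DecidablePred p]
    (hp : ∀ x, p (flip i x) ↔ p x) :
    Function.Injective fun x => if p x then flip i x else x := by
  refine Function.Involutive.injective fun x => ?_
  by_cases h : p x
  · simp [h, hp, flip_flip]
  · simp [h]

theorem weight_hadamard (i : ℕ) (ψ : QState) : weight (Gate.H.apply i ψ) = weight ψ := by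
  refine weight_ofBasis (fun x y => ?_) ψ
  have hs : ((1 / Real.sqrt 2 : ℝ) : ℂ) * ((1 / Real.sqrt 2 : ℝ) : ℂ) = 1 / 2 := by
    rw [← Complex.ofReal_mul, div_mul_div_comm, Real.mul_self_sqrt (by norm_num)]; norm_num
  have h1 : ∀ x y : Finset ℕ, x.erase i ≠ insert i y := fun x y h => by
    have := Finset.notMem_erase i x
    rw [h] at this
    exact this (Finset.mem_insert_self i y)
  have h2 : x.erase i = y.erase i ↔ insert i x = insert i y := by
    simp only [Finset.ext_iff, Finset.mem_erase, Finset.mem_insert]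
    refine forall_congr' fun j => ?_
    tauto
  have h3 : x = y ↔ (x.erase i = y.erase i ∧ (i ∈ x ↔ i ∈ y)) := by
    refine ⟨fun h => by simp [h], fun ⟨h, h'⟩ => ?_⟩
    ext j
    have := Finset.ext_iff.1 h j
    simp only [Finset.mem_erase] at this
    by_cases hj : j = i
    · rw [hj, h']
    · tauto
  simp only [ip_smul_left, ip_smul_right, ip_add_left, ip_add_right, ip_ket, h1, (h1 _ _).symm,
    if_false, ← h2, Complex.conj_ofReal]
  generalize ((1 / Real.sqrt 2 : ℝ) : ℂ) = c at hs ⊢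
  by_cases hxy : x.erase i = y.erase i <;> by_cases hx : i ∈ x <;> by_cases hy : i ∈ y <;>
    simp only [h3, hxy, hx, hy, if_true, if_false, map_neg, map_one, true_and, false_and,
      true_iff, false_iff, not_true_eq_false] <;>
    first | linear_combination 2 * hs | ring

theorem weight_gate (G : Gate) (i : ℕ) (ψ : QState) : weight (G.apply i ψ) = weight ψ := by
  cases G with
  | H => exact weight_hadamard i ψ
  | X => exact weight_ofBasis_ket (Function.Involutive.injective (flip_flip i)) ψ
  | Z => exact weight_ofBasis_phase (fun x => by split_ifs <;> simp) ψ
  | T =>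
    refine weight_ofBasis_phase (fun x => ?_) ψ
    split_ifs
    · rw [mul_comm, Complex.norm_exp_ofReal_mul_I]
    · simp

theorem weight_cnot (c t : ℕ) (ψ : QState) : weight (cnotGate c t ψ) = weight ψ :=
  weight_ofBasis_ket (injective_flip_if fun x => by
    simp only [mem_flip, and_congr_right_iff]; intro h; simp [h]) ψ

theorem weight_toffoli (c c' t : ℕ) (ψ : QState) : weight (toffoliGate c c' t ψ) = weight ψ :=
  weight_ofBasis_ket (injective_flip_if fun x => by
    simp only [mem_flip, and_congr_right_iff]; intro h h'; simp [h, h']) ψ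

theorem weight_oracle {n : ℕ} (h : (Fin n → ZMod 2) → ZMod 2) (a : ℕ) (ψ : QState) :
    weight (oracleGate h a ψ) = weight ψ := by
  refine weight_ofBasis_ket (injective_flip_if fun x => ?_) ψ
  have : readBlock n (a + 1) (flip a x) = readBlock n (a + 1) x := by
    funext i
    have : a + 1 + (i : ℕ) ≠ a := by omega
    simp [readBlock, mem_flip, this]
  rw [this]

theorem weight_project (i : ℕ) (ψ : QState) :
    weight (project i false ψ) + weight (project i true ψ) = weight ψ := by
  have h1 : project i false ψ = ψ.filter fun x => ¬ i ∈ x := by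
    unfold project; congr 1; ext; simp
  have h2 : project i true ψ = ψ.filter fun x => i ∈ x := by
    unfold project; congr 1; ext; simp
  rw [h1, h2, add_comm]
  simp only [weight, Finsupp.sum, Finsupp.support_filter]
  rw [← Finset.sum_filter_add_sum_filter_not ψ.support (fun x => i ∈ x)]
  congr 1 <;> refine Finset.sum_congr rfl fun x hx => ?_ <;>
    simp [(Finset.mem_filter.1 hx).2]

variable {n : ℕ} {f g : (Fin n → ZMod 2) → ZMod 2}

/-- Gates are isometries and a measurement splits the weight, so the weights of the branches always
form a probability distribution. -/
theorem weight_step (c : Config) :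
    ((step f g c).map fun c' => weight c'.qubits).sum = weight c.qubits := by
  obtain ⟨K, r, m, ψ, k⟩ := c
  cases K with
  | nil => simp [step]
  | cons p K =>
    cases p <;>
      simp [step, weight_gate, weight_cnot, weight_toffoli, weight_oracle, weight_project]

theorem weight_iter (t : ℕ) (c : Config) :
    ((iter f g t c).map fun c' => weight c'.qubits).sum = weight c.qubits := by
  induction t generalizing c with
  | zero => simp [iter]
  | succ t ih =>
    rw [iter, Multiset.map_bind, Multiset.sum_bind, ← weight_step (f := f) (g := g) c]
    congr 1
    exact Multiset.map_congr rfl fun c' _ => ih c'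

theorem weight_ket (x : Finset ℕ) : weight (ket x) = 1 := by
  simp [weight, ket]

theorem weight_smul (a : ℂ) (ψ : QState) : weight (a • ψ) = ‖a‖₊ ^ 2 * weight ψ := by
  have := ip_self (a • ψ)
  rw [ip_smul_left, ip_smul_right, ip_self, ← mul_assoc, mul_comm (starRingEnd ℂ a),
    Complex.mul_conj, Complex.normSq_eq_norm_sq] at this
  have h : ((weight (a • ψ) : ℝ)) = ‖a‖ ^ 2 * weight ψ := by exact_mod_cast this.symm
  ext
  simpa using h

end

section

/-! ### The Walsh–Hadamard transform and amplitude amplification -/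

/-- The sign `(-1) ^ z`. -/
def sgn (z : ZMod 2) : ℝ := if z = 1 then -1 else 1

theorem zmod_two_cases (z : ZMod 2) : z = 0 ∨ z = 1 := by
  revert z; decide

@[simp] theorem sgn_zero : sgn 0 = 1 := by simp [sgn]

@[simp] theorem sgn_one : sgn 1 = -1 := by simp [sgn]

theorem sgn_add (a b : ZMod 2) : sgn (a + b) = sgn a * sgn b := by
  rcases zmod_two_cases a with rfl | rfl <;> rcases zmod_two_cases b with rfl | rfl <;>
    simp [show (1 + 1 : ZMod 2) = 0 from rfl]

theorem sgn_mul_self (a : ZMod 2) : sgn a * sgn a = 1 := by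
  rcases zmod_two_cases a with rfl | rfl <;> simp

theorem sgn_sum {ι : Type*} (s : Finset ι) (a : ι → ZMod 2) :
    sgn (∑ i ∈ s, a i) = ∏ i ∈ s, sgn (a i) := by
  classical
  induction s using Finset.induction_on with
  | empty => simp
  | insert i s hi ih => rw [Finset.sum_insert hi, Finset.prod_insert hi, sgn_add, ih]

theorem add_self_zmod_two {m : ℕ} (v : Fin m → ZMod 2) : v + v = 0 := by
  funext i; exact CharTwo.add_self_eq_zero (v i)

variable {m : ℕ}

/-- If `v i = 1`, translating `u` by the `i`-th unit vector negates every term. -/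
theorem sum_sgn_dotProduct (v : Fin m → ZMod 2) :
    ∑ u : Fin m → ZMod 2, sgn (u ⬝ᵥ v) = if v = 0 then 2 ^ m else 0 := by
  split_ifs with h
  · subst h; simp [dotProduct_zero, ZMod.card]
  · obtain ⟨i, hi⟩ := Function.ne_iff.1 h
    have hi : v i = 1 := (zmod_two_cases (v i)).resolve_left hi
    have := Equiv.sum_comp (Equiv.addRight (Pi.single i (1 : ZMod 2)))
      fun u : Fin m → ZMod 2 => sgn (u ⬝ᵥ v)
    simp only [Equiv.coe_addRight, add_dotProduct, single_dotProduct, hi, sgn_add, mul_one,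
      sgn_one, mul_neg, Finset.sum_neg_distrib] at this
    linarith

/-- The Walsh–Hadamard transform of amplitudes. -/
def had (a : (Fin m → ZMod 2) → ℝ) (v : Fin m → ZMod 2) : ℝ :=
  (1 / Real.sqrt 2) ^ m * ∑ u, a u * sgn (u ⬝ᵥ v)

theorem inv_sqrt_two_pow_sq (m : ℕ) :
    (1 / Real.sqrt 2) ^ m * (1 / Real.sqrt 2) ^ m = (1 / 2 : ℝ) ^ m := by
  rw [← mul_pow, div_mul_div_comm, Real.mul_self_sqrt (by norm_num), one_mul]

theorem sum_had_mul (a b : (Fin m → ZMod 2) → ℝ) : ∑ v, had a v * b v = ∑ v, a v * had b v := by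
  simp only [had, Finset.mul_sum, Finset.sum_mul]
  rw [Finset.sum_comm]
  refine Finset.sum_congr rfl fun u _ => Finset.sum_congr rfl fun v _ => ?_
  rw [dotProduct_comm]; ring

theorem had_had (a : (Fin m → ZMod 2) → ℝ) : had (had a) = a := by
  funext w
  have h1 : ∀ v u : Fin m → ZMod 2, sgn (u ⬝ᵥ v) * sgn (v ⬝ᵥ w) = sgn (v ⬝ᵥ (u + w)) := by
    intro v u
    rw [← sgn_add, dotProduct_comm u v, dotProduct_add]
  have h2 : ∀ u, u + w = 0 ↔ u = w := fun u => by
    rw [← add_left_inj w, add_assoc, add_self_zmod_two, add_zero, zero_add]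
  calc had (had a) w
      = (1 / Real.sqrt 2) ^ m * (1 / Real.sqrt 2) ^ m *
          ∑ u, a u * ∑ v, sgn (v ⬝ᵥ (u + w)) := by
        simp only [had, Finset.mul_sum, Finset.sum_mul]
        rw [Finset.sum_comm]
        refine Finset.sum_congr rfl fun u _ => Finset.sum_congr rfl fun v _ => ?_
        rw [← h1]; ring
    _ = a w := by
        simp only [inv_sqrt_two_pow_sq, sum_sgn_dotProduct, h2, mul_ite, mul_zero,
          Finset.sum_ite_eq', Finset.mem_univ, if_true]
        rw [mul_left_comm, ← mul_pow]; norm_num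

/-- The amplitudes of `|0⟩`. -/
def amp0 (u : Fin m → ZMod 2) : ℝ := if u = 0 then 1 else 0

/-- The operator `H D H`, where `D` is diagonal with entries `φ`. -/
def samp (φ a : (Fin m → ZMod 2) → ℝ) : (Fin m → ZMod 2) → ℝ := had fun u => φ u * had a u

/-- The amplitudes of the sampled state. -/
def psi (φ : (Fin m → ZMod 2) → ℝ) : (Fin m → ZMod 2) → ℝ := samp φ amp0

theorem samp_samp {φ : (Fin m → ZMod 2) → ℝ} (hφ : ∀ u, φ u * φ u = 1)
    (a : (Fin m → ZMod 2) → ℝ) : samp φ (samp φ a) = a := by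
  simp only [samp, had_had, ← mul_assoc, hφ, one_mul]

theorem sum_samp_mul (φ a b : (Fin m → ZMod 2) → ℝ) :
    ∑ v, samp φ a v * b v = ∑ v, a v * samp φ b v := by
  calc ∑ v, samp φ a v * b v = ∑ v, φ v * had a v * had b v := sum_had_mul _ _
    _ = ∑ v, had a v * (φ v * had b v) := Finset.sum_congr rfl fun v _ => by ring
    _ = ∑ v, a v * samp φ b v := sum_had_mul _ _

theorem samp_sub_smul (φ a b : (Fin m → ZMod 2) → ℝ) (c : ℝ) :
    samp φ (fun u => a u - c * b u) = fun u => samp φ a u - c * samp φ b u := by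
  have : ∀ a b : (Fin m → ZMod 2) → ℝ, ∀ v,
      had (fun u => a u - c * b u) v = had a v - c * had b v := by
    intro a b v
    simp only [had, sub_mul, Finset.sum_sub_distrib, mul_assoc, ← Finset.mul_sum]
    ring
  funext v
  simp only [samp, this, mul_sub, mul_left_comm _ c]

/-- The sign flip of the amplitude of `|0⟩`. -/
def refl0 (a : (Fin m → ZMod 2) → ℝ) (u : Fin m → ZMod 2) : ℝ := if u = 0 then -a u else a u

/-- The self-adjoint involution `samp φ` takes `|0⟩` to `ψ = psi φ`, so it conjugates the reflection
in `|0⟩` to `I - 2 |ψ⟩⟨ψ|`. -/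
theorem samp_refl0_samp {φ : (Fin m → ZMod 2) → ℝ} (hφ : ∀ u, φ u * φ u = 1)
    (a : (Fin m → ZMod 2) → ℝ) :
    samp φ (refl0 (samp φ a)) = fun u => a u - 2 * (∑ v, psi φ v * a v) * psi φ u := by
  have h : samp φ a 0 = ∑ v, psi φ v * a v := by
    rw [psi, sum_samp_mul]
    simp [amp0]
  have : refl0 (samp φ a) = fun u => samp φ a u - 2 * (∑ v, psi φ v * a v) * amp0 u := by
    funext u
    simp only [refl0, amp0, ← h]
    split_ifs with hu
    · rw [hu]; ring
    · ring
  rw [this, samp_sub_smul, samp_samp hφ]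
  rfl

/-- One step of amplitude amplification; the good vectors `u` satisfy `u ⬝ᵥ r = 1`. -/
def grover (φ : (Fin m → ZMod 2) → ℝ) (r : Fin m → ZMod 2) (a : (Fin m → ZMod 2) → ℝ) :
    (Fin m → ZMod 2) → ℝ :=
  samp φ (refl0 (samp φ fun u => sgn (u ⬝ᵥ r) * a u))

/-! ### The distribution of the sampled vector -/

theorem had_amp0 (v : Fin m → ZMod 2) : had amp0 v = (1 / Real.sqrt 2) ^ m := by
  simp [had, amp0]

theorem psi_apply (φ : (Fin m → ZMod 2) → ℝ) (v : Fin m → ZMod 2) :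
    psi φ v = (1 / 2) ^ m * ∑ u, φ u * sgn (u ⬝ᵥ v) := by
  have : ∀ u, φ u * had amp0 u * sgn (u ⬝ᵥ v) = (1 / Real.sqrt 2) ^ m * (φ u * sgn (u ⬝ᵥ v)) :=
    fun u => by rw [had_amp0]; ring
  rw [psi, samp, had]
  simp only [this]
  rw [← Finset.mul_sum, ← mul_assoc, inv_sqrt_two_pow_sq]

/-- The transform turns multiplication by the character `sgn (v ⬝ᵥ r)` into translation by `r`. As
it is self-adjoint, the mean of the character under sampling becomes the autocorrelation of the
phases at `r`. -/
theorem sum_psi_sq_sgn (φ : (Fin m → ZMod 2) → ℝ) (r : Fin m → ZMod 2) :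
    ∑ v, psi φ v ^ 2 * sgn (v ⬝ᵥ r) = (1 / 2) ^ m * ∑ u, φ u * φ (u + r) := by
  have key : had (fun v => sgn (v ⬝ᵥ r) * psi φ v) =
      fun u => (1 / Real.sqrt 2) ^ m * φ (u + r) := by
    funext u
    have : had (fun v => sgn (v ⬝ᵥ r) * psi φ v) u = had (psi φ) (u + r) := by
      simp only [had]
      congr 1
      refine Finset.sum_congr rfl fun v _ => ?_
      rw [dotProduct_add, sgn_add]; ring
    rw [this, psi, samp, had_had]
    simp only [had_amp0]; ring
  calc ∑ v, psi φ v ^ 2 * sgn (v ⬝ᵥ r)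
      = ∑ v, psi φ v * (sgn (v ⬝ᵥ r) * psi φ v) :=
        Finset.sum_congr rfl fun v _ => by ring
    _ = ∑ u, (φ u * had amp0 u) * had (fun v => sgn (v ⬝ᵥ r) * psi φ v) u := by
        nth_rewrite 1 [psi]
        rw [samp, sum_had_mul]
    _ = _ := by
        rw [key, Finset.mul_sum]
        refine Finset.sum_congr rfl fun u _ => ?_
        rw [had_amp0, ← inv_sqrt_two_pow_sq]; ring

theorem sum_psi_sq {φ : (Fin m → ZMod 2) → ℝ} (hφ : ∀ u, φ u * φ u = 1) :
    ∑ v, psi φ v ^ 2 = 1 := by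
  have := sum_psi_sq_sgn φ 0
  simp only [dotProduct_zero, sgn_zero, mul_one, add_zero, hφ] at this
  rw [this]
  simp [ZMod.card]

/-- The probability of sampling a vector `v` with `v ⬝ᵥ r = 1`. -/
def goodProb (φ : (Fin m → ZMod 2) → ℝ) (r : Fin m → ZMod 2) : ℝ :=
  ∑ v, if v ⬝ᵥ r = 1 then psi φ v ^ 2 else 0

/-- The indicator of `v ⬝ᵥ r = 1` is `(1 - sgn (v ⬝ᵥ r)) / 2`. -/
theorem goodProb_eq {φ : (Fin m → ZMod 2) → ℝ} (hφ : ∀ u, φ u * φ u = 1)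
    (r : Fin m → ZMod 2) :
    goodProb φ r = (1 - (1 / 2) ^ m * ∑ u, φ u * φ (u + r)) / 2 := by
  rw [← sum_psi_sq_sgn, ← sum_psi_sq hφ, ← Finset.sum_sub_distrib, goodProb, Finset.sum_div]
  refine Finset.sum_congr rfl fun v _ => ?_
  rcases zmod_two_cases (v ⬝ᵥ r) with h | h <;> simp [h]

/-- The state stays in the span of the good and the bad part of `psi φ`, where a step is a product
of two reflections: up to sign, a rotation by `2 θ`. The factor `(-1) ^ j` arises because the second
reflection is `I - 2 |ψ⟩⟨ψ|` and not its negative. Multiplying by `sin θ` and `cos θ` avoids a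
division, as one of the two parts may vanish. -/
theorem grover_iterate {φ : (Fin m → ZMod 2) → ℝ} (hφ : ∀ u, φ u * φ u = 1)
    (r : Fin m → ZMod 2) {θ : ℝ} (hθ : Real.sin θ ^ 2 = goodProb φ r) (j : ℕ) :
    ∃ α β : ℝ, ((grover φ r)^[j] (psi φ) = fun u => (if u ⬝ᵥ r = 1 then α else β) * psi φ u) ∧
      α * Real.sin θ = (-1) ^ j * Real.sin ((2 * j + 1) * θ) ∧
      β * Real.cos θ = (-1) ^ j * Real.cos ((2 * j + 1) * θ) := by
  induction j with
  | zero => exact ⟨1, 1, by simp, by simp, by simp⟩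
  | succ j ih =>
    obtain ⟨α, β, h, hα, hβ⟩ := ih
    have hbad : Real.cos θ ^ 2 = ∑ v, if v ⬝ᵥ r = 1 then 0 else psi φ v ^ 2 := by
      have : goodProb φ r + (∑ v, if v ⬝ᵥ r = 1 then 0 else psi φ v ^ 2) = 1 := by
        rw [goodProb, ← Finset.sum_add_distrib, ← sum_psi_sq hφ]
        refine Finset.sum_congr rfl fun v _ => ?_
        split_ifs <;> simp
      rw [Real.cos_sq', hθ]; linarith
    -- `c` is the overlap of `psi φ` with the state after the sign flip of the good part.
    set c := -α * Real.sin θ ^ 2 + β * Real.cos θ ^ 2 with hc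
    have hsum : ∑ v, psi φ v * (sgn (v ⬝ᵥ r) * ((if v ⬝ᵥ r = 1 then α else β) * psi φ v)) = c := by
      rw [hc, hθ, hbad, goodProb, Finset.mul_sum, Finset.mul_sum, ← Finset.sum_add_distrib]
      refine Finset.sum_congr rfl fun v _ => ?_
      rcases zmod_two_cases (v ⬝ᵥ r) with h | h <;> simp [h] <;> ring
    have hc' : c = (-1) ^ j * Real.cos ((2 * j + 2) * θ) := by
      have : c = -(α * Real.sin θ) * Real.sin θ + (β * Real.cos θ) * Real.cos θ := by rw [hc]; ring
      rw [this, hα, hβ, show (2 * (j : ℝ) + 2) * θ = (2 * j + 1) * θ + θ by ring, Real.cos_add]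
      ring
    have e3 : (2 * ((j + 1 : ℕ) : ℝ) + 1) * θ = (2 * j + 2) * θ + θ := by push_cast; ring
    have e1 : (2 * (j : ℝ) + 1) * θ = (2 * j + 2) * θ - θ := by ring
    refine ⟨-α - 2 * c, β - 2 * c, ?_, ?_, ?_⟩
    · rw [Function.iterate_succ_apply', h, grover, samp_refl0_samp hφ, hsum]
      funext u
      rcases zmod_two_cases (u ⬝ᵥ r) with h | h <;> simp [h] <;> ring
    · rw [e3, Real.sin_add, sub_mul, neg_mul, hα, e1, Real.sin_sub, hc']; ring
    · rw [e3, Real.cos_add, sub_mul, hβ, e1, Real.cos_sub, hc']; ring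

/-- The probability of measuring a good vector after `j` steps of amplitude amplification. -/
theorem sum_grover_good {φ : (Fin m → ZMod 2) → ℝ} (hφ : ∀ u, φ u * φ u = 1)
    (r : Fin m → ZMod 2) {θ : ℝ} (hθ : Real.sin θ ^ 2 = goodProb φ r) (j : ℕ) :
    (∑ u, if u ⬝ᵥ r = 1 then (grover φ r)^[j] (psi φ) u ^ 2 else 0) =
      Real.sin ((2 * j + 1) * θ) ^ 2 := by
  obtain ⟨α, β, h, hα, -⟩ := grover_iterate hφ r hθ j
  have : Real.sin ((2 * j + 1) * θ) ^ 2 = (α * Real.sin θ) ^ 2 := by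
    rw [hα, mul_pow, ← pow_mul, mul_comm j 2, pow_mul]; norm_num
  rw [this, mul_pow, hθ, goodProb, Finset.mul_sum, h]
  refine Finset.sum_congr rfl fun u _ => ?_
  by_cases hu : u ⬝ᵥ r = 1
  · simp only [hu, if_true]; ring
  · simp only [hu, if_false, mul_zero]

/-- The angle of amplitude amplification. -/
def angle (φ : (Fin m → ZMod 2) → ℝ) (r : Fin m → ZMod 2) : ℝ :=
  Real.arcsin (Real.sqrt (goodProb φ r))

theorem goodProb_nonneg (φ : (Fin m → ZMod 2) → ℝ) (r : Fin m → ZMod 2) : 0 ≤ goodProb φ r :=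
  Finset.sum_nonneg fun v _ => by split_ifs <;> positivity

theorem sin_angle {φ : (Fin m → ZMod 2) → ℝ} (hφ : ∀ u, φ u * φ u = 1) (r : Fin m → ZMod 2) :
    Real.sin (angle φ r) = Real.sqrt (goodProb φ r) := by
  refine Real.sin_arcsin (by linarith [Real.sqrt_nonneg (goodProb φ r)]) (Real.sqrt_le_one.2 ?_)
  rw [← sum_psi_sq hφ]
  exact Finset.sum_le_sum fun v _ => by split_ifs <;> [exact le_rfl; positivity]

theorem sin_angle_sq {φ : (Fin m → ZMod 2) → ℝ} (hφ : ∀ u, φ u * φ u = 1) (r : Fin m → ZMod 2) :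
    Real.sin (angle φ r) ^ 2 = goodProb φ r := by
  rw [sin_angle hφ, Real.sq_sqrt (goodProb_nonneg φ r)]

/-- The iterates are pointwise multiples of `psi φ`. Hence amplified samples are still orthogonal to
the solution. -/
theorem grover_iterate_eq_zero {φ : (Fin m → ZMod 2) → ℝ} (hφ : ∀ u, φ u * φ u = 1)
    (r : Fin m → ZMod 2) {u : Fin m → ZMod 2} (hu : psi φ u = 0) (j : ℕ) :
    (grover φ r)^[j] (psi φ) u = 0 := by
  obtain ⟨α, β, h, -⟩ := grover_iterate hφ r (sin_angle_sq hφ r) j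
  simp [h, hu]

theorem samp_sq_sum {φ : (Fin m → ZMod 2) → ℝ} (hφ : ∀ u, φ u * φ u = 1)
    (a : (Fin m → ZMod 2) → ℝ) : ∑ u, samp φ a u ^ 2 = ∑ u, a u ^ 2 := by
  simp only [pow_two]
  rw [sum_samp_mul, samp_samp hφ]

theorem sum_grover_sq {φ : (Fin m → ZMod 2) → ℝ} (hφ : ∀ u, φ u * φ u = 1)
    (r : Fin m → ZMod 2) (j : ℕ) : ∑ u, (grover φ r)^[j] (psi φ) u ^ 2 = 1 := by
  induction j with
  | zero => exact sum_psi_sq hφ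
  | succ j ih =>
    rw [Function.iterate_succ_apply', grover, samp_sq_sum hφ, ← ih]
    have : ∀ a : (Fin m → ZMod 2) → ℝ, ∑ u, refl0 a u ^ 2 = ∑ u, a u ^ 2 := fun a =>
      Finset.sum_congr rfl fun u _ => by simp only [refl0]; split_ifs <;> ring
    rw [this, samp_sq_sum hφ]
    exact Finset.sum_congr rfl fun u _ => by rw [mul_pow, pow_two, sgn_mul_self, one_mul]

/-- Translation by `s` preserves `φ` and negates the character of `v`, so the Fourier sum equals its
own negative. -/
theorem psi_eq_zero {φ : (Fin m → ZMod 2) → ℝ} {s : Fin m → ZMod 2} (hs : ∀ u, φ (u + s) = φ u)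
    {v : Fin m → ZMod 2} (hv : v ⬝ᵥ s ≠ 0) : psi φ v = 0 := by
  have hv : s ⬝ᵥ v = 1 := by
    rw [dotProduct_comm]; exact (zmod_two_cases _).resolve_left hv
  have := Equiv.sum_comp (Equiv.addRight s) fun u : Fin m → ZMod 2 => φ u * sgn (u ⬝ᵥ v)
  simp only [Equiv.coe_addRight, hs, add_dotProduct, hv, sgn_add, sgn_one, mul_neg, mul_one,
    Finset.sum_neg_distrib] at this
  rw [psi_apply]
  have h0 : ∑ u : Fin m → ZMod 2, φ u * sgn (u ⬝ᵥ v) = 0 := by linarith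
  rw [h0, mul_zero]

/-! ### The sampled state of an instance -/

variable {n : ℕ}

/-- The function on `n + 1` bits that is `f` where the last bit is `0`, and `g` where it is `1`. -/
def glue (f g : (Fin n → ZMod 2) → ZMod 2) (u : Fin (n + 1) → ZMod 2) : ZMod 2 :=
  if u (Fin.last n) = 1 then g (Fin.init u) else f (Fin.init u)

/-- The phases of the sampled state. -/
def phase (f g : (Fin n → ZMod 2) → ZMod 2) (u : Fin (n + 1) → ZMod 2) : ℝ := sgn (glue f g u)

theorem phase_mul_self (f g : (Fin n → ZMod 2) → ZMod 2) (u : Fin (n + 1) → ZMod 2) :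
    phase f g u * phase f g u = 1 := sgn_mul_self _

variable {f g : (Fin n → ZMod 2) → ZMod 2} {s : Fin n → ZMod 2}

/-- The solution, followed by the bit `1`. -/
def extend (s : Fin n → ZMod 2) : Fin (n + 1) → ZMod 2 := Fin.snoc s 1

theorem phase_add_extend (h : IsInstance f g s) (u : Fin (n + 1) → ZMod 2) :
    phase f g (u + extend s) = phase f g u := by
  have h1 : (u + extend s) (Fin.last n) = u (Fin.last n) + 1 := by simp [extend]
  have h2 : Fin.init (u + extend s) = Fin.init u + s := by
    funext i; simp [Fin.init, extend]
  unfold phase glue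
  rw [h1, h2]
  rcases zmod_two_cases (u (Fin.last n)) with hu | hu
  · simp [hu, h.shift, add_assoc, add_self_zmod_two]
  · simp [hu, h.shift, show (1 + 1 : ZMod 2) = 0 from rfl]

/-- A shift with last bit `0` preserves both halves of the cube. Since `g` is a translate of `f`,
each half contributes the autocorrelation of `f`, which after normalization is `1` minus twice the
influence. -/
theorem goodProb_phase (h : IsInstance f g s) {r : Fin (n + 1) → ZMod 2}
    (hr : r (Fin.last n) = 0) : goodProb (phase f g) r = influence f (Fin.init r) := by
  have hsum : ∑ u, phase f g u * phase f g (u + r) =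
      2 * ∑ x : Fin n → ZMod 2, sgn (f x) * sgn (f (x + Fin.init r)) := by
    have e := Equiv.sum_comp (Fin.snocEquiv fun _ : Fin (n + 1) => ZMod 2)
      fun u => phase f g u * phase f g (u + r)
    rw [← e, Fintype.sum_prod_type]
    have hz : ∀ F : ZMod 2 → ℝ, ∑ z, F z = F 0 + F 1 := fun F => Fin.sum_univ_two F
    have hlast : ∀ (z : ZMod 2) (x : Fin n → ZMod 2),
        ((Fin.snoc x z : Fin (n + 1) → ZMod 2) + r) (Fin.last n) = z := by
      intro z x; simp [hr]
    have hinit : ∀ (z : ZMod 2) (x : Fin n → ZMod 2),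
        Fin.init ((Fin.snoc x z : Fin (n + 1) → ZMod 2) + r) = x + Fin.init r := by
      intro z x; funext i; simp [Fin.init]
    have e0 : ∀ (z : ZMod 2) (x : Fin n → ZMod 2),
        (Fin.snocEquiv fun _ : Fin (n + 1) => ZMod 2) (z, x) = Fin.snoc x z := fun _ _ => rfl
    have eg := Equiv.sum_comp (Equiv.addRight s)
      fun x : Fin n → ZMod 2 => sgn (f x) * sgn (f (x + Fin.init r))
    simp only [Equiv.coe_addRight] at eg
    rw [hz, two_mul]
    congr 1
    · simp only [e0, phase, glue, hlast, hinit, Fin.snoc_last, Fin.init_snoc]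
      simp
    · rw [← eg]
      simp only [e0, phase, glue, hlast, hinit, Fin.snoc_last, Fin.init_snoc, h.shift, if_true]
      exact Finset.sum_congr rfl fun x _ => by rw [add_right_comm]
  have hcount : ∑ x : Fin n → ZMod 2, sgn (f x) * sgn (f (x + Fin.init r)) =
      2 ^ n - 2 * ((Finset.univ.filter fun x => f x ≠ f (x + Fin.init r)).card : ℝ) := by
    have : (2 : ℝ) ^ n = ∑ x : Fin n → ZMod 2, 1 := by simp [ZMod.card]
    rw [this, Finset.card_filter, Nat.cast_sum, Finset.mul_sum, ← Finset.sum_sub_distrib]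
    refine Finset.sum_congr rfl fun x _ => ?_
    rcases zmod_two_cases (f x) with hx | hx <;>
      rcases zmod_two_cases (f (x + Fin.init r)) with hy | hy <;> simp [hx, hy] <;> norm_num
  rw [goodProb_eq (phase_mul_self f g), hsum, hcount, influence]
  have : (Fintype.card (Fin n → ZMod 2) : ℝ) = 2 ^ n := by simp [ZMod.card]
  rw [this, pow_succ, div_pow, one_pow]
  field_simp
  ring

theorem minInfluence_le (f : (Fin n → ZMod 2) → ZMod 2) {v : Fin n → ZMod 2} (hv : v ≠ 0) :
    minInfluence f ≤ influence f v := by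
  refine ciInf_le ?_ (⟨v, hv⟩ : {v : Fin n → ZMod 2 // v ≠ 0})
  exact (Set.finite_range _).bddBelow

end

section

/-! ### The quantum subroutines on basis states -/

variable {m : ℕ}

/-- The basis state in which the qubits `1, …, m` hold `u` and all others are `0`. -/
def enc (u : Fin m → ZMod 2) : Finset ℕ :=
  (Finset.univ.filter fun i : Fin m => u i = 1).image fun i : Fin m => (i : ℕ) + 1

theorem mem_enc {u : Fin m → ZMod 2} {j : ℕ} :
    j ∈ enc u ↔ ∃ i : Fin m, u i = 1 ∧ (i : ℕ) + 1 = j := by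
  simp [enc]

theorem succ_mem_enc {u : Fin m → ZMod 2} {i : Fin m} : (i : ℕ) + 1 ∈ enc u ↔ u i = 1 := by
  rw [mem_enc]
  refine ⟨fun ⟨j, hj, h⟩ => ?_, fun h => ⟨i, h, rfl⟩⟩
  rwa [← Fin.ext (Nat.succ_injective h)]

theorem enc_subset (u : Fin m → ZMod 2) : enc u ⊆ Finset.Icc 1 m := by
  intro j hj
  obtain ⟨i, -, rfl⟩ := mem_enc.1 hj
  simp only [Finset.mem_Icc]; omega

theorem notMem_enc {u : Fin m → ZMod 2} {j : ℕ} (hj : j = 0 ∨ m < j) : j ∉ enc u := fun h => by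
  have := Finset.mem_Icc.1 (enc_subset u h)
  omega

theorem enc_injective : Function.Injective (enc : (Fin m → ZMod 2) → Finset ℕ) := by
  intro u v h
  funext i
  have := succ_mem_enc (u := u) (i := i)
  rw [h, succ_mem_enc] at this
  rcases zmod_two_cases (u i) with hu | hu <;> rcases zmod_two_cases (v i) with hv | hv <;>
    simp_all

theorem enc_zero : enc (0 : Fin m → ZMod 2) = ∅ := by simp [enc]

theorem image_enc_univ : Finset.univ.image (enc : (Fin m → ZMod 2) → Finset ℕ) =
    (Finset.Icc 1 m).powerset := by
  ext x
  simp only [Finset.mem_image, Finset.mem_univ, true_and, Finset.mem_powerset]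
  refine ⟨fun ⟨u, hu⟩ => hu ▸ enc_subset u, fun hx => ?_⟩
  refine ⟨fun i => if (i : ℕ) + 1 ∈ x then 1 else 0, ?_⟩
  ext j
  rw [mem_enc]
  constructor
  · rintro ⟨i, hi, rfl⟩
    by_contra h
    simp [h] at hi
  · intro hj
    have := Finset.mem_Icc.1 (hx hj)
    refine ⟨⟨j - 1, by omega⟩, ?_, by simp only; omega⟩
    simp [Nat.sub_add_cancel this.1, hj]

theorem sum_powerset_enc {M : Type*} [AddCommMonoid M] (F : Finset ℕ → M) :
    ∑ x ∈ (Finset.Icc 1 m).powerset, F x = ∑ u : Fin m → ZMod 2, F (enc u) := by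
  rw [← image_enc_univ, Finset.sum_image fun u _ v _ h => enc_injective h]

/-- The state vector with amplitudes `a` on the qubits `1, …, m`. -/
def vec (a : (Fin m → ZMod 2) → ℝ) : QState := ∑ u, (a u : ℂ) • ket (enc u)

theorem vec_amp0 : vec (amp0 : (Fin m → ZMod 2) → ℝ) = ket ∅ := by
  rw [vec, Finset.sum_eq_single 0]
  · simp [amp0, enc_zero]
  · intro u _ hu; simp [amp0, hu]
  · simp

theorem map_vec (L : QState →ₗ[ℂ] QState) (a : (Fin m → ZMod 2) → ℝ) :
    L (vec a) = ∑ u, (a u : ℂ) • L (ket (enc u)) := by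
  simp [vec]

theorem map_vec_phase {L : QState →ₗ[ℂ] QState} {d : (Fin m → ZMod 2) → ℝ}
    (hL : ∀ u, L (ket (enc u)) = (d u : ℂ) • ket (enc u)) (a : (Fin m → ZMod 2) → ℝ) :
    L (vec a) = vec fun u => d u * a u := by
  rw [map_vec, vec]
  refine Finset.sum_congr rfl fun u _ => ?_
  rw [hL, smul_smul, Complex.ofReal_mul, mul_comm]

/-- Hadamard gates on the qubits `m, …, 1`. -/
def hadOp : ℕ → QState →ₗ[ℂ] QState
  | 0 => .id
  | i + 1 => hadOp i ∘ₗ Gate.H.apply (i + 1)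

/-- The basis state is arbitrary because the first gate already produces two of them. The induction
splits the subsets `y` by whether they contain `k + 1`. -/
theorem hadOp_ket (k : ℕ) (x : Finset ℕ) :
    hadOp k (ket x) = (((1 / Real.sqrt 2 : ℝ) ^ k : ℝ) : ℂ) • ∑ y ∈ (Finset.Icc 1 k).powerset,
      (∏ i ∈ y, if i ∈ x then (-1 : ℂ) else 1) • ket (y ∪ (x \ Finset.Icc 1 k)) := by
  induction k generalizing x with
  | zero => simp [hadOp]
  | succ k ih =>
    have hk : k + 1 ∉ Finset.Icc 1 k := by simp
    have hI : Finset.Icc 1 (k + 1) = insert (k + 1) (Finset.Icc 1 k) := by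
      ext; simp; omega
    rw [hI, Finset.sum_powerset_insert hk, hadOp, LinearMap.comp_apply, Gate.apply, ofBasis_ket,
      map_smul, map_add, map_smul, ih, ih, pow_succ', Complex.ofReal_mul, mul_smul, smul_comm _
      ((((1 / Real.sqrt 2 : ℝ) ^ k : ℝ) : ℂ)), ← smul_add, Finset.smul_sum]
    congr 3
    · refine Finset.sum_congr rfl fun y hy => ?_
      have hy := Finset.mem_powerset.1 hy
      congr 1
      · refine Finset.prod_congr rfl fun i hi => ?_
        have : i ≠ k + 1 := fun h => hk (h ▸ hy hi)
        simp [this]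
      · congr 1
        ext j; simp only [Finset.mem_union, Finset.mem_sdiff, Finset.mem_erase, Finset.mem_insert]
        tauto
    · refine Finset.sum_congr rfl fun y hy => ?_
      have hy := Finset.mem_powerset.1 hy
      rw [Finset.prod_insert fun h => hk (hy h), mul_smul]
      congr 2
      · refine Finset.prod_congr rfl fun i hi => ?_
        have : i ≠ k + 1 := fun h => hk (h ▸ hy hi)
        simp [this]
      · congr 1
        ext j; simp only [Finset.mem_union, Finset.mem_sdiff, Finset.mem_insert]
        by_cases h : j = k + 1
        · subst h; simp
        · simp [h]

theorem hadOp_vec (a : (Fin m → ZMod 2) → ℝ) : hadOp m (vec a) = vec (had a) := by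
  have h1 : ∀ u v : Fin m → ZMod 2,
      (∏ i ∈ enc v, if i ∈ enc u then (-1 : ℂ) else 1) = ((sgn (u ⬝ᵥ v) : ℝ) : ℂ) := by
    intro u v
    rw [enc, Finset.prod_image (by intro i _ j _ h; exact Fin.ext (Nat.succ_injective h)),
      dotProduct, sgn_sum, Finset.prod_filter, Complex.ofReal_prod]
    refine Finset.prod_congr rfl fun i _ => ?_
    simp only [succ_mem_enc]
    rcases zmod_two_cases (u i) with hu | hu <;> rcases zmod_two_cases (v i) with hv | hv <;>
      simp [hu, hv]
  have h2 : ∀ u v : Fin m → ZMod 2, enc v ∪ (enc u \ Finset.Icc 1 m) = enc v := by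
    intro u v
    rw [Finset.sdiff_eq_empty_iff_subset.2 (enc_subset u), Finset.union_empty]
  rw [map_vec, vec]
  simp only [hadOp_ket, sum_powerset_enc, h1, h2, Finset.smul_sum, had]
  rw [Finset.sum_comm]
  refine Finset.sum_congr rfl fun v _ => ?_
  rw [Complex.ofReal_mul, Complex.ofReal_sum, mul_smul, Finset.sum_smul, Finset.smul_sum]
  refine Finset.sum_congr rfl fun u _ => ?_
  rw [Complex.ofReal_mul, mul_smul, smul_comm]

/-- Sign flips of those of the qubits `m, …, 1` where `b` is nonzero. -/
def signOp (b : ℕ → ℕ) : ℕ → QState →ₗ[ℂ] QState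
  | 0 => .id
  | i + 1 => signOp b i ∘ₗ (if b i ≠ 0 then Gate.Z.apply (i + 1) else .id)

theorem signOp_ket (b : ℕ → ℕ) (k : ℕ) (x : Finset ℕ) :
    signOp b k (ket x) =
      (∏ i ∈ Finset.range k, if b i ≠ 0 ∧ i + 1 ∈ x then (-1 : ℂ) else 1) • ket x := by
  induction k with
  | zero => simp [signOp]
  | succ k ih =>
    rw [signOp, LinearMap.comp_apply, Finset.prod_range_succ, mul_comm]
    by_cases h : b k = 0
    · simp [h, ih]
    · simp only [h, ne_eq, not_false_eq_true, if_true, Gate.apply, ofBasis_ket, map_smul, ih,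
        true_and, mul_smul]

theorem signOp_vec {b : ℕ → ℕ} {r : Fin m → ZMod 2} (hr : ∀ i, r i = 1 ↔ b i ≠ 0)
    (a : (Fin m → ZMod 2) → ℝ) :
    signOp b m (vec a) = vec fun u => sgn (u ⬝ᵥ r) * a u := by
  refine map_vec_phase (fun u => ?_) a
  rw [signOp_ket, dotProduct, sgn_sum, Finset.prod_range, Complex.ofReal_prod]
  congr 1
  refine Finset.prod_congr rfl fun i _ => ?_
  simp only [succ_mem_enc, ← hr]
  rcases zmod_two_cases (u i) with hu | hu <;> rcases zmod_two_cases (r i) with hv | hv <;>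
    simp [hu, hv]

/-- One rung of the ladder that finds out whether the qubits `1, …, m` are all `0`. -/
def rung (m i : ℕ) : QState →ₗ[ℂ] QState :=
  Gate.X.apply i ∘ₗ toffoliGate i (m + 1 + i) (m + i) ∘ₗ Gate.X.apply i

/-- The rungs `k, …, 1`. -/
def ladder (m : ℕ) : ℕ → QState →ₗ[ℂ] QState
  | 0 => .id
  | k + 1 => ladder m k ∘ₗ rung m (k + 1)

/-- The rungs `1, …, k`. -/
def ladderInv (m : ℕ) : ℕ → QState →ₗ[ℂ] QState
  | 0 => .id
  | k + 1 => rung m (k + 1) ∘ₗ ladderInv m k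

theorem X_ket (i : ℕ) (x : Finset ℕ) : Gate.X.apply i (ket x) = ket (flip i x) := by
  simp [Gate.apply]

theorem Z_ket (i : ℕ) (x : Finset ℕ) :
    Gate.Z.apply i (ket x) = (if i ∈ x then (-1 : ℂ) else 1) • ket x := by
  simp only [Gate.apply, ofBasis_ket]

theorem linearMap_ext_ket {L L' : QState →ₗ[ℂ] QState} (h : ∀ x, L (ket x) = L' (ket x)) :
    L = L' := by
  refine Finsupp.lhom_ext fun x a => ?_
  have : Finsupp.single x a = a • ket x := by simp [ket]
  rw [this, map_smul, map_smul, h]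

theorem rung_rung (m i : ℕ) (ψ : QState) : rung m i (rung m i ψ) = ψ := by
  have : rung m i ∘ₗ rung m i = .id := by
    refine linearMap_ext_ket fun x => ?_
    simp only [rung, LinearMap.comp_apply, X_ket, toffoliGate, ofBasis_ket, flip_flip,
      LinearMap.id_apply]
    split_ifs <;> simp_all [flip_flip, mem_flip]
  exact LinearMap.congr_fun this ψ

theorem ladderInv_ladder (m k : ℕ) (ψ : QState) : ladderInv m k (ladder m k ψ) = ψ := by
  induction k generalizing ψ with
  | zero => rfl
  | succ k ih => simp only [ladder, ladderInv, LinearMap.comp_apply, ih, rung_rung]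

/-- Rung `i` negates the ancilla `m + i` exactly if qubit `i` is `0` and the ancilla `m + 1 + i` is
`1`. So before the rungs `k, …, 1` the ancilla `m + 1 + k` records that all qubits above `k` are
`0`, and the lower ancillas are still clear, by the agreement of `y` with `x`. Qubit `m + 1` ends up
recording that all are `0`. -/
theorem ladder_ket (x : Finset ℕ) (hx : x ⊆ Finset.Icc 1 m) (k : ℕ) (hk : k ≤ m)
    (y : Finset ℕ) (hy : ∀ j < m + 1 + k, j ∈ y ↔ j ∈ x)
    (hyk : m + 1 + k ∈ y ↔ ∀ j ∈ x, j ≤ k) :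
    ∃ y', ladder m k (ket y) = ket y' ∧ (m + 1 ∈ y' ↔ x = ∅) := by
  induction k generalizing y with
  | zero =>
    refine ⟨y, rfl, hyk.trans ⟨fun h => ?_, fun h => by simp [h]⟩⟩
    refine Finset.eq_empty_of_forall_notMem fun j hj => ?_
    have := (Finset.mem_Icc.1 (hx hj)).1
    have := h j hj
    omega
  | succ k ih =>
    have hnot : m + (k + 1) ∉ x := fun h => by
      have := (Finset.mem_Icc.1 (hx h)).2
      omega
    rw [ladder, LinearMap.comp_apply, rung, LinearMap.comp_apply, LinearMap.comp_apply, X_ket,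
      toffoliGate, ofBasis_ket, X_ket]
    have h1 : k + 1 ≠ m + (k + 1) := by omega
    have h2 : m + 1 + (k + 1) ≠ m + (k + 1) := by omega
    have h3 : m + 1 + (k + 1) ≠ k + 1 := by omega
    simp only [mem_flip, if_true, h1, h2, h3, if_false, ne_eq, not_false_eq_true, true_and]
    refine ih (by omega) _ ?_ ?_
    · intro j hj
      have h4 : j ≠ m + (k + 1) := by omega
      rw [← hy j (by omega), mem_flip]
      split_ifs with h5 h6 <;> by_cases h7 : j = k + 1 <;> simp_all [mem_flip]
    · have h4 : m + 1 + k = m + (k + 1) := by omega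
      have h5 : m + (k + 1) ≠ k + 1 := by omega
      have h6 : m + (k + 1) ∉ y := fun h => hnot ((hy _ (by omega)).1 h)
      rw [h4, mem_flip, if_neg h5]
      simp only [hy (k + 1) (by omega), hyk]
      have h7 : (∀ j ∈ x, j ≤ k) ↔ k + 1 ∉ x ∧ ∀ j ∈ x, j ≤ k + 1 := by
        constructor
        · exact fun h => ⟨fun h' => absurd (h _ h') (by omega), fun j hj => (h j hj).trans (by omega)⟩
        · rintro ⟨h, h'⟩ j hj
          have := h' j hj
          have : j ≠ k + 1 := fun e => h (e ▸ hj)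
          omega
      rw [h7]
      split_ifs with h8
      · simp only [mem_flip, if_true, if_neg h5, h6, not_false_eq_true, true_iff]
        exact h8
      · simp only [mem_flip, if_neg h5, h6, false_iff]
        exact h8

/-- The sign flip of `|0⟩` on the qubits `1, …, m`. -/
def reflOp (m : ℕ) : QState →ₗ[ℂ] QState :=
  Gate.X.apply (2 * m + 1) ∘ₗ ladderInv m m ∘ₗ Gate.Z.apply (m + 1) ∘ₗ ladder m m ∘ₗ
    Gate.X.apply (2 * m + 1)

/-- On a basis state the ladder yields a single basis state, so `Z` only contributes a scalar and
the inverse ladder clears the ancillas again. -/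
theorem reflOp_vec (a : (Fin m → ZMod 2) → ℝ) : reflOp m (vec a) = vec (refl0 a) := by
  have : refl0 a = fun u => (if u = 0 then -1 else 1) * a u := by
    funext u; simp only [refl0]; split_ifs <;> ring
  rw [this]
  refine map_vec_phase (fun u => ?_) a
  have hx := enc_subset u
  have hnot : m + 1 + m ∉ enc u := notMem_enc (by omega)
  obtain ⟨y', hy', h⟩ := ladder_ket (enc u) hx m le_rfl (flip (2 * m + 1) (enc u))
    (fun j hj => by rw [mem_flip, if_neg (by omega)])
    (by
      rw [mem_flip, if_pos (by omega), show 2 * m + 1 = m + 1 + m by ring]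
      simp only [hnot, not_false_eq_true, true_iff]
      exact fun j hj => (Finset.mem_Icc.1 (hx hj)).2)
  rw [reflOp]
  simp only [LinearMap.comp_apply, X_ket, hy']
  rw [Z_ket, map_smul, ← hy', ladderInv_ladder, map_smul, X_ket, flip_flip]
  congr 1
  have h0 : enc u = ∅ ↔ u = 0 := by rw [← enc_zero (m := m), enc_injective.eq_iff]
  rw [h0] at h
  simp only [h]
  split_ifs <;> simp

variable {n : ℕ}

/-- The sign flip of the states where qubit `n + 1` is `1` and `h` is `1` on the block
`1, …, n`. -/
def ctrlOp (h : (Fin n → ZMod 2) → ZMod 2) : QState →ₗ[ℂ] QState :=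
  oracleGate h 0 ∘ₗ toffoliGate (n + 1) 0 (n + 2) ∘ₗ Gate.Z.apply (n + 2) ∘ₗ
    toffoliGate (n + 1) 0 (n + 2) ∘ₗ oracleGate h 0

theorem readBlock_congr {a : ℕ} {x y : Finset ℕ}
    (h : ∀ j, a ≤ j → j < a + n → (j ∈ x ↔ j ∈ y)) : readBlock n a x = readBlock n a y := by
  funext i
  simp only [readBlock, h (a + i) (by omega) (by omega)]

/-- The query writes the value to qubit `0`, and the Toffoli gate writes its conjunction with qubit
`n + 1` to qubit `n + 2`, where `Z` turns it into a sign. Clearing both qubits again costs the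
second query. -/
theorem ctrlOp_ket (h : (Fin n → ZMod 2) → ZMod 2) {x : Finset ℕ} (h0 : 0 ∉ x)
    (h2 : n + 2 ∉ x) :
    ctrlOp h (ket x) =
      (if n + 1 ∈ x ∧ h (readBlock n 1 x) = 1 then (-1 : ℂ) else 1) • ket x := by
  have e1 : readBlock n 1 (flip 0 x) = readBlock n 1 x :=
    readBlock_congr fun j _ _ => by rw [mem_flip, if_neg (by omega)]
  have hb : h (readBlock n 1 x) = 1 ∨ ¬ h (readBlock n 1 x) = 1 := em _
  simp only [ctrlOp, LinearMap.comp_apply, oracleGate, toffoliGate, ofBasis_ket, Gate.apply,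
    zero_add]
  by_cases hn : n + 1 ∈ x <;> rcases hb with hb | hb <;>
    simp [mem_flip, hn, hb, h0, h2, flip_flip, e1]

/-- The phase oracle for `glue f g`. -/
def phaseOp (f g : (Fin n → ZMod 2) → ZMod 2) : QState →ₗ[ℂ] QState :=
  ctrlOp g ∘ₗ Gate.X.apply (n + 1) ∘ₗ ctrlOp f ∘ₗ Gate.X.apply (n + 1)

theorem readBlock_enc (u : Fin (n + 1) → ZMod 2) : readBlock n 1 (enc u) = Fin.init u := by
  funext i
  have : 1 + (i : ℕ) ∈ enc u ↔ u i.castSucc = 1 := by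
    rw [add_comm 1]; exact succ_mem_enc (i := i.castSucc)
  simp only [readBlock, this, Fin.init]
  rcases zmod_two_cases (u i.castSucc) with h | h <;> simp [h]

theorem phaseOp_vec (f g : (Fin n → ZMod 2) → ZMod 2) (a : (Fin (n + 1) → ZMod 2) → ℝ) :
    phaseOp f g (vec a) = vec fun u => phase f g u * a u := by
  refine map_vec_phase (fun u => ?_) a
  have h0 : 0 ∉ enc u := notMem_enc (.inl rfl)
  have h2 : n + 2 ∉ enc u := notMem_enc (by omega)
  have hl : n + 1 ∈ enc u ↔ u (Fin.last n) = 1 := succ_mem_enc (i := Fin.last n)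
  have e1 : readBlock n 1 (flip (n + 1) (enc u)) = readBlock n 1 (enc u) :=
    readBlock_congr fun j _ _ => by rw [mem_flip, if_neg (by omega)]
  rw [phaseOp, LinearMap.comp_apply, LinearMap.comp_apply, LinearMap.comp_apply, X_ket,
    ctrlOp_ket f (by simp [mem_flip, h0]) (by simp [mem_flip, h2]), map_smul, X_ket, flip_flip,
    map_smul, ctrlOp_ket g h0 h2, smul_smul, e1, readBlock_enc]
  congr 1
  simp only [mem_flip, if_true, hl, phase, glue, sgn]
  by_cases hu : u (Fin.last n) = 1 <;> simp [hu] <;> split_ifs <;> simp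

/-- The operator whose action on amplitudes is `samp`. -/
def sampOp (f g : (Fin n → ZMod 2) → ZMod 2) : QState →ₗ[ℂ] QState :=
  hadOp (n + 1) ∘ₗ phaseOp f g ∘ₗ hadOp (n + 1)

theorem sampOp_vec (f g : (Fin n → ZMod 2) → ZMod 2) (a : (Fin (n + 1) → ZMod 2) → ℝ) :
    sampOp f g (vec a) = vec (samp (phase f g) a) := by
  rw [sampOp, LinearMap.comp_apply, LinearMap.comp_apply, hadOp_vec, phaseOp_vec, hadOp_vec, samp]

end

section

/-! ### The quantum part of the program

The registers below `10` are scratch registers. Of the others, `10` holds the constant `1`, `11`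
the number `n + 1`, `16` the number `n + 2`, `17` the number `(n + 1) ^ 2`, `18` the constant `0` and
`20` the number `2 * (n + 1) + 1`. -/

/-- The registers that hold constants have the right content. -/
structure Consts (n : ℕ) (σ : St) : Prop where
  one : σ.regs 10 = 1
  size : σ.regs 11 = n + 1
  anc : σ.regs 16 = n + 2
  out : σ.regs 17 = (n + 1) * (n + 1)
  zero : σ.regs 18 = 0
  top : σ.regs 20 = 2 * (n + 1) + 1

/-- The states agree up to scratch registers, qubits and queries. -/
structure Same (e σ : St) : Prop where
  regs : ∀ r, 10 ≤ r → σ.regs r = e.regs r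
  mem : σ.mem = e.mem

theorem Same.refl (e : St) : Same e e := ⟨fun _ _ => rfl, rfl⟩

theorem Same.update {e σ : St} (h : Same e σ) {r : ℕ} (hr : r < 10) (v : ℕ) (ψ : QState) (q : ℕ) :
    Same e ⟨Function.update σ.regs r v, σ.mem, ψ, q⟩ :=
  ⟨fun r' hr' => by
    have : r' ≠ r := by omega
    simp [Function.update_of_ne this, h.regs r' hr'], h.mem⟩

theorem Same.set {e σ : St} (h : Same e σ) (ψ : QState) (q : ℕ) :
    Same e ⟨σ.regs, σ.mem, ψ, q⟩ := ⟨h.regs, h.mem⟩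

theorem Consts.of_same {n : ℕ} {e σ : St} (h : Consts n e) (h' : Same e σ) : Consts n σ := by
  constructor <;> rw [h'.regs _ (by norm_num)]
  exacts [h.one, h.size, h.anc, h.out, h.zero, h.top]

variable {n : ℕ} {f g : (Fin n → ZMod 2) → ZMod 2}

/-- In the environment `e`, the program `p` applies `L` to the qubits, within `t` steps and with
`k` queries. -/
def Acts (f g : (Fin n → ZMod 2) → ZMod 2) (e : St) (p : Program) (t : ℕ)
    (L : QState →ₗ[ℂ] QState) (k : ℕ) : Prop :=
  ∀ σ, Same e σ → Reaches f g p σ t fun σ' =>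
    Same e σ' ∧ σ'.qubits = L σ.qubits ∧ σ'.queries = σ.queries + k

theorem Acts.seq {e : St} {p q : Program} {t t' : ℕ} {L L' : QState →ₗ[ℂ] QState} {k k' : ℕ}
    (hp : Acts f g e p t L k) (hq : Acts f g e q t' L' k') :
    Acts f g e (.seq p q) (t + t' + 1) (L' ∘ₗ L) (k + k') := by
  intro σ hσ
  refine (hp σ hσ).seq fun σ' ⟨h1, h2, h3⟩ => (hq σ' h1).mono le_rfl fun τ ⟨h1', h2', h3'⟩ => ?_
  exact ⟨h1', by rw [h2', h2]; rfl, by rw [h3', h3, add_assoc]⟩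

theorem Acts.mono {e : St} {p : Program} {t t' : ℕ} {L : QState →ₗ[ℂ] QState} {k : ℕ}
    (h : Acts f g e p t L k) (ht : t ≤ t') : Acts f g e p t' L k :=
  fun σ hσ => (h σ hσ).mono ht fun _ h => h

open Program (block)

/-- Hadamard gates on the qubits `1, …, n + 1`. -/
def hadProg : Program := block [.add 0 11 18, .loop 0 (block [.gate .H 0, .sub 0 0 10])]

/-- Loop invariant: the gates still to come, applied to the current state, give the desired final
state. -/
theorem hadProg_acts {e : St} (he : Consts n e) :
    Acts f g e hadProg (4 * (n + 1) + 3) (hadOp (n + 1)) 0 := by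
  intro σ hσ
  have h1 : Reaches f g (.add 0 11 18) σ 1 fun σ' => Same e σ' ∧ σ'.regs 0 = n + 1 ∧
      hadOp (n + 1) σ'.qubits = hadOp (n + 1) σ.qubits ∧ σ'.queries = σ.queries :=
    Reaches.of_simple rfl ⟨hσ.update (by norm_num) _ _ _, by
      have := he.of_same hσ
      simp [Program.run, this.size, this.zero], rfl, rfl⟩
  refine (h1.seq fun σ₁ hσ₁ => Reaches.loop (t := 3)
    (fun i σ' => Same e σ' ∧ σ'.regs 0 = i ∧
      hadOp i σ'.qubits = hadOp (n + 1) σ.qubits ∧ σ'.queries = σ.queries)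
    ?_ (fun _ h => h.2.1) (n + 1) σ₁ hσ₁).mono (by omega) fun _ h => ⟨h.1, h.2.2⟩
  rintro i σ' ⟨h1, h2, h3, h4⟩
  refine ⟨by omega, Reaches.of_simple rfl ⟨h1.update (by norm_num) _ _ _, ?_, ?_, h4⟩⟩
  · simp [block, Program.run, h2, (he.of_same h1).one]
  · rw [← h3]; simp [block, Program.run, h2, hadOp]

/-- Sign flips of those qubits where the row at register `12` is nonzero. -/
def signProg : Program :=
  block [.add 0 11 18, .loop 0 (block
    [.add 1 12 0, .sub 1 1 10, .load 2 1, .ite 2 (.gate .Z 0) .skip, .sub 0 0 10])]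

theorem signProg_acts {e : St} (he : Consts n e) :
    Acts f g e signProg (12 * (n + 1) + 3)
      (signOp (fun i => e.mem (e.regs 12 + i)) (n + 1)) 0 := by
  intro σ hσ
  set L := signOp fun i => e.mem (e.regs 12 + i) with hL
  have h1 : Reaches f g (.add 0 11 18) σ 1 fun σ' => Same e σ' ∧ σ'.regs 0 = n + 1 ∧
      L (n + 1) σ'.qubits = L (n + 1) σ.qubits ∧ σ'.queries = σ.queries :=
    Reaches.of_simple rfl ⟨hσ.update (by norm_num) _ _ _, by
      have := he.of_same hσ
      simp [Program.run, this.size, this.zero], rfl, rfl⟩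
  refine (h1.seq fun σ₁ hσ₁ => Reaches.loop (t := 11)
    (fun i σ' => Same e σ' ∧ σ'.regs 0 = i ∧
      L i σ'.qubits = L (n + 1) σ.qubits ∧ σ'.queries = σ.queries)
    ?_ (fun _ h => h.2.1) (n + 1) σ₁ hσ₁).mono (by omega) fun _ h => ⟨h.1, h.2.2⟩
  rintro i σ' ⟨h1, h2, h3, h4⟩
  refine ⟨by omega, Reaches.of_simple rfl ?_⟩
  have e12 := h1.regs 12 (by norm_num)
  have ha : σ'.regs 12 + (i + 1) - 1 = e.regs 12 + i := by omega
  by_cases h : e.mem (e.regs 12 + i) = 0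
  all_goals
    refine ⟨⟨fun r hr => ?_, ?_⟩, ?_, ?_, ?_⟩
    · have r0 : r ≠ 0 := by omega
      have r1 : r ≠ 1 := by omega
      have r2 : r ≠ 2 := by omega
      simp [block, Program.run, h1.mem, h2, (he.of_same h1).one, ha, h, r0, r1, r2,
        h1.regs r hr]
    · simp [block, Program.run, h1.mem, h2, (he.of_same h1).one, ha, h]
    · simp [block, Program.run, h1.mem, h2, (he.of_same h1).one, ha, h]
    · rw [← h3]
      simp [block, Program.run, h1.mem, h2, (he.of_same h1).one, ha, h, hL, signOp]
    · simp [block, Program.run, h1.mem, h2, (he.of_same h1).one, ha, h, h4]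

/-- One rung of the ladder, at the qubit in register `0`. -/
def rungProg : Program :=
  block [.add 2 16 0, .add 3 11 0, .gate .X 0, .toffoli 0 2 3, .gate .X 0]

theorem rungProg_run {e σ : St} (he : Consts n e) (hσ : Same e σ) :
    ∃ ρ : ℕ → ℕ, rungProg.run f g σ = ⟨ρ, σ.mem, rung (n + 1) (σ.regs 0) σ.qubits, σ.queries⟩ ∧
      (∀ r, 10 ≤ r → ρ r = e.regs r) ∧ ρ 0 = σ.regs 0 ∧ ρ 1 = σ.regs 1 := by
  have h := he.of_same hσ
  refine ⟨Function.update (Function.update σ.regs 2 (n + 2 + σ.regs 0)) 3 (n + 1 + σ.regs 0),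
    ?_, fun r hr => ?_, rfl, rfl⟩
  · simp [rungProg, block, Program.run, h.anc, h.size, rung]
  · have r0 : r ≠ 2 := by omega
    have r1 : r ≠ 3 := by omega
    simp [r0, r1, hσ.regs r hr]

/-- The sign flip of `|0⟩` on the qubits `1, …, n + 1`. -/
def reflProg : Program :=
  block [.gate .X 20, .add 0 11 18, .loop 0 (.seq rungProg (.sub 0 0 10)), .gate .Z 16,
    .add 1 11 18, .const 0 1, .loop 1 (.seq rungProg (block [.add 0 0 10, .sub 1 1 10])),
    .gate .X 20]

theorem reflProg_acts {e : St} (he : Consts n e) :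
    Acts f g e reflProg (28 * (n + 1) + 20) (reflOp (n + 1)) 0 := by
  intro σ hσ
  have hX : Gate.X.apply (2 * (n + 1) + 1) σ.qubits = Gate.X.apply (σ.regs 20) σ.qubits := by
    rw [(he.of_same hσ).top]
  set ψ₀ := Gate.X.apply (2 * (n + 1) + 1) σ.qubits with hψ₀
  set ψ₁ := Gate.Z.apply (n + 1 + 1) (ladder (n + 1) (n + 1) ψ₀) with hψ₁
  have s1 : Reaches f g (.gate .X 20) σ 1 fun σ' => Same e σ' ∧
      σ'.qubits = ψ₀ ∧ σ'.queries = σ.queries :=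
    Reaches.of_simple rfl ⟨hσ.set _ _, hX.symm, rfl⟩
  have s2 : ∀ τ, (Same e τ ∧ τ.qubits = ψ₀ ∧ τ.queries = σ.queries) →
      Reaches f g (.add 0 11 18) τ 1 fun σ' => Same e σ' ∧ σ'.regs 0 = n + 1 ∧
      ladder (n + 1) (n + 1) σ'.qubits = ladder (n + 1) (n + 1) ψ₀ ∧ σ'.queries = σ.queries := by
    rintro τ ⟨h1, h2, h3⟩
    refine Reaches.of_simple rfl ⟨h1.update (by norm_num) _ _ _, ?_, ?_, h3⟩
    · have := he.of_same h1
      simp [Program.run, this.size, this.zero]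
    · rw [← h2]; rfl
  have s3 : ∀ τ, (Same e τ ∧ τ.regs 0 = n + 1 ∧
      ladder (n + 1) (n + 1) τ.qubits = ladder (n + 1) (n + 1) ψ₀ ∧ τ.queries = σ.queries) →
      Reaches f g (.loop 0 (.seq rungProg (.sub 0 0 10))) τ ((n + 1) * 12 + 1) fun σ' =>
        Same e σ' ∧ σ'.regs 0 = 0 ∧
        ladder (n + 1) 0 σ'.qubits = ladder (n + 1) (n + 1) ψ₀ ∧ σ'.queries = σ.queries := by
    refine fun τ hτ => Reaches.loop (t := 11) (fun i σ' => Same e σ' ∧ σ'.regs 0 = i ∧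
        ladder (n + 1) i σ'.qubits = ladder (n + 1) (n + 1) ψ₀ ∧ σ'.queries = σ.queries)
      ?_ (fun _ h => h.2.1) (n + 1) τ hτ
    rintro i σ' ⟨h1, h2, h3, h4⟩
    obtain ⟨ρ, hρ, h5, h6, h7⟩ := rungProg_run (f := f) (g := g) he h1
    refine ⟨by omega, Reaches.of_simple rfl ?_⟩
    simp only [Program.run, hρ]
    have hs : Same e ⟨ρ, σ'.mem, σ'.qubits, σ'.queries⟩ := ⟨h5, h1.mem⟩
    refine ⟨hs.update (by norm_num) _ _ _, ?_, ?_, h4⟩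
    · simp [h6, h2, h5 10 le_rfl, he.one]
    · rw [← h3, h2]; simp [ladder]
  have s4 : ∀ τ, (Same e τ ∧ τ.regs 0 = 0 ∧
      ladder (n + 1) 0 τ.qubits = ladder (n + 1) (n + 1) ψ₀ ∧ τ.queries = σ.queries) →
      Reaches f g (.gate .Z 16) τ 1 fun σ' => Same e σ' ∧ σ'.qubits = ψ₁ ∧
        σ'.queries = σ.queries := by
    rintro τ ⟨h1, -, h2, h3⟩
    refine Reaches.of_simple rfl ⟨h1.set _ _, ?_, h3⟩
    have h2 : τ.qubits = ladder (n + 1) (n + 1) ψ₀ := h2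
    simp [Program.run, hψ₁, h2, (he.of_same h1).anc]
  have s5 : ∀ τ, (Same e τ ∧ τ.qubits = ψ₁ ∧ τ.queries = σ.queries) →
      Reaches f g (.add 1 11 18) τ 1 fun σ' => Same e σ' ∧ σ'.regs 1 = n + 1 ∧
        σ'.qubits = ψ₁ ∧ σ'.queries = σ.queries := by
    rintro τ ⟨h1, h2, h3⟩
    refine Reaches.of_simple rfl ⟨h1.update (by norm_num) _ _ _, ?_, h2, h3⟩
    have := he.of_same h1
    simp [Program.run, this.size, this.zero]
  have s6 : ∀ τ, (Same e τ ∧ τ.regs 1 = n + 1 ∧ τ.qubits = ψ₁ ∧ τ.queries = σ.queries) →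
      Reaches f g (.const 0 1) τ 1 fun σ' => Same e σ' ∧ σ'.regs 1 = n + 1 ∧
        σ'.regs 0 = n + 1 - (n + 1) + 1 ∧ n + 1 ≤ n + 1 ∧
        σ'.qubits = ladderInv (n + 1) (n + 1 - (n + 1)) ψ₁ ∧ σ'.queries = σ.queries := by
    rintro τ ⟨h1, h2, h3, h4⟩
    refine Reaches.of_simple rfl ⟨h1.update (by norm_num) _ _ _, h2, ?_, le_rfl, ?_, h4⟩
    · simp [Program.run]
    · rw [Nat.sub_self]; exact h3
  -- The inverse ladder ascends, so its invariant records the part already applied; register `1`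
  -- counts down while register `0` names the rung.
  have s7 : ∀ τ, (Same e τ ∧ τ.regs 1 = n + 1 ∧
        τ.regs 0 = n + 1 - (n + 1) + 1 ∧ n + 1 ≤ n + 1 ∧
        τ.qubits = ladderInv (n + 1) (n + 1 - (n + 1)) ψ₁ ∧ τ.queries = σ.queries) →
      Reaches f g (.loop 1 (.seq rungProg (block [.add 0 0 10, .sub 1 1 10]))) τ
        ((n + 1) * 14 + 1) fun σ' => Same e σ' ∧ σ'.regs 1 = 0 ∧
        σ'.regs 0 = n + 1 - 0 + 1 ∧ 0 ≤ n + 1 ∧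
        σ'.qubits = ladderInv (n + 1) (n + 1 - 0) ψ₁ ∧ σ'.queries = σ.queries := by
    refine fun τ hτ => Reaches.loop (t := 13) (fun d σ' => Same e σ' ∧ σ'.regs 1 = d ∧
        σ'.regs 0 = n + 1 - d + 1 ∧ d ≤ n + 1 ∧
        σ'.qubits = ladderInv (n + 1) (n + 1 - d) ψ₁ ∧ σ'.queries = σ.queries)
      ?_ (fun _ h => h.2.1) (n + 1) τ hτ
    rintro d σ' ⟨h1, h2, h3, h4, h5, h6⟩
    obtain ⟨ρ, hρ, h7, h8, h9⟩ := rungProg_run (f := f) (g := g) he h1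
    refine ⟨by omega, Reaches.of_simple rfl ?_⟩
    simp only [Program.run, hρ, block]
    have hs : Same e ⟨ρ, σ'.mem, σ'.qubits, σ'.queries⟩ := ⟨h7, h1.mem⟩
    have hd : n + 1 - d = (n + 1 - (d + 1)) + 1 := by omega
    refine ⟨(hs.update (r := 0) (by norm_num) _ σ'.qubits σ'.queries).update (by norm_num) _ _ _,
      ?_, ?_, by omega, ?_, h6⟩
    · simp [h9, h2, h7 10 le_rfl, he.one]
    · simp [h8, h3, h7 10 le_rfl, he.one]; omega
    · rw [h5, h3, hd]; simp [ladderInv]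
  have s8 : ∀ τ, (Same e τ ∧ τ.regs 1 = 0 ∧ τ.regs 0 = n + 1 - 0 + 1 ∧ 0 ≤ n + 1 ∧
        τ.qubits = ladderInv (n + 1) (n + 1 - 0) ψ₁ ∧ τ.queries = σ.queries) →
      Reaches f g (.gate .X 20) τ 1 fun σ' => Same e σ' ∧
        σ'.qubits = reflOp (n + 1) σ.qubits ∧ σ'.queries = σ.queries + 0 := by
    rintro τ ⟨h1, -, -, -, h2, h3⟩
    refine Reaches.of_simple rfl ⟨h1.set _ _, ?_, h3⟩
    simp [Program.run, h2, (he.of_same h1).top, reflOp, hψ₁, hψ₀]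
  exact (s1.seq fun _ h => (s2 _ h).seq fun _ h => (s3 _ h).seq fun _ h => (s4 _ h).seq
    fun _ h => (s5 _ h).seq fun _ h => (s6 _ h).seq fun _ h => (s7 _ h).seq s8).mono
    (by omega) fun _ h => h

/-- The phase oracle for `glue f g`. -/
def phaseProg : Program :=
  block [.gate .X 11, .queryF 18, .toffoli 11 18 16, .gate .Z 16, .toffoli 11 18 16, .queryF 18,
    .gate .X 11, .queryG 18, .toffoli 11 18 16, .gate .Z 16, .toffoli 11 18 16, .queryG 18]

theorem phaseProg_acts {e : St} (he : Consts n e) :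
    Acts f g e phaseProg 23 (phaseOp f g) 4 := by
  intro σ hσ
  have h := he.of_same hσ
  refine Reaches.of_simple rfl ?_
  simp only [phaseProg, block, Program.run, h.anc, h.size, h.zero]
  exact ⟨hσ.set _ _, rfl, trivial⟩

/-- The preparation of the sampled state, which is its own inverse. -/
def sampProg : Program := block [hadProg, phaseProg, hadProg]

theorem sampProg_acts {e : St} (he : Consts n e) :
    Acts f g e sampProg (8 * (n + 1) + 31) (sampOp f g) 4 :=
  ((hadProg_acts he).seq ((phaseProg_acts he).seq (hadProg_acts he))).mono (by omega)

/-- One step of amplitude amplification. -/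
def groverProg : Program := block [signProg, sampProg, reflProg, sampProg]

/-- The action of `groverProg`. -/
def groverOp (f g : (Fin n → ZMod 2) → ZMod 2) (b : ℕ → ℕ) : QState →ₗ[ℂ] QState :=
  sampOp f g ∘ₗ reflOp (n + 1) ∘ₗ sampOp f g ∘ₗ signOp b (n + 1)

theorem groverProg_acts {e : St} (he : Consts n e) :
    Acts f g e groverProg (56 * (n + 1) + 100)
      (groverOp f g fun i => e.mem (e.regs 12 + i)) 8 := by
  have h := (signProg_acts (f := f) (g := g) he).seq ((sampProg_acts he).seq
    ((reflProg_acts he).seq (sampProg_acts he)))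
  rw [LinearMap.comp_assoc, LinearMap.comp_assoc] at h
  exact h.mono (by omega)

theorem groverOp_vec {b : ℕ → ℕ} {r : Fin (n + 1) → ZMod 2} (hr : ∀ i, r i = 1 ↔ b i ≠ 0)
    (a : (Fin (n + 1) → ZMod 2) → ℝ) :
    groverOp f g b (vec a) = vec (grover (phase f g) r a) := by
  simp only [groverOp, LinearMap.comp_apply, signOp_vec hr, sampOp_vec, reflOp_vec, grover]

/-- The states agree up to the registers below `10`, register `19`, qubits and queries. -/
structure SameButCounter (e σ : St) : Prop where
  regs : ∀ r, 10 ≤ r → r ≠ 19 → σ.regs r = e.regs r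
  mem : σ.mem = e.mem

theorem Consts.of_sameButCounter {n : ℕ} {e σ : St} (h : Consts n e) (h' : SameButCounter e σ) :
    Consts n σ := by
  constructor <;> rw [h'.regs _ (by norm_num) (by norm_num)]
  exacts [h.one, h.size, h.anc, h.out, h.zero, h.top]

/-- The preparation of the sampled state, amplified as many times as register `13` says. -/
def prepProg : Program :=
  block [sampProg, .add 19 13 18, .loop 19 (.seq groverProg (.sub 19 19 10))]

/-- A sampling costs `4` queries and an amplification step uses two samplings, hence `4 + 8 J = 4 (2
J + 1)`. The counter is kept outside the scratch registers, which the body overwrites. -/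
theorem prepProg_reaches {e : St} (he : Consts n e) {r : Fin (n + 1) → ZMod 2}
    (hr : ∀ i, r i = 1 ↔ e.mem (e.regs 12 + i) ≠ 0) {z : ℂ} (hz : e.qubits = z • ket ∅) :
    Reaches f g prepProg e ((e.regs 13 + 1) * (200 * (n + 1))) fun σ =>
      SameButCounter e σ ∧
      σ.qubits = z • vec ((grover (phase f g) r)^[e.regs 13] (psi (phase f g))) ∧
      σ.queries = e.queries + 4 * (2 * e.regs 13 + 1) := by
  set J := e.regs 13 with hJ
  set a := fun j => (grover (phase f g) r)^[j] (psi (phase f g)) with ha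
  have s1 : Reaches f g sampProg e (8 * (n + 1) + 31) fun σ => Same e σ ∧
      σ.qubits = z • vec (a 0) ∧ σ.queries = e.queries + 4 := by
    refine (sampProg_acts he e (Same.refl e)).mono le_rfl fun σ ⟨h1, h2, h3⟩ => ⟨h1, ?_, h3⟩
    rw [h2, hz, ← vec_amp0 (m := n + 1), map_smul, sampOp_vec]; rfl
  have s2 : ∀ τ, (Same e τ ∧ τ.qubits = z • vec (a 0) ∧ τ.queries = e.queries + 4) →
      Reaches f g (.add 19 13 18) τ 1 fun σ => SameButCounter e σ ∧ σ.regs 19 = J ∧ J ≤ J ∧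
        σ.qubits = z • vec (a (J - J)) ∧ σ.queries = e.queries + 4 + 8 * (J - J) := by
    rintro τ ⟨h1, h2, h3⟩
    refine Reaches.of_simple rfl ⟨⟨fun r h10 h19 => ?_, h1.mem⟩, ?_, le_rfl, ?_, ?_⟩
    · simp [Program.run, h19, h1.regs r h10]
    · simp [Program.run, (he.of_same h1).zero, h1.regs 13 (by norm_num), hJ]
    · simpa [Program.run] using h2
    · simpa [Program.run] using h3
  have s3 : ∀ τ, (SameButCounter e τ ∧ τ.regs 19 = J ∧ J ≤ J ∧
        τ.qubits = z • vec (a (J - J)) ∧ τ.queries = e.queries + 4 + 8 * (J - J)) →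
      Reaches f g (.loop 19 (.seq groverProg (.sub 19 19 10))) τ
        (J * ((56 * (n + 1) + 102) + 1) + 1) fun σ =>
        SameButCounter e σ ∧ σ.regs 19 = 0 ∧ 0 ≤ J ∧
        σ.qubits = z • vec (a (J - 0)) ∧ σ.queries = e.queries + 4 + 8 * (J - 0) := by
    refine fun τ hτ => Reaches.loop (fun j σ => SameButCounter e σ ∧ σ.regs 19 = j ∧ j ≤ J ∧
        σ.qubits = z • vec (a (J - j)) ∧ σ.queries = e.queries + 4 + 8 * (J - j)) ?_
      (fun _ h => h.2.1) J τ hτ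
    rintro j σ ⟨h1, h2, h3, h4, h5⟩
    have hj : J - j = (J - (j + 1)) + 1 := by omega
    have hσ := he.of_sameButCounter h1
    refine ⟨by omega, (groverProg_acts hσ σ (Same.refl σ)).seq (t' := 1) ?_⟩
    rintro τ ⟨k1, k2, k3⟩
    refine Reaches.of_simple rfl ⟨⟨fun r h10 h19 => ?_, k1.mem.trans h1.mem⟩, ?_, by omega, ?_, ?_⟩
    · simp [Program.run, h19, k1.regs r h10, h1.regs r h10 h19]
    · simp [Program.run, k1.regs 19 (by norm_num), h2, (hσ.of_same k1).one]
    · simp only [Program.run, k2, h4, map_smul]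
      rw [groverOp_vec (r := r), hj, ha]
      · simp only [Function.iterate_succ_apply']
      · intro i; rw [hr, h1.mem, h1.regs 12 (by norm_num) (by norm_num)]
    · simp only [Program.run, k3, h5]; omega
  refine (s1.seq fun _ h => (s2 _ h).seq s3).mono ?_ ?_
  · have : (J + 1) * (200 * (n + 1)) = J * (56 * (n + 1) + 144 * n + 144) + 200 * (n + 1) := by ring
    have h2 : J * ((56 * (n + 1) + 102) + 1) ≤ J * (56 * (n + 1) + 144 * n + 144) :=
      Nat.mul_le_mul_left _ (by omega)
    omega
  · rintro σ ⟨h1, -, -, h2, h3⟩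
    exact ⟨h1, h2, by omega⟩

end

section

variable {n : ℕ} {f g : (Fin n → ZMod 2) → ZMod 2}

open Program (block)

/-! ### Measurement -/

theorem Runs.measure (r a : ℕ) (σ : St) : Runs f g (.measure r a) σ 1
    {⟨Function.update σ.regs r 0, σ.mem, project (σ.regs a) false σ.qubits, σ.queries⟩,
      ⟨Function.update σ.regs r 1, σ.mem, project (σ.regs a) true σ.qubits, σ.queries⟩} := by
  intro K
  exact .two rfl (.leaf _ _) (.leaf _ _)

/-- Write register `1` into the memory. -/
def recordProg : Program := block [.add 2 17 0, .store 2 1, .sub 0 0 10]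

/-- Measure the qubits `n + 1, …, 1` and write the outcomes into the memory. -/
def measLoop : Program :=
  .loop 0 (.seq (.measure 1 0) recordProg)

/-- The result of measuring the qubits `1, …, i` with the outcome `S`. -/
structure Measured (e σ : St) (i : ℕ) (S : Finset ℕ) (τ : St) : Prop where
  regs : ∀ r, 10 ≤ r → τ.regs r = e.regs r
  mem : τ.mem = fun a => if e.regs 17 < a ∧ a ≤ e.regs 17 + i then
    (if a - e.regs 17 ∈ S then 1 else 0) else σ.mem a
  qubits : τ.qubits = σ.qubits.filter fun x => x ∩ Finset.Icc 1 i = S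
  queries : τ.queries = σ.queries

theorem inter_eq_iff {s t x : Finset ℕ} (h : t ⊆ s) :
    x ∩ s = t ↔ ∀ j ∈ s, (j ∈ x ↔ j ∈ t) := by
  refine ⟨?_, fun h' => ?_⟩
  · rintro rfl j hj; simp [hj]
  · ext j
    rw [Finset.mem_inter]
    exact ⟨fun hj => (h' j hj.2).1 hj.1, fun hj => ⟨(h' j (h hj)).2 hj, h hj⟩⟩

theorem map_powerset_Icc_succ {α : Type*} (i : ℕ) (F₀ F₁ : Finset ℕ → α) :
    ((Finset.Icc 1 (i + 1)).powerset.val.map fun S =>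
      if i + 1 ∈ S then F₁ (S.erase (i + 1)) else F₀ S) =
    (Finset.Icc 1 i).powerset.val.map F₀ + (Finset.Icc 1 i).powerset.val.map F₁ := by
  have hk : i + 1 ∉ Finset.Icc 1 i := by simp
  have hI : Finset.Icc 1 (i + 1) = insert (i + 1) (Finset.Icc 1 i) := by
    ext; simp; omega
  have hnot : ∀ S ∈ (Finset.Icc 1 i).powerset, i + 1 ∉ S := fun S hS h =>
    hk (Finset.mem_powerset.1 hS h)
  have hd : Disjoint (Finset.Icc 1 i).powerset
      ((Finset.Icc 1 i).powerset.image (insert (i + 1))) := by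
    rw [Finset.disjoint_left]
    intro S hS hS'
    obtain ⟨T, -, rfl⟩ := Finset.mem_image.1 hS'
    exact hnot _ hS (Finset.mem_insert_self _ _)
  rw [hI, Finset.powerset_insert, ← Finset.disjUnion_eq_union _ _ hd, Finset.disjUnion_val,
    Multiset.map_add]
  congr 1
  · refine Multiset.map_congr rfl fun S hS => ?_
    rw [if_neg (hnot S hS)]
  · rw [Finset.image_val_of_injOn, Multiset.map_map]
    · refine Multiset.map_congr rfl fun S hS => ?_
      simp [Finset.erase_insert (hnot S hS)]
    · intro S hS T hT h
      have h : insert (i + 1) S = insert (i + 1) T := h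
      rw [← Finset.erase_insert (hnot S hS), h, Finset.erase_insert (hnot T hT)]

/-- The branches are indexed by the set `S` of qubits with outcome `1`. The top qubit is measured
first, so the induction splits by whether `i + 1 ∈ S`. -/
theorem measLoop_runs {e : St} (he : Consts n e) (i : ℕ) (σ : St)
    (hσ : ∀ r, 10 ≤ r → σ.regs r = e.regs r) (h0 : σ.regs 0 = i) :
    ∃ F : Finset ℕ → St, Runs f g measLoop σ (8 * i + 1) ((Finset.Icc 1 i).powerset.val.map F) ∧
      ∀ S ⊆ Finset.Icc 1 i, Measured e σ i S (F S) := by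
  induction i generalizing σ with
  | zero =>
    refine ⟨fun _ => σ, ?_, fun S hS => ⟨hσ, ?_, ?_, rfl⟩⟩
    · simpa [measLoop] using Runs.loop_done h0 0
    · funext a
      rw [if_neg (by omega)]
    · ext x
      have : S = ∅ := Finset.subset_empty.1 (by simpa using hS)
      simp [this]
  | succ i ih =>
    have hr : σ.regs 0 ≠ 0 := by omega
    have h17 := hσ 17 (by norm_num)
    have h10 : σ.regs 10 = 1 := (hσ 10 (by norm_num)).trans he.one
    let ρ : ℕ → ℕ → ℕ := fun b => Function.update (Function.update (Function.update σ.regs 1 b) 2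
      (e.regs 17 + (i + 1))) 0 i
    let σ' : ℕ → Bool → St := fun b B =>
      ⟨ρ b, Function.update σ.mem (e.regs 17 + (i + 1)) b, project (i + 1) B σ.qubits, σ.queries⟩
    have hbody : Runs f g (.seq (.measure 1 0) recordProg) σ 7 ({σ' 0 false, σ' 1 true}) := by
      have := (Runs.measure (f := f) (g := g) 1 0 σ).seq (q := recordProg) (t' := 5)
        (F := fun b => {recordProg.run f g b}) (fun b _ => Runs.of_simple rfl b)
      convert this using 1
      have e : ∀ b B, recordProg.run f g ⟨Function.update σ.regs 1 b, σ.mem,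
          project (σ.regs 0) B σ.qubits, σ.queries⟩ = σ' b B := by
        intro b B
        simp [recordProg, block, Program.run, σ', ρ, h0, h17, h10]
      rw [Multiset.insert_eq_cons, Multiset.insert_eq_cons, Multiset.cons_bind,
        Multiset.singleton_bind, e, e]
      rfl
    have hreg : ∀ b r, 10 ≤ r → ρ b r = e.regs r := by
      intro b r h
      have r0 : r ≠ 0 := by omega
      have r1 : r ≠ 1 := by omega
      have r2 : r ≠ 2 := by omega
      simp [ρ, r0, r1, r2, hσ r h]
    obtain ⟨F₀, hF₀, hM₀⟩ := ih (σ' 0 false) (hreg 0) (by simp [σ', ρ])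
    obtain ⟨F₁, hF₁, hM₁⟩ := ih (σ' 1 true) (hreg 1) (by simp [σ', ρ])
    refine ⟨fun S => if i + 1 ∈ S then F₁ (S.erase (i + 1)) else F₀ S, ?_, fun S hS => ?_⟩
    · rw [map_powerset_Icc_succ]
      -- The continuation is a function of the configuration; register `1`, which holds the outcome,
      -- tells the two branches apart.
      have hK : ∀ K, Tree f g (8 * (i + 1) + 1) (σ.push (measLoop :: K)) _ := fun K =>
        .one (c' := σ.push (.seq (.measure 1 0) recordProg :: measLoop :: K))
          (by simp [step, St.push, measLoop, hr]) <|
          ((hbody (measLoop :: K)).bind (t' := 8 * i + 1)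
            (F := fun c => if c.regs 1 = 0 then ((Finset.Icc 1 i).powerset.val.map F₀).map (St.push K)
              else ((Finset.Icc 1 i).powerset.val.map F₁).map (St.push K)) (by
            intro b hb
            simp only [Multiset.insert_eq_cons, Multiset.map_cons, Multiset.map_singleton,
              Multiset.mem_cons, Multiset.mem_singleton] at hb
            rcases hb with rfl | rfl
            · simpa [St.push, σ', ρ] using hF₀ K
            · simpa [St.push, σ', ρ] using hF₁ K)).mono (by omega)
      intro K
      convert hK K using 1
      simp [St.push, σ', ρ]
    · by_cases hi : i + 1 ∈ S
      · have hS' : S.erase (i + 1) ⊆ Finset.Icc 1 i := by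
          intro j hj
          have h1 := Finset.mem_erase.1 hj
          have h2 := Finset.mem_Icc.1 (hS h1.2)
          rw [Finset.mem_Icc]; omega
        have h := hM₁ _ hS'
        simp only [hi, if_true]
        refine ⟨h.regs, ?_, ?_, h.queries⟩
        · rw [h.mem]
          funext a
          by_cases ha : a = e.regs 17 + (i + 1)
          · subst ha; simp [σ', hi]
          · have : (e.regs 17 < a ∧ a ≤ e.regs 17 + i) ↔
                (e.regs 17 < a ∧ a ≤ e.regs 17 + (i + 1)) := by omega
            have h3 : e.regs 17 < a → a - e.regs 17 ≠ i + 1 := by omega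
            simp only [this, σ', Function.update_of_ne ha, Finset.mem_erase]
            split_ifs with h4 h5 h6 <;> simp_all
        · rw [h.qubits]
          ext x
          simp only [σ', project, Finsupp.filter_apply]
          rw [← ite_and]
          refine if_congr ?_ rfl rfl
          rw [inter_eq_iff hS, inter_eq_iff hS']
          constructor
          · rintro ⟨h1, h2⟩ j hj
            by_cases hj' : j = i + 1
            · subst hj'; simp [hi, h2]
            · have := Finset.mem_Icc.1 hj
              rw [h1 j (by rw [Finset.mem_Icc]; omega)]; simp [hj']
          · refine fun h1 => ⟨fun j hj => ?_, ?_⟩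
            · have hj := Finset.mem_Icc.1 hj
              have hj' : j ≠ i + 1 := by omega
              rw [h1 j (by rw [Finset.mem_Icc]; omega)]; simp [hj']
            · simp [h1 (i + 1) (by simp), hi]
      · have hS' : S ⊆ Finset.Icc 1 i := by
          intro j hj
          have h2 := Finset.mem_Icc.1 (hS hj)
          have : j ≠ i + 1 := fun h => hi (h ▸ hj)
          rw [Finset.mem_Icc]; omega
        have h := hM₀ _ hS'
        simp only [hi, if_false]
        refine ⟨h.regs, ?_, ?_, h.queries⟩
        · rw [h.mem]
          funext a
          by_cases ha : a = e.regs 17 + (i + 1)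
          · subst ha; simp [σ', hi]
          · have : (e.regs 17 < a ∧ a ≤ e.regs 17 + i) ↔
                (e.regs 17 < a ∧ a ≤ e.regs 17 + (i + 1)) := by omega
            simp only [this, σ', Function.update_of_ne ha]
        · rw [h.qubits]
          ext x
          simp only [σ', project, Finsupp.filter_apply]
          rw [← ite_and]
          refine if_congr ?_ rfl rfl
          rw [inter_eq_iff hS, inter_eq_iff hS']
          constructor
          · rintro ⟨h1, h2⟩ j hj
            by_cases hj' : j = i + 1
            · subst hj'; simpa [hi] using h2
            · have := Finset.mem_Icc.1 hj
              rw [h1 j (by rw [Finset.mem_Icc]; omega)]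
          · refine fun h1 => ⟨fun j hj => ?_, ?_⟩
            · have hj := Finset.mem_Icc.1 hj
              rw [h1 j (by rw [Finset.mem_Icc]; omega)]
            · simp [h1 (i + 1) (by simp), hi]

theorem filter_vec {m : ℕ} (z : ℂ) (a : (Fin m → ZMod 2) → ℝ) (u : Fin m → ZMod 2) :
    ((z • vec a).filter fun x => x ∩ Finset.Icc 1 m = enc u) =
      (z * a u) • ket (enc u) := by
  have hp : ∀ v : Fin m → ZMod 2, enc v ∩ Finset.Icc 1 m = enc u ↔ v = u := by
    intro v
    rw [Finset.inter_eq_left.2 (enc_subset v), enc_injective.eq_iff]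
  ext x
  rw [Finsupp.filter_apply]
  simp only [vec, Finsupp.smul_apply, Finsupp.finsetSum_apply, ket, Finsupp.single_apply]
  by_cases hx : ∃ v : Fin m → ZMod 2, enc v = x
  · obtain ⟨v, rfl⟩ := hx
    simp only [hp, enc_injective.eq_iff]
    by_cases hv : v = u
    · subst hv; simp
    · simp [hv, Ne.symm hv]
  · have : ∀ v : Fin m → ZMod 2, enc v ≠ x := fun v h => hx ⟨v, h⟩
    simp [this]

/-- The memory cells after `a` hold `u`. -/
def Holds {m : ℕ} (μ : ℕ → ℕ) (a : ℕ) (u : Fin m → ZMod 2) : Prop :=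
  ∀ i : Fin m, μ (a + i) = (u i).val

/-- Measure the qubits `1, …, n + 1`. -/
def measProg : Program := .seq (.add 0 11 18) measLoop

/-- Outcomes of amplitude zero are branches too, so the leaves are indexed by all vectors `u`. -/
theorem measProg_runs {e : St} (he : Consts n e) {z : ℂ} {a : (Fin (n + 1) → ZMod 2) → ℝ}
    (hq : e.qubits = z • vec a) :
    ∃ F : (Fin (n + 1) → ZMod 2) → St,
      Runs f g measProg e (8 * (n + 1) + 3) (Finset.univ.val.map F) ∧
      ∀ u, (∀ r, 10 ≤ r → (F u).regs r = e.regs r) ∧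
        (∀ c ≤ e.regs 17, (F u).mem c = e.mem c) ∧ Holds (F u).mem (e.regs 17 + 1) u ∧
        (F u).qubits = (z * a u) • ket (enc u) ∧ (F u).queries = e.queries := by
  have h1 := Runs.of_simple (f := f) (g := g) (p := .add 0 11 18) rfl e
  obtain ⟨F, hF, hM⟩ := measLoop_runs (f := f) (g := g) he (n + 1)
    (Program.run f g (.add 0 11 18) e)
    ((Same.refl e).update (r := 0) (by norm_num) _ e.qubits e.queries).regs
    (by simp [Program.run, he.size, he.zero])
  refine ⟨fun u => F (enc u), ?_, fun u => ?_⟩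
  · have := h1.seq_det hF
    rw [← image_enc_univ, Finset.image_val_of_injOn enc_injective.injOn, Multiset.map_map] at this
    exact this.mono (by simp only [Program.cost]; omega)
  · have h := hM (enc u) (enc_subset u)
    refine ⟨h.regs, fun c hc => ?_, fun i => ?_, ?_, h.queries⟩
    · rw [h.mem]; simp only [if_neg (show ¬(e.regs 17 < c ∧ c ≤ e.regs 17 + (n + 1)) by omega)]; rfl
    · have hi : e.regs 17 + 1 + (i : ℕ) - e.regs 17 = i + 1 := by omega
      rw [h.mem]
      simp only [if_pos (show e.regs 17 < e.regs 17 + 1 + (i : ℕ) ∧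
        e.regs 17 + 1 + (i : ℕ) ≤ e.regs 17 + (n + 1) by omega), hi, succ_mem_enc]
      rcases zmod_two_cases (u i) with h | h <;> simp [h, ZMod.val_one]
    · rw [h.qubits, ← filter_vec, ← hq]; rfl

/-- Set the measured qubits to `0`. -/
def resetProg : Program :=
  block [.add 0 11 18, .loop 0 (block
    [.add 1 17 0, .load 2 1, .ite 2 (.gate .X 0) .skip, .sub 0 0 10])]

theorem resetProg_reaches {e : St} (he : Consts n e) {z : ℂ} {u : Fin (n + 1) → ZMod 2}
    (hu : Holds e.mem (e.regs 17 + 1) u) (hq : e.qubits = z • ket (enc u)) :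
    Reaches f g resetProg e (10 * (n + 1) + 3) fun σ =>
      Same e σ ∧ σ.qubits = z • ket ∅ ∧ σ.queries = e.queries := by
  have h1 : Reaches f g (.add 0 11 18) e 1 fun σ' => Same e σ' ∧ σ'.regs 0 = n + 1 ∧
      n + 1 ≤ n + 1 ∧
      σ'.qubits = z • ket ((enc u).filter (· ≤ n + 1)) ∧ σ'.queries = e.queries := by
    refine Reaches.of_simple rfl ⟨(Same.refl e).update (by norm_num) _ _ _, ?_, le_rfl, ?_, rfl⟩
    · simp [Program.run, he.size, he.zero]
    · rw [Finset.filter_true_of_mem fun j hj => (Finset.mem_Icc.1 (enc_subset u hj)).2]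
      exact hq
  refine (h1.seq fun σ₁ hσ₁ => Reaches.loop (t := 9)
    (fun i σ' => Same e σ' ∧ σ'.regs 0 = i ∧ i ≤ n + 1 ∧
      σ'.qubits = z • ket ((enc u).filter (· ≤ i)) ∧ σ'.queries = e.queries)
    ?_ (fun _ h => h.2.1) (n + 1) σ₁ hσ₁).mono (by omega) ?_
  · rintro i σ' ⟨h1, h2, h3, h4, h5⟩
    refine ⟨by omega, Reaches.of_simple rfl ?_⟩
    have h17 := h1.regs 17 (by norm_num)
    have hb : e.mem (e.regs 17 + (i + 1)) = (u ⟨i, by omega⟩).val := by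
      rw [← hu ⟨i, by omega⟩]; congr 1; simp only; ring
    have hmem : i + 1 ∈ enc u ↔ u ⟨i, by omega⟩ = 1 := succ_mem_enc (i := ⟨i, by omega⟩)
    have hfil : (enc u).filter (· ≤ i) = if u ⟨i, by omega⟩ = 1 then
        flip (i + 1) ((enc u).filter (· ≤ i + 1)) else (enc u).filter (· ≤ i + 1) := by
      split_ifs with h
      · ext j
        rw [mem_flip]
        split_ifs with hj
        · subst hj; simp [hmem.2 h]
        · simp only [Finset.mem_filter]; refine and_congr_right fun _ => ?_; omega
      · refine Finset.filter_congr fun j hj => ?_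
        have : j ≠ i + 1 := fun e => h (hmem.1 (e ▸ hj))
        omega
    rcases zmod_two_cases (u ⟨i, by omega⟩) with h | h
    all_goals
      refine ⟨⟨fun r hr => ?_, ?_⟩, ?_, by omega, ?_, ?_⟩
      · have r0 : r ≠ 0 := by omega
        have r1 : r ≠ 1 := by omega
        have r2 : r ≠ 2 := by omega
        simp [block, Program.run, h1.mem, h2, h17, hb, h, ZMod.val_one, r0, r1, r2, h1.regs r hr]
      · simp [block, Program.run, h1.mem, h2, h17, hb, h, ZMod.val_one]
      · simp [block, Program.run, h1.mem, h2, h17, hb, h, ZMod.val_one, (he.of_same h1).one]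
      · rw [hfil]
        simp [block, Program.run, h1.mem, h2, h17, hb, h, ZMod.val_one, h4, X_ket]
      · simp [block, Program.run, h1.mem, h2, h17, hb, h, ZMod.val_one, h5]
  · rintro σ ⟨h1, -, -, h2, h3⟩
    refine ⟨h1, ?_, h3⟩
    rw [h2]
    congr 2
    refine Finset.filter_eq_empty_iff.2 fun j hj => ?_
    have := (Finset.mem_Icc.1 (enc_subset u hj)).1
    omega

end

section

variable {n : ℕ} {f g : (Fin n → ZMod 2) → ZMod 2}

open Program (block)

/-! ### The classical update -/

/-- Row `i` of the table in the memory is `R i`. -/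
def Rows (n : ℕ) (μ : ℕ → ℕ) (R : ℕ → Fin (n + 1) → ZMod 2) : Prop :=
  ∀ i ≤ n, Holds μ (i * (n + 1)) (R i)

/-- The states agree except for scratch registers. -/
structure Idle (e σ : St) : Prop extends Same e σ where
  qubits : σ.qubits = e.qubits
  queries : σ.queries = e.queries

theorem Idle.refl (e : St) : Idle e e := ⟨Same.refl e, rfl, rfl⟩

theorem Idle.update {e σ : St} (h : Idle e σ) {r : ℕ} (hr : r < 10) (v : ℕ) :
    Idle e ⟨Function.update σ.regs r v, σ.mem, σ.qubits, σ.queries⟩ :=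
  ⟨h.toSame.update hr _ _ _, h.qubits, h.queries⟩

/-- Register `2` becomes the inner product of the measured vector with the row at register `23`. -/
def dotProg : Program :=
  block [.const 2 0, .add 0 11 18, .loop 0 (block
    [.add 1 23 0, .sub 1 1 10, .load 3 1, .add 4 17 0, .load 5 4,
      .ite 3 (.ite 5 (.sub 2 10 2) .skip) .skip, .sub 0 0 10])]

theorem dotProg_reaches {e : St} (he : Consts n e) {r u : Fin (n + 1) → ZMod 2}
    (hr : Holds e.mem (e.regs 23) r) (hu : Holds e.mem (e.regs 17 + 1) u) :
    Reaches f g dotProg e (20 * (n + 1) + 5) fun σ => Idle e σ ∧ σ.regs 2 = (u ⬝ᵥ r).val := by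
  let F : ℕ → ZMod 2 := fun j =>
    (e.mem (e.regs 17 + 1 + j) : ZMod 2) * (e.mem (e.regs 23 + j) : ZMod 2)
  have hF : ∑ j ∈ Finset.range (n + 1), F j = u ⬝ᵥ r := by
    rw [Finset.sum_range, dotProduct]
    refine Finset.sum_congr rfl fun i _ => ?_
    simp only [F]
    rw [hr i, hu i, ZMod.natCast_zmod_val, ZMod.natCast_zmod_val]
  -- The accumulator plus the terms not yet treated is the inner product. The bound by `1` makes the
  -- subtraction from `1` an addition of `1` modulo `2`.
  let I : ℕ → St → Prop := fun i σ => Idle e σ ∧ σ.regs 0 = i ∧ i ≤ n + 1 ∧ σ.regs 2 ≤ 1 ∧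
    (σ.regs 2 : ZMod 2) + ∑ j ∈ Finset.range i, F j = u ⬝ᵥ r
  have s1 : Reaches f g (.const 2 0) e 1 fun σ => Idle e σ ∧ σ.regs 2 = 0 :=
    Reaches.of_simple rfl ⟨(Idle.refl e).update (by norm_num) _, by simp [Program.run]⟩
  have s2 : ∀ σ, (Idle e σ ∧ σ.regs 2 = 0) → Reaches f g (.add 0 11 18) σ 1 (I (n + 1)) := by
    rintro σ ⟨h1, h2⟩
    have hσ := he.of_same h1.toSame
    refine Reaches.of_simple rfl ⟨h1.update (by norm_num) _, ?_, le_rfl, ?_, ?_⟩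
    · simp [Program.run, hσ.size, hσ.zero]
    · simp [Program.run, h2]
    · simp [Program.run, h2, hF]
  refine (s1.seq fun _ h => (s2 _ h).seq (Reaches.loop (t := 17) I ?_ (fun _ h => h.2.1)
    (n + 1))).mono (by omega) ?_
  · rintro i σ ⟨h1, h2, h3, h4, h5⟩
    have hσ := he.of_same h1.toSame
    have h17 := h1.regs 17 (by norm_num)
    have h23 := h1.regs 23 (by norm_num)
    have ha : e.regs 23 + (i + 1) - 1 = e.regs 23 + i := by omega
    have hb : e.regs 17 + (i + 1) = e.regs 17 + 1 + i := by omega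
    have hr' : e.mem (e.regs 23 + i) = (r ⟨i, by omega⟩).val := hr ⟨i, by omega⟩
    have hu' : e.mem (e.regs 17 + 1 + i) = (u ⟨i, by omega⟩).val := hu ⟨i, by omega⟩
    rw [Finset.sum_range_succ] at h5
    simp only [F, hr', hu', ZMod.natCast_zmod_val] at h5
    refine ⟨by omega, Reaches.of_simple rfl ?_⟩
    have hneg : ((1 - σ.regs 2 : ℕ) : ZMod 2) = (σ.regs 2 : ZMod 2) + 1 := by
      interval_cases σ.regs 2 <;> decide
    rcases zmod_two_cases (r ⟨i, by omega⟩) with hv | hv <;>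
      rcases zmod_two_cases (u ⟨i, by omega⟩) with hw | hw <;>
      simp only [hv, hw, mul_zero, mul_one, add_zero] at h5
    all_goals
      refine ⟨⟨⟨fun q hq => ?_, ?_⟩, ?_, ?_⟩, ?_, by omega, ?_, ?_⟩
      · have r0 : q ≠ 0 := by omega
        have r1 : q ≠ 1 := by omega
        have r2 : q ≠ 2 := by omega
        have r3 : q ≠ 3 := by omega
        have r4 : q ≠ 4 := by omega
        have r5 : q ≠ 5 := by omega
        simp [block, Program.run, h1.mem, h2, h17, h23, ha, hb, hr', hu', hv, hw, ZMod.val_one,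
          hσ.one, r0, r1, r2, r3, r4, r5, h1.regs q hq]
      · simp [block, Program.run, h1.mem, h2, h17, h23, ha, hb, hr', hu', hv, hw, ZMod.val_one,
          hσ.one]
      · simp [block, Program.run, h1.mem, h2, h17, h23, ha, hb, hr', hu', hv, hw, ZMod.val_one,
          hσ.one, h1.qubits]
      · simp [block, Program.run, h1.mem, h2, h17, h23, ha, hb, hr', hu', hv, hw, ZMod.val_one,
          hσ.one, h1.queries]
      · simp [block, Program.run, h1.mem, h2, h17, h23, ha, hb, hr', hu', hv, hw, ZMod.val_one,
          hσ.one]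
      · simp [block, Program.run, h1.mem, h2, h17, h23, ha, hb, hr', hu', hv, hw, ZMod.val_one,
          hσ.one, h4]
      · rw [← h5]
        simp [block, Program.run, h1.mem, h2, h17, h23, ha, hb, hr', hu', hv, hw, ZMod.val_one,
          hσ.one, hneg, F] <;> ring
  · rintro σ ⟨h1, -, -, h4, h5⟩
    refine ⟨h1, ?_⟩
    rw [Finset.sum_range_zero, add_zero] at h5
    rw [← h5, ZMod.val_natCast, Nat.mod_eq_of_lt (by omega)]

/-- Add the row at register `12` to the row at register `23`. -/
def addProg : Program :=
  block [.add 0 11 18, .loop 0 (block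
    [.add 1 23 0, .sub 1 1 10, .load 3 1, .add 4 12 0, .sub 4 4 10, .load 5 4,
      .ite 5 (block [.sub 3 10 3, .store 1 3]) .skip, .sub 0 0 10])]

/-- By `hPV` the target row ends before the source row begins, so the source is not disturbed by the
writing. -/
theorem addProg_reaches {e : St} (he : Consts n e) (hPV : e.regs 23 + (n + 1) ≤ e.regs 12) :
    Reaches f g addProg e (25 * (n + 1) + 3) fun σ =>
      (∀ r, 10 ≤ r → σ.regs r = e.regs r) ∧ σ.qubits = e.qubits ∧ σ.queries = e.queries ∧
      ∀ a, σ.mem a = if e.regs 23 ≤ a ∧ a < e.regs 23 + (n + 1) ∧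
        e.mem (e.regs 12 + (a - e.regs 23)) ≠ 0 then 1 - e.mem a else e.mem a := by
  let I : ℕ → St → Prop := fun i σ => (∀ r, 10 ≤ r → σ.regs r = e.regs r) ∧
    σ.regs 0 = i ∧ i ≤ n + 1 ∧ σ.qubits = e.qubits ∧ σ.queries = e.queries ∧
    σ.mem = fun a => if e.regs 23 + i ≤ a ∧ a < e.regs 23 + (n + 1) ∧
      e.mem (e.regs 12 + (a - e.regs 23)) ≠ 0 then 1 - e.mem a else e.mem a
  have s1 : Reaches f g (.add 0 11 18) e 1 (I (n + 1)) := by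
    refine Reaches.of_simple rfl ⟨((Idle.refl e).update (by norm_num) _).regs, ?_, le_rfl, rfl,
      rfl, ?_⟩
    · simp [Program.run, he.size, he.zero]
    · funext a
      rw [if_neg (by omega)]; rfl
  refine (s1.seq (Reaches.loop (t := 19) I ?_ (fun _ h => h.2.1) (n + 1))).mono (by omega) ?_
  · rintro i σ ⟨h1, h2, h3, h4, h5, h6⟩
    have h10 : σ.regs 10 = 1 := (h1 10 (by norm_num)).trans he.one
    have h12 := h1 12 (by norm_num)
    have h23 := h1 23 (by norm_num)
    have ha : e.regs 23 + (i + 1) - 1 = e.regs 23 + i := by omega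
    have hb : e.regs 12 + (i + 1) - 1 = e.regs 12 + i := by omega
    have m1 : σ.mem (e.regs 23 + i) = e.mem (e.regs 23 + i) := by
      rw [h6]; simp only; rw [if_neg (by omega)]
    have m2 : σ.mem (e.regs 12 + i) = e.mem (e.regs 12 + i) := by
      rw [h6]; simp only; rw [if_neg (by omega)]
    have hrec : ∀ a, a ≠ e.regs 23 + i →
        ((e.regs 23 + i ≤ a ∧ a < e.regs 23 + (n + 1) ∧
          e.mem (e.regs 12 + (a - e.regs 23)) ≠ 0) ↔
        (e.regs 23 + (i + 1) ≤ a ∧ a < e.regs 23 + (n + 1) ∧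
          e.mem (e.regs 12 + (a - e.regs 23)) ≠ 0)) := by
      intro a ha
      refine and_congr_left fun _ => ?_
      omega
    refine ⟨by omega, Reaches.of_simple rfl ?_⟩
    by_cases hv : e.mem (e.regs 12 + i) = 0
    all_goals
      refine ⟨fun q hq => ?_, ?_, by omega, ?_, ?_, ?_⟩
      · have r0 : q ≠ 0 := by omega
        have r1 : q ≠ 1 := by omega
        have r3 : q ≠ 3 := by omega
        have r4 : q ≠ 4 := by omega
        have r5 : q ≠ 5 := by omega
        simp [block, Program.run, h2, h12, h23, ha, hb, m1, m2, hv, h10, r0, r1, r3, r4, r5,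
          h1 q hq]
      · simp [block, Program.run, h2, h12, h23, ha, hb, m1, m2, hv, h10]
      · simp [block, Program.run, h2, h12, h23, ha, hb, m1, m2, hv, h10, h4]
      · simp [block, Program.run, h2, h12, h23, ha, hb, m1, m2, hv, h10, h5]
      · funext a
        by_cases hai : a = e.regs 23 + i
        · subst hai
          have : i < n + 1 := by omega
          simp [block, Program.run, h2, h12, h23, ha, hb, m1, m2, hv, h10, this]
        · simp only [hrec a hai]
          refine Eq.trans ?_ (congrFun h6 a)
          simp [block, Program.run, h2, h12, h23, ha, hb, m1, m2, hv, h10, hai]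
  · rintro σ ⟨h1, -, -, h4, h5, h6⟩
    exact ⟨h1, h4, h5, fun a => by rw [h6]; rfl⟩

/-- Process the rows below the one at register `12`, and remove the latter. -/
def elimProg : Program :=
  block [.loop 23 (block [.sub 23 23 11, dotProg, .ite 2 addProg .skip]), .sub 12 12 11]

/-- The table after the elimination of row `k`. -/
def elim {m : ℕ} (u : Fin m → ZMod 2) (k : ℕ) (R : ℕ → Fin m → ZMod 2) (i : ℕ) : Fin m → ZMod 2 :=
  if i < k then R i + (u ⬝ᵥ R i) • R k else R i

/-- The states agree up to the registers below `10` and the registers in `s`, and the memory. -/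
structure Quiet (s : List ℕ) (e σ : St) : Prop where
  regs : ∀ r, 10 ≤ r → r ∉ s → σ.regs r = e.regs r
  qubits : σ.qubits = e.qubits
  queries : σ.queries = e.queries

theorem Consts.of_regs {e σ : St} (h : Consts n e) {s : List ℕ}
    (h' : ∀ r, 10 ≤ r → r ∉ s → σ.regs r = e.regs r)
    (hs : ∀ r ∈ [10, 11, 16, 17, 18, 20], r ∉ s) : Consts n σ := by
  constructor <;> rw [h' _ (by norm_num) (hs _ (by simp))]
  exacts [h.one, h.size, h.anc, h.out, h.zero, h.top]

theorem holds_add {P V N : ℕ} {μ μ' : ℕ → ℕ} {r v : Fin N → ZMod 2} (hr : Holds μ P r)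
    (hv : Holds μ V v) (hμ : ∀ a, μ' a = if P ≤ a ∧ a < P + N ∧ μ (V + (a - P)) ≠ 0
      then 1 - μ a else μ a) : Holds μ' P (r + v) := by
  intro c
  have : P + (c : ℕ) < P + N := by omega
  rw [hμ, Nat.add_sub_cancel_left, hv c, hr c, Pi.add_apply]
  simp only [this, Nat.le_add_right, true_and]
  rcases zmod_two_cases (r c) with h | h <;> rcases zmod_two_cases (v c) with h' | h' <;>
    simp [h, h', ZMod.val_one, show (1 + 1 : ZMod 2) = 0 from rfl]

theorem holds_of_disjoint {P V N Q M : ℕ} {μ μ' : ℕ → ℕ} {r : Fin M → ZMod 2} (hr : Holds μ Q r)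
    (hμ : ∀ a, μ' a = if P ≤ a ∧ a < P + N ∧ μ (V + (a - P)) ≠ 0 then 1 - μ a else μ a)
    (hd : Q + M ≤ P ∨ P + N ≤ Q) : Holds μ' Q r := by
  intro c
  rw [hμ, if_neg (by omega), hr c]

/-- Register `23` is both the address of the current row and the loop condition. It is lowered
before it is used, so row `0`, at address `0`, is treated last and then ends the loop. `T j` is the
table once the rows from `j` to `k - 1` are treated. -/
theorem elimProg_reaches {e : St} (he : Consts n e) {k : ℕ} (hk : k ≤ n)
    (h12 : e.regs 12 = k * (n + 1)) (h23 : e.regs 23 = k * (n + 1))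
    {R : ℕ → Fin (n + 1) → ZMod 2} {u : Fin (n + 1) → ZMod 2} (hR : Rows n e.mem R)
    (hu : Holds e.mem (e.regs 17 + 1) u) :
    Reaches f g elimProg e (n * (45 * (n + 1) + 20) + 3) fun σ =>
      Quiet [12, 23] e σ ∧ σ.regs 12 = (k - 1) * (n + 1) ∧ Rows n σ.mem (elim u k R) := by
  let T : ℕ → ℕ → Fin (n + 1) → ZMod 2 := fun j i =>
    if j ≤ i ∧ i < k then R i + (u ⬝ᵥ R i) • R k else R i
  let I : ℕ → St → Prop := fun j σ => Quiet [23] e σ ∧ σ.regs 23 = j * (n + 1) ∧ j ≤ k ∧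
    Rows n σ.mem (T j) ∧ Holds σ.mem (e.regs 17 + 1) u
  have s1 : Reaches f g (.loop 23 (block [.sub 23 23 11, dotProg, .ite 2 addProg .skip])) e
      (k * (45 * (n + 1) + 20) + 1) (I 0) := by
    refine (Reaches.loop (t := 45 * (n + 1) + 15) I ?_ (fun _ h => by simpa using h.2.1) k e
      ⟨⟨fun _ _ _ => rfl, rfl, rfl⟩, h23, le_rfl, ?_, hu⟩).mono
      (Nat.add_le_add_right (Nat.mul_le_mul_left _ (by omega)) _) fun _ h => h
    · rintro j σ ⟨h1, h2, h3, h4, h5⟩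
      have hσ := he.of_regs h1.regs (by simp)
      refine ⟨by rw [h2]; exact Nat.mul_ne_zero (by omega) (by omega), ?_⟩
      have t1 : Reaches f g (.sub 23 23 11) σ 1 fun τ => Quiet [23] e τ ∧
          τ.regs 23 = j * (n + 1) ∧ τ.mem = σ.mem := by
        refine Reaches.of_simple rfl ⟨⟨fun r hr h => ?_, h1.qubits, h1.queries⟩, ?_, rfl⟩
        · have h' : r ≠ 23 := by simpa using h
          simp [Program.run, h', h1.regs r hr h]
        · simp [Program.run, h2, hσ.size, Nat.succ_mul]
      have hjn : j ≤ n := by omega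
      have t2 : ∀ τ, (Quiet [23] e τ ∧ τ.regs 23 = j * (n + 1) ∧ τ.mem = σ.mem) →
          Reaches f g dotProg τ (20 * (n + 1) + 5) fun υ => Quiet [23] e υ ∧
          υ.regs 23 = j * (n + 1) ∧ υ.mem = σ.mem ∧ υ.regs 2 = (u ⬝ᵥ R j).val := by
        rintro τ ⟨k1, k2, k3⟩
        have hτ := he.of_regs k1.regs (by simp)
        refine (dotProg_reaches hτ (r := R j) (u := u) ?_ ?_).mono le_rfl ?_
        · rw [k2, k3]
          have := h4 j hjn
          simpa [T] using this
        · rw [k3, k1.regs 17 (by norm_num) (by norm_num)]; exact h5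
        · rintro υ ⟨l1, l2⟩
          exact ⟨⟨fun r hr h => (l1.regs r hr).trans (k1.regs r hr h), l1.qubits.trans k1.qubits,
            l1.queries.trans k1.queries⟩, (l1.regs 23 (by norm_num)).trans k2, l1.mem.trans k3, l2⟩
      have hTj : ∀ i, i ≠ j → T j i = T (j + 1) i := by
        intro i hi
        simp only [T]
        refine if_congr ?_ rfl rfl
        omega
      have hTj' : T j j = R j + (u ⬝ᵥ R j) • R k := by
        simp only [T]; rw [if_pos ⟨le_rfl, by omega⟩]
      have hTk : T (j + 1) k = R k := by simp [T]
      have hTR : T (j + 1) j = R j := by simp [T]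
      refine (t1.seq fun _ h => (t2 _ h).seq (t' := 25 * (n + 1) + 4) ?_).mono (by omega)
        fun _ h => h
      rintro τ ⟨k1, k2, k3, k4⟩
      rcases zmod_two_cases (u ⬝ᵥ R j) with hz | hz
      · refine ⟨τ, (Runs.ite_neg (by rw [k4, hz, ZMod.val_zero])
          (Runs.of_simple rfl τ)).mono (by simp only [Program.cost]; omega), k1, k2, by omega, ?_, ?_⟩
        · simp only [k3]
          intro i hi
          by_cases hij : i = j
          · subst hij
            rw [hTj', hz, zero_smul, add_zero, ← hTR]
            exact h4 i hi
          · rw [hTj i hij]; exact h4 i hi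
        · simp only [k3]; exact h5
      · have hτ := he.of_regs k1.regs (by simp)
        have k12 : τ.regs 12 = k * (n + 1) := by
          rw [k1.regs 12 (by norm_num) (by norm_num), h12]
        have hjk : (j + 1) * (n + 1) ≤ k * (n + 1) := Nat.mul_le_mul_right _ h3
        have hkn : (k + 1) * (n + 1) ≤ (n + 1) * (n + 1) := Nat.mul_le_mul_right _ (by omega)
        rw [Nat.succ_mul] at hjk hkn
        have h17 : τ.regs 17 = (n + 1) * (n + 1) := hτ.out
        obtain ⟨υ, hυ, l1, l2, l3, l4⟩ := addProg_reaches (f := f) (g := g) hτ (by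
          rw [k2, k12]; omega)
        refine ⟨υ, (Runs.ite_pos (by rw [k4, hz, ZMod.val_one]; norm_num) hυ).mono (by omega),
          ⟨fun r hr h => (l1 r hr).trans (k1.regs r hr h), l2.trans k1.qubits,
            l3.trans k1.queries⟩, (l1 23 (by norm_num)).trans k2, by omega, fun i hi => ?_, ?_⟩
        · rw [k3, k2, k12] at l4
          by_cases hij : i = j
          · subst hij
            rw [hTj', hz, one_smul, ← hTR]
            refine holds_add (h4 i hi) ?_ l4
            rw [← hTk]; exact h4 k hk
          · rw [hTj i hij]
            refine holds_of_disjoint (h4 i hi) l4 ?_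
            rcases Nat.lt_or_gt_of_ne hij with h | h
            · left
              have := Nat.mul_le_mul_right (n + 1) (show i + 1 ≤ j from h)
              rwa [Nat.succ_mul] at this
            · right
              have := Nat.mul_le_mul_right (n + 1) (show j + 1 ≤ i from h)
              rwa [Nat.succ_mul] at this
        · rw [k3, k2, k12] at l4
          refine holds_of_disjoint h5 l4 (.inr ?_)
          rw [← k1.regs 17 (by norm_num) (by norm_num), h17]
          omega
    · intro i hi
      have : T k i = R i := by simp only [T]; rw [if_neg (by omega)]
      rw [this]; exact hR i hi
  refine (s1.seq (t' := 1) (Q' := fun σ => Quiet [12, 23] e σ ∧ σ.regs 12 = (k - 1) * (n + 1) ∧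
    Rows n σ.mem (elim u k R)) ?_).mono ?_ fun _ h => h
  · rintro σ ⟨h1, h2, h3, h4, h5⟩
    refine Reaches.of_simple rfl ⟨⟨fun r hr h => ?_, h1.qubits, h1.queries⟩, ?_, ?_⟩
    · simp only [List.mem_cons, List.not_mem_nil, or_false, not_or] at h
      simp [block, Program.run, h.1, h1.regs r hr (by simpa using h.2)]
    · have := he.of_regs h1.regs (by simp)
      simp [block, Program.run, this.size, h1.regs 12 (by norm_num) (by norm_num), h12, Nat.sub_mul]
    · have : T 0 = elim u k R := by
        funext i; simp [T, elim]
      rw [← this]; exact h4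
  · have := Nat.mul_le_mul_right (45 * (n + 1) + 20) hk
    omega

/-- The classical reaction to the measured vector. -/
def updateProg : Program :=
  .ite 12 (block [.add 23 12 18, dotProg, .ite 2 elimProg .skip]) .skip

/-- Register `12` is zero exactly when `k = 0`. Then samples are still taken but ignored, which
keeps the query count independent of the outcomes. -/
theorem updateProg_reaches {e : St} (he : Consts n e) {k : ℕ} (hk : k ≤ n)
    (h12 : e.regs 12 = k * (n + 1))
    {R : ℕ → Fin (n + 1) → ZMod 2} {u : Fin (n + 1) → ZMod 2} (hR : Rows n e.mem R)
    (hu : Holds e.mem (e.regs 17 + 1) u) :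
    Reaches f g updateProg e (n * (45 * (n + 1) + 20) + 20 * (n + 1) + 13) fun σ =>
      Quiet [12, 23] e σ ∧
      if k ≠ 0 ∧ u ⬝ᵥ R k = 1 then
        σ.regs 12 = (k - 1) * (n + 1) ∧ Rows n σ.mem (elim u k R)
      else σ.regs 12 = k * (n + 1) ∧ Rows n σ.mem R := by
  rcases Nat.eq_zero_or_pos k with rfl | hpos
  · refine ⟨e, (Runs.ite_neg (by rw [h12, zero_mul]) (Runs.of_simple rfl e)).mono
      (by simp only [Program.cost]; omega), ⟨fun _ _ _ => rfl, rfl, rfl⟩, ?_⟩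
    rw [if_neg (by simp)]
    exact ⟨h12, hR⟩
  · have hne : k ≠ 0 := by omega
    have t1 : Reaches f g (.add 23 12 18) e 1 fun τ => Quiet [23] e τ ∧
        τ.regs 23 = k * (n + 1) ∧ τ.mem = e.mem := by
      refine Reaches.of_simple rfl ⟨⟨fun r hr h => ?_, rfl, rfl⟩, ?_, rfl⟩
      · have h' : r ≠ 23 := by simpa using h
        simp [Program.run, h']
      · simp [Program.run, h12, he.zero]
    have t2 : ∀ τ, (Quiet [23] e τ ∧ τ.regs 23 = k * (n + 1) ∧ τ.mem = e.mem) →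
        Reaches f g dotProg τ (20 * (n + 1) + 5) fun υ => Quiet [23] e υ ∧
        υ.regs 23 = k * (n + 1) ∧ υ.mem = e.mem ∧ υ.regs 2 = (u ⬝ᵥ R k).val := by
      rintro τ ⟨k1, k2, k3⟩
      have hτ := he.of_regs k1.regs (by simp)
      refine (dotProg_reaches hτ (r := R k) (u := u) ?_ ?_).mono le_rfl ?_
      · rw [k2, k3]; exact hR k hk
      · rw [k3, k1.regs 17 (by norm_num) (by norm_num)]; exact hu
      · rintro υ ⟨l1, l2⟩
        exact ⟨⟨fun r hr h => (l1.regs r hr).trans (k1.regs r hr h), l1.qubits.trans k1.qubits,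
          l1.queries.trans k1.queries⟩, (l1.regs 23 (by norm_num)).trans k2, l1.mem.trans k3, l2⟩
    have t3 : ∀ τ, (Quiet [23] e τ ∧ τ.regs 23 = k * (n + 1) ∧ τ.mem = e.mem ∧
        τ.regs 2 = (u ⬝ᵥ R k).val) → Reaches f g (.ite 2 elimProg .skip) τ
          (n * (45 * (n + 1) + 20) + 4) fun σ => Quiet [12, 23] e σ ∧
      if k ≠ 0 ∧ u ⬝ᵥ R k = 1 then
        σ.regs 12 = (k - 1) * (n + 1) ∧ Rows n σ.mem (elim u k R)
      else σ.regs 12 = k * (n + 1) ∧ Rows n σ.mem R := by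
      rintro τ ⟨k1, k2, k3, k4⟩
      have k12 : τ.regs 12 = k * (n + 1) := by
        rw [k1.regs 12 (by norm_num) (by norm_num), h12]
      rcases zmod_two_cases (u ⬝ᵥ R k) with hz | hz
      · refine ⟨τ, (Runs.ite_neg (by rw [k4, hz, ZMod.val_zero])
          (Runs.of_simple rfl τ)).mono (by simp only [Program.cost]; omega),
          ⟨fun r hr h => k1.regs r hr (by simp at h; simp [h]), k1.qubits, k1.queries⟩, ?_⟩
        rw [if_neg (by simp [hz])]
        simp only [k3]
        exact ⟨k12, hR⟩
      · have hτ := he.of_regs k1.regs (by simp)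
        obtain ⟨υ, hυ, l1, l2, l3⟩ := elimProg_reaches (f := f) (g := g) hτ hk k12 k2 (R := R)
          (u := u) (by rwa [k3])
          (by rw [k3, k1.regs 17 (by norm_num) (by norm_num)]; exact hu)
        refine ⟨υ, Runs.ite_pos (by rw [k4, hz, ZMod.val_one]; norm_num) hυ,
          ⟨fun r hr h => (l1.regs r hr h).trans (k1.regs r hr (by simp at h; simp [h])),
            l1.qubits.trans k1.qubits, l1.queries.trans k1.queries⟩, ?_⟩
        rw [if_pos ⟨hne, hz⟩]
        exact ⟨l2, l3⟩
    obtain ⟨σ, hσ, h⟩ := t1.seq fun _ h => (t2 _ h).seq t3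
    refine ⟨σ, (Runs.ite_pos (by rw [h12]; exact Nat.mul_ne_zero hne (by omega)) hσ).mono
      (by omega), h⟩

end

section

variable {n : ℕ} {f g : (Fin n → ZMod 2) → ZMod 2} {s : Fin n → ZMod 2}

open Program (block)

/-! ### The invariant of the algorithm -/

/-- Between two trials, `k` rows are left, the table is `R` and the qubits are reset. -/
structure Ready (n k : ℕ) (R : ℕ → Fin (n + 1) → ZMod 2) (z : ℂ) (σ : St) : Prop where
  consts : Consts n σ
  le : k ≤ n
  ptr : σ.regs 12 = k * (n + 1)
  rows : Rows n σ.mem R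
  qubits : σ.qubits = z • ket ∅

/-- The first `k` rows of the table are in echelon form, and together with row `0` they leave the
solution possible. -/
structure Sound (s : Fin n → ZMod 2) (k : ℕ) (R : ℕ → Fin (n + 1) → ZMod 2) : Prop where
  pivot : ∀ i : Fin (n + 1), (i : ℕ) < k → R (i + 1) i = 1
  low : ∀ i j : Fin (n + 1), (i : ℕ) < k → j < i → R (i + 1) j = 0
  last : ∀ i < k, R (i + 1) (Fin.last n) = 0
  sol : ∃ c : ℕ → ZMod 2, extend s = R 0 + ∑ i ∈ Finset.range k, c i • R (i + 1)

/-- Pairing the expansion of the solution with `u` determines its last coefficient: `c k = u ⬝ᵥ (R 0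
+ ∑ i < k, c i • R (i + 1))`. Hence the new rows, with the same coefficients, absorb the summand `c
k • R (k + 1)`. The echelon form survives because the removed row vanishes in the columns below `k`
and in the last one. -/
theorem Sound.elim {k : ℕ} {R : ℕ → Fin (n + 1) → ZMod 2} (h : Sound s (k + 1) R) (hk : k + 1 ≤ n)
    {u : Fin (n + 1) → ZMod 2} (hu : u ⬝ᵥ R (k + 1) = 1) (hs : u ⬝ᵥ extend s = 0) :
    Sound s k (elim u (k + 1) R) := by
  have hel : ∀ i ≤ k, HiddenShift.elim u (k + 1) R i = R i + (u ⬝ᵥ R i) • R (k + 1) := fun i hi =>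
    if_pos (by omega)
  refine ⟨fun i hi => ?_, fun i j hi hj => ?_, fun i hi => ?_, ?_⟩
  · have h0 : R (k + 1) i = 0 := h.low ⟨k, by omega⟩ i (Nat.lt_succ_self k) hi
    rw [hel _ hi, Pi.add_apply, Pi.smul_apply, h0, smul_zero, add_zero, h.pivot i (by omega)]
  · have h0 : R (k + 1) j = 0 := h.low ⟨k, by omega⟩ j (Nat.lt_succ_self k) (hj.trans hi)
    rw [hel _ hi, Pi.add_apply, Pi.smul_apply, h0, smul_zero, add_zero, h.low i j (by omega) hj]
  · rw [hel _ hi, Pi.add_apply, Pi.smul_apply, h.last k (by omega), smul_zero, add_zero,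
      h.last i (by omega)]
  · obtain ⟨c, hc⟩ := h.sol
    refine ⟨c, ?_⟩
    have h1 : R 0 + ∑ i ∈ Finset.range k, c i • R (i + 1) = extend s + c k • R (k + 1) := by
      rw [hc, Finset.sum_range_succ, ← add_assoc, add_assoc, ← smul_add, add_self_zmod_two,
        smul_zero, add_zero]
    have h2 : u ⬝ᵥ (R 0 + ∑ i ∈ Finset.range k, c i • R (i + 1)) = c k := by
      rw [h1, dotProduct_add, hs, dotProduct_smul, hu, zero_add, smul_eq_mul, mul_one]
    have h3 : HiddenShift.elim u (k + 1) R 0 +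
        ∑ i ∈ Finset.range k, c i • HiddenShift.elim u (k + 1) R (i + 1) =
        (R 0 + ∑ i ∈ Finset.range k, c i • R (i + 1)) +
          (u ⬝ᵥ (R 0 + ∑ i ∈ Finset.range k, c i • R (i + 1))) • R (k + 1) := by
      rw [hel 0 (by omega), Finset.sum_congr rfl fun i hi => by
        rw [hel (i + 1) (by have := Finset.mem_range.1 hi; omega), smul_add, smul_smul],
        Finset.sum_add_distrib, ← Finset.sum_smul, dotProduct_add, dotProduct_sum, add_smul]
      simp only [dotProduct_smul, smul_eq_mul]
      abel
    rw [h3, h2, h1, add_assoc, add_self_zmod_two, add_zero]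

theorem Sound.zero {R : ℕ → Fin (n + 1) → ZMod 2} (h : Sound s 0 R) : R 0 = extend s := by
  obtain ⟨c, hc⟩ := h.sol
  simpa using hc.symm

/-- Row `k` has a pivot among the first `n` columns and last entry `0`, so it is a nonzero shift of
`f`. -/
theorem Sound.goodProb_ge (hI : IsInstance f g s) {k : ℕ} {R : ℕ → Fin (n + 1) → ZMod 2}
    (h : Sound s k R) (hk : k ≤ n) (h0 : k ≠ 0) :
    minInfluence f ≤ goodProb (phase f g) (R k) := by
  obtain ⟨k, rfl⟩ := Nat.exists_eq_succ_of_ne_zero h0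
  rw [goodProb_phase hI (h.last k (Nat.lt_succ_self k))]
  refine minInfluence_le f fun h' => ?_
  have h1 := h.pivot (Fin.castSucc ⟨k, by omega⟩) (Nat.lt_succ_self k)
  have h2 := congrFun h' ⟨k, by omega⟩
  simp only [Fin.init, Pi.zero_apply] at h2
  have h3 : R (k + 1) (Fin.castSucc ⟨k, by omega⟩) = 1 := h1
  rw [h3] at h2
  exact one_ne_zero h2

/-! ### One trial -/

/-- One trial: sample a vector, and use it. -/
def trialProg : Program := block [prepProg, measProg, resetProg, updateProg]

/-- The amplitudes before the measurement of a trial. -/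
def trialAmp (f g : (Fin n → ZMod 2) → ZMod 2) (r : Fin (n + 1) → ZMod 2) (J : ℕ) :
    (Fin (n + 1) → ZMod 2) → ℝ :=
  (grover (phase f g) r)^[J] (psi (phase f g))

theorem trialProg_runs {σ : St} {k : ℕ} {R : ℕ → Fin (n + 1) → ZMod 2} {z : ℂ}
    (h : Ready n k R z σ) :
    ∃ F : (Fin (n + 1) → ZMod 2) → St,
      Runs f g trialProg σ (400 * (n + 1) ^ 2 * (2 * σ.regs 13 + 1)) (Finset.univ.val.map F) ∧
      ∀ u, (∀ r, 10 ≤ r → r ∉ [12, 19, 23] → (F u).regs r = σ.regs r) ∧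
        (F u).queries = σ.queries + 4 * (2 * σ.regs 13 + 1) ∧
        if k ≠ 0 ∧ u ⬝ᵥ R k = 1 then
          Ready n (k - 1) (elim u k R) (z * trialAmp f g (R k) (σ.regs 13) u) (F u)
        else Ready n k R (z * trialAmp f g (R k) (σ.regs 13) u) (F u) := by
  set J := σ.regs 13 with hJ
  obtain ⟨τ, hτ, c1, q1, k1⟩ := prepProg_reaches (f := f) (g := g) h.consts (r := R k) (by
    intro i
    rw [h.ptr, h.rows k h.le i]
    rcases zmod_two_cases (R k i) with h | h <;> simp [h, ZMod.val_one]) h.qubits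
  have hc1 : Consts n τ := h.consts.of_sameButCounter c1
  obtain ⟨F₁, hF₁, hM⟩ := measProg_runs (f := f) (g := g) hc1 q1
  have hlast : ∀ u, ∃ υ, Runs f g (.seq resetProg updateProg) (F₁ u)
      ((10 * (n + 1) + 3) + (n * (45 * (n + 1) + 20) + 20 * (n + 1) + 13) + 1) {υ} ∧
      (∀ r, 10 ≤ r → r ∉ [12, 19, 23] → υ.regs r = σ.regs r) ∧
        υ.queries = σ.queries + 4 * (2 * J + 1) ∧
        if k ≠ 0 ∧ u ⬝ᵥ R k = 1 then
          Ready n (k - 1) (elim u k R) (z * trialAmp f g (R k) J u) υ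
        else Ready n k R (z * trialAmp f g (R k) J u) υ := by
    intro u
    obtain ⟨m1, m2, m3, m4, m5⟩ := hM u
    have hc2 : Consts n (F₁ u) := hc1.of_regs (s := []) (fun r hr _ => m1 r hr) (by simp)
    have e17 : (F₁ u).regs 17 = τ.regs 17 := m1 17 (by norm_num)
    obtain ⟨υ₁, r1, r2, r3, r4⟩ := resetProg_reaches (f := f) (g := g) hc2 (u := u)
      (by rw [e17]; exact m3) m4
    have hc3 : Consts n υ₁ := hc2.of_same r2
    have hrows : Rows n υ₁.mem R := by
      intro i hi c
      have : i * (n + 1) + c ≤ τ.regs 17 := by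
        have := Nat.mul_le_mul_right (n + 1) (show i + 1 ≤ n + 1 by omega)
        rw [Nat.succ_mul] at this
        rw [hc1.out]; omega
      rw [r2.mem, m2 _ this, c1.mem]
      exact h.rows i hi c
    have h12 : υ₁.regs 12 = k * (n + 1) := by
      rw [r2.regs 12 (by norm_num), m1 12 (by norm_num), c1.regs 12 (by norm_num) (by norm_num),
        h.ptr]
    obtain ⟨υ, u1, u2, u3⟩ := updateProg_reaches (f := f) (g := g) hc3 h.le h12 hrows (u := u)
      (by rw [r2.regs 17 (by norm_num), r2.mem, e17]; exact m3)
    have hc4 : Consts n υ := hc3.of_regs u2.regs (by simp)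
    have hq : υ.qubits = (z * trialAmp f g (R k) J u) • ket ∅ := by rw [u2.qubits, r3]; rfl
    refine ⟨υ, r1.seq_det u1, fun r hr hs => ?_, ?_, ?_⟩
    · simp only [List.mem_cons, List.not_mem_nil, or_false, not_or] at hs
      rw [u2.regs r hr (by simp [hs]), r2.regs r hr, m1 r hr, c1.regs r hr hs.2.1]
    · rw [u2.queries, r4, m5, k1]
    · split_ifs at u3 ⊢ with hk
      · exact ⟨hc4, by have := h.le; omega, u3.1, u3.2, hq⟩
      · exact ⟨hc4, h.le, u3.1, u3.2, hq⟩
  choose F hF hP using hlast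
  refine ⟨F, ?_, hP⟩
  -- `Runs.seq` needs the continuation as a function of the state; the state determines `u`, which
  -- it holds in memory.
  have hinj : Function.Injective F₁ := by
    intro u v huv
    have h1 := (hM u).2.2.1
    have h2 := (hM v).2.2.1
    rw [huv] at h1
    funext i
    exact ZMod.val_injective 2 ((h1 i).symm.trans (h2 i))
  have hseq := hF₁.seq (q := .seq resetProg updateProg)
    (F := fun b => {F (Function.invFun F₁ b)}) (by
      intro b hb
      obtain ⟨u, -, rfl⟩ := Multiset.mem_map.1 hb
      rw [Function.leftInverse_invFun hinj u]
      exact hF u)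
  rw [Multiset.bind_map] at hseq
  simp only [Function.leftInverse_invFun hinj _, Multiset.bind_singleton] at hseq
  refine (hτ.seq_det hseq).mono ?_
  rw [← hJ]
  nlinarith [Nat.zero_le (J * n), Nat.zero_le (J * n ^ 2), Nat.zero_le J, Nat.zero_le (n ^ 2)]

/-! ### Sweeps -/

/-- The potential of a state: its weight, times the number of nonzero candidates. -/
def pot (n : ℕ) (σ : St) : ℝ := (weight σ.qubits : ℝ) * (2 ^ (σ.regs 12 / (n + 1)) - 1)

theorem Ready.pot_eq {k : ℕ} {R : ℕ → Fin (n + 1) → ZMod 2} {z : ℂ} {σ : St}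
    (h : Ready n k R z σ) : pot n σ = ‖z‖ ^ 2 * (2 ^ k - 1) := by
  rw [pot, h.ptr, Nat.mul_div_cancel _ (Nat.succ_pos n), h.qubits, weight_smul, weight_ket]
  simp

/-- The state is between two trials, and on a branch of nonzero probability the table is
correct. -/
def Valid (s : Fin n → ZMod 2) (σ : St) : Prop :=
  ∃ k R z, Ready n k R z σ ∧ (z ≠ 0 → Sound s k R)

/-- A trial, followed by the next number of amplification steps. -/
def sweepBody : Program := .seq trialProg (block [.add 13 13 13, .add 13 13 10, .sub 21 14 13])

/-- The update of register `13` yields `J = 0, 1, 3, 7, …`. Register `21` is the truncated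
difference `M - J`, nonzero as long as another trial is due. -/
theorem sweepBody_runs {σ : St} {k : ℕ} {R : ℕ → Fin (n + 1) → ZMod 2} {z : ℂ}
    (h : Ready n k R z σ) :
    ∃ F : (Fin (n + 1) → ZMod 2) → St,
      Runs f g sweepBody σ (400 * (n + 1) ^ 2 * (2 * σ.regs 13 + 1) + 6)
        (Finset.univ.val.map F) ∧
      ∀ u, (F u).regs 13 = 2 * σ.regs 13 + 1 ∧ (F u).regs 14 = σ.regs 14 ∧
        (F u).regs 15 = σ.regs 15 ∧ (F u).regs 21 = σ.regs 14 - (2 * σ.regs 13 + 1) ∧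
        (F u).queries = σ.queries + 4 * (2 * σ.regs 13 + 1) ∧
        if k ≠ 0 ∧ u ⬝ᵥ R k = 1 then
          Ready n (k - 1) (elim u k R) (z * trialAmp f g (R k) (σ.regs 13) u) (F u)
        else Ready n k R (z * trialAmp f g (R k) (σ.regs 13) u) (F u) := by
  obtain ⟨F, hF, hP⟩ := trialProg_runs (f := f) (g := g) h
  set rest := block [.add 13 13 13, .add 13 13 10, .sub 21 14 13] with hrest
  have hseq := hF.seq (q := rest) (F := fun b => {rest.run f g b})
    fun b _ => Runs.of_simple rfl b
  rw [Multiset.bind_map, Multiset.bind_singleton] at hseq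
  refine ⟨_, hseq, fun u => ?_⟩
  obtain ⟨h1, h2, h3⟩ := hP u
  have e10 : (F u).regs 10 = 1 := (h1 10 (by norm_num) (by simp)).trans h.consts.one
  have e13 := h1 13 (by norm_num) (by simp)
  have e14 := h1 14 (by norm_num) (by simp)
  have e15 := h1 15 (by norm_num) (by simp)
  have e13' : σ.regs 13 + σ.regs 13 + 1 = 2 * σ.regs 13 + 1 := by ring
  have hready : ∀ {k' R' z'}, Ready n k' R' z' (F u) → Ready n k' R' z' (rest.run f g (F u)) :=
    fun hr => ⟨hr.consts.of_regs (s := [13, 21]) (fun r _ hs => by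
      simp only [List.mem_cons, List.not_mem_nil, or_false, not_or] at hs
      simp [hrest, block, Program.run, hs]) (by simp), hr.le,
      hr.ptr, hr.rows, hr.qubits⟩
  refine ⟨?_, ?_, ?_, ?_, h2, ?_⟩
  · simp [hrest, block, Program.run, e10, e13, e13']
  · simp [hrest, block, Program.run, e14]
  · simp [hrest, block, Program.run, e15]
  · simp [hrest, block, Program.run, e10, e13, e14, e13']
  · split_ifs at h3 ⊢
    · exact hready h3
    · exact hready h3

/-- All trials of a sweep. -/
def sweepLoop : Program := .loop 21 sweepBody

/-- The bookkeeping of a sweep from which `S` steps are left. -/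
structure SweepEnd (n : ℕ) (s : Fin n → ZMod 2) (S : ℕ) (σ b : St) : Prop where
  valid : Valid s b
  bound : b.regs 14 = σ.regs 14
  counter : b.regs 15 = σ.regs 15
  queries : b.queries = σ.queries + 4 * S

theorem Ready.pot_nonneg {k : ℕ} {R : ℕ → Fin (n + 1) → ZMod 2} {z : ℂ} {σ : St}
    (h : Ready n k R z σ) : 0 ≤ pot n σ := by
  rw [h.pot_eq]
  have : (1 : ℝ) ≤ 2 ^ k := one_le_pow₀ (by norm_num)
  exact mul_nonneg (sq_nonneg _) (by linarith)

/-! ### Bounds on the amplification angle -/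

theorem sin_sq_ge {x : ℝ} (h1 : Real.pi / 6 ≤ x) (h2 : x ≤ Real.pi / 2) :
    1 / 4 ≤ Real.sin x ^ 2 := by
  have := Real.sin_le_sin_of_le_of_le_pi_div_two (by linarith [Real.pi_pos]) h2 h1
  rw [Real.sin_pi_div_six] at this
  nlinarith

theorem angle_nonneg {m : ℕ} (φ : (Fin m → ZMod 2) → ℝ) (r : Fin m → ZMod 2) :
    0 ≤ angle φ r := Real.arcsin_nonneg.2 (Real.sqrt_nonneg _)

/-- Use `θ ≥ sin θ = √goodProb ≥ 1 / M`. -/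
theorem one_le_mul_angle {m : ℕ} {φ : (Fin m → ZMod 2) → ℝ} (hφ : ∀ u, φ u * φ u = 1)
    (r : Fin m → ZMod 2) {M : ℕ} (hM : 1 ≤ (M : ℝ) ^ 2 * goodProb φ r) :
    1 ≤ (M : ℝ) * angle φ r := by
  have h1 : Real.sqrt (goodProb φ r) ≤ angle φ r := by
    rw [← sin_angle hφ]
    exact Real.sin_le (angle_nonneg φ r)
  have h2 : 1 ≤ (M : ℝ) * Real.sqrt (goodProb φ r) := by
    have h0 : 0 ≤ (M : ℝ) * Real.sqrt (goodProb φ r) :=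
      mul_nonneg (Nat.cast_nonneg _) (Real.sqrt_nonneg _)
    have : 1 ≤ ((M : ℝ) * Real.sqrt (goodProb φ r)) ^ 2 := by
      rwa [mul_pow, Real.sq_sqrt (goodProb_nonneg φ r)]
    nlinarith
  exact h2.trans (mul_le_mul_of_nonneg_left h1 (Nat.cast_nonneg _))

/-- `S` sums `2 J + 1` over the remaining trials; it depends only on `M` and `J`, so it is chosen
before the state. For the contraction, let the current angle be at most `π / 2`. If it is at least
`π / 6`, this trial succeeds with probability at least `1 / 4` and then halves the potential, whence
`1 - 1 / 8`. If it is smaller, the next angle is still at most `π / 2`: the branches of success are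
halved, and the others shrink by induction. After a success the row and its angle have changed, and
the plain bound by `pot n σ` is used. -/
theorem sweepLoop_runs (hI : IsInstance f g s) {M : ℕ}
    (hM : 1 ≤ (M : ℝ) ^ 2 * minInfluence f) (d J : ℕ) (hd : M - J ≤ d) :
    ∃ S, (M ≤ J → S = 0) ∧ (J < M → M ≤ S ∧ S + 2 * J ≤ 4 * M) ∧
    ∀ σ k R z, Ready n k R z σ → (z ≠ 0 → Sound s k R) → σ.regs 13 = J → σ.regs 14 = M →
      σ.regs 21 = M - J →
    ∃ B, Runs f g sweepLoop σ (500 * (n + 1) ^ 2 * S + 1) B ∧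
      (∀ b ∈ B, SweepEnd n s S σ b) ∧ (B.map (pot n)).sum ≤ pot n σ ∧
      (J < M → (2 * J + 1) * angle (phase f g) (R k) ≤ Real.pi / 2 →
        (B.map (pot n)).sum ≤ 7 / 8 * pot n σ) := by
  induction d generalizing J with
  | zero =>
    refine ⟨0, fun _ => rfl, fun h => by omega,
      fun σ k R z h hs h13 h14 h21 => ⟨{σ}, ?_, ?_, ?_, ?_⟩⟩
    · exact Runs.loop_done (by omega) _
    · intro b hb
      rw [Multiset.mem_singleton.1 hb]
      exact ⟨⟨k, R, z, h, hs⟩, rfl, rfl, rfl⟩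
    · simp
    · intro h; omega
  | succ d ih =>
    rcases Nat.lt_or_ge J M with hJM | hJM
    swap
    · refine ⟨0, fun _ => rfl, fun h => by omega,
        fun σ k R z h hs h13 h14 h21 => ⟨{σ}, ?_, ?_, ?_, ?_⟩⟩
      · exact Runs.loop_done (by omega) _
      · intro b hb
        rw [Multiset.mem_singleton.1 hb]
        exact ⟨⟨k, R, z, h, hs⟩, rfl, rfl, rfl⟩
      · simp
      · intro h; omega
    obtain ⟨S, hS0, hS, ih⟩ := ih (2 * J + 1) (by omega)
    -- The summand `2 * J` makes the bound on the geometric sum inductive; `M ≤ S` holds because the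
    -- last trial has `M ≤ 2 * J + 1`.
    refine ⟨2 * J + 1 + S, fun _ => by omega, fun _ => ?_, ?_⟩
    · rcases Nat.lt_or_ge (2 * J + 1) M with h | h
      · have := hS h; omega
      · have := hS0 h; omega
    intro σ k R z h hs h13 h14 h21
    obtain ⟨F, hF, hP⟩ := sweepBody_runs (f := f) (g := g) h
    rw [h13] at hF hP
    set a := trialAmp f g (R k) J with ha
    have hφ := phase_mul_self f g
    have hsum : ∑ u, a u ^ 2 = 1 := sum_grover_sq hφ (R k) J
    have hzero : ∀ u, a u ≠ 0 → u ⬝ᵥ extend s = 0 := by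
      intro u hu
      by_contra h0
      exact hu (grover_iterate_eq_zero hφ _ (psi_eq_zero (phase_add_extend hI) h0) J)
    set W := ‖z‖ ^ 2 with hW
    have hW0 : 0 ≤ W := sq_nonneg _
    have hpow : ∀ j : ℕ, (1 : ℝ) ≤ 2 ^ j := fun j => one_le_pow₀ (by norm_num)
    have hnorm : ∀ u, ‖z * (a u : ℂ)‖ ^ 2 = W * a u ^ 2 := by
      intro u
      rw [norm_mul, mul_pow, Complex.norm_real, Real.norm_eq_abs, sq_abs]
    -- A success replaces `2 ^ k - 1` by `2 ^ (k - 1) - 1`, at most half of it; at `k = 0` the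
    -- potential is already zero.
    have hpot : ∀ u, pot n (F u) ≤
        W * (2 ^ k - 1) * (a u ^ 2 - 1 / 2 * if u ⬝ᵥ R k = 1 then a u ^ 2 else 0) ∨
        (k = 0 ∧ pot n (F u) = 0) := by
      intro u
      obtain ⟨-, -, -, -, -, h6⟩ := hP u
      rcases Nat.eq_zero_or_pos k with h0 | h0
      · rw [if_neg (by simp [h0])] at h6
        right; refine ⟨h0, ?_⟩
        rw [h6.pot_eq, h0]; simp
      · left
        obtain ⟨k, rfl⟩ : ∃ k', k = k' + 1 := ⟨k - 1, by omega⟩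
        by_cases hu : u ⬝ᵥ R (k + 1) = 1
        · rw [if_pos ⟨by omega, hu⟩] at h6
          rw [h6.pot_eq, hnorm, if_pos hu, Nat.add_sub_cancel, pow_succ (2 : ℝ) k]
          nlinarith [mul_nonneg hW0 (sq_nonneg (a u))]
        · rw [if_neg (by simp [hu])] at h6
          rw [h6.pot_eq, hnorm, if_neg hu]
          exact le_of_eq (by ring)
    have hpot' : ∀ u, pot n (F u) ≤ W * (2 ^ k - 1) * a u ^ 2 := by
      intro u
      have hk := hpow k
      have h0 : 0 ≤ W * (2 ^ k - 1) := mul_nonneg hW0 (by linarith)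
      rcases hpot u with h | h
      · refine h.trans (mul_le_mul_of_nonneg_left ?_ h0)
        split_ifs <;> nlinarith [sq_nonneg (a u)]
      · rw [h.2]; exact mul_nonneg h0 (sq_nonneg _)
    -- The last clause is for failed trials only, recognized by the unchanged row pointer; after a
    -- success the angle refers to a removed row.
    have hnext : ∀ b ∈ Finset.univ.val.map F, ∃ B,
        Runs f g sweepLoop b (500 * (n + 1) ^ 2 * S + 1) B ∧
        (∀ b' ∈ B, SweepEnd n s S b b') ∧ (B.map (pot n)).sum ≤ pot n b ∧
        (2 * J + 1 < M → (2 * ((2 * J + 1 : ℕ) : ℝ) + 1) * angle (phase f g) (R k) ≤ Real.pi / 2 →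
          b.regs 12 = k * (n + 1) → (B.map (pot n)).sum ≤ 7 / 8 * pot n b) := by
      intro b hb
      obtain ⟨u, -, rfl⟩ := Multiset.mem_map.1 hb
      obtain ⟨h1, h2, h3, h4, h5, h6⟩ := hP u
      by_cases hc : k ≠ 0 ∧ u ⬝ᵥ R k = 1
      · rw [if_pos hc] at h6
        obtain ⟨B, b1, b2, b3, b4⟩ := ih (F u) _ _ _ h6 (fun hz => by
          have hz1 : z ≠ 0 := left_ne_zero_of_mul hz
          have hz2 : a u ≠ 0 := by exact_mod_cast right_ne_zero_of_mul hz
          obtain ⟨k, rfl⟩ := Nat.exists_eq_succ_of_ne_zero hc.1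
          exact (hs hz1).elim h.le hc.2 (hzero u hz2)) h1 (h2.trans h14) (by rw [h4, h14])
        refine ⟨B, b1, b2, b3, fun _ _ h12 => ?_⟩
        rw [h6.ptr] at h12
        have := Nat.eq_of_mul_eq_mul_right (Nat.succ_pos n) h12
        have := hc.1
        omega
      · rw [if_neg hc] at h6
        obtain ⟨B, b1, b2, b3, b4⟩ := ih (F u) _ _ _ h6
          (fun hz => hs (left_ne_zero_of_mul hz)) h1 (h2.trans h14) (by rw [h4, h14])
        exact ⟨B, b1, b2, b3, fun h7 h8 _ => b4 h7 h8⟩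
    choose! G hG hend hle hlt using hnext
    have hmem : ∀ u, F u ∈ Finset.univ.val.map F := fun u =>
      Multiset.mem_map_of_mem _ (Finset.mem_univ u)
    have htot : (((Finset.univ.val.map F).bind G).map (pot n)).sum =
        ∑ u, ((G (F u)).map (pot n)).sum := by
      rw [Multiset.map_bind, Multiset.sum_bind, Multiset.map_map]
      rfl
    have hpotσ : pot n σ = W * (2 ^ k - 1) := h.pot_eq
    have hall : ∑ u, ((G (F u)).map (pot n)).sum ≤ pot n σ := by
      calc ∑ u, ((G (F u)).map (pot n)).sum ≤ ∑ u, W * (2 ^ k - 1) * a u ^ 2 :=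
            Finset.sum_le_sum fun u _ => (hle _ (hmem u)).trans (hpot' u)
        _ = pot n σ := by rw [← Finset.mul_sum, hsum, mul_one, hpotσ]
    refine ⟨(Finset.univ.val.map F).bind G, ?_, ?_, ?_, ?_⟩
    · refine (Runs.loop_step (by omega) hF hG).mono ?_
      nlinarith [Nat.zero_le (J * n), Nat.zero_le (J * n ^ 2), Nat.zero_le (n ^ 2)]
    · intro b hb
      obtain ⟨b₁, hb₁, hb⟩ := Multiset.mem_bind.1 hb
      have e := hend b₁ hb₁ b hb
      obtain ⟨u, -, rfl⟩ := Multiset.mem_map.1 hb₁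
      obtain ⟨h1, h2, h3, h4, h5, h6⟩ := hP u
      exact ⟨e.valid, e.bound.trans h2, e.counter.trans h3, by rw [e.queries, h5]; ring⟩
    · rw [htot]; exact hall
    · intro _ hθ
      rw [htot]
      by_cases hk : k = 0
      · have : pot n σ = 0 := by rw [hpotσ, hk]; simp
        rw [this] at hall ⊢; linarith
      by_cases hz : z = 0
      · have : pot n σ = 0 := by rw [hpotσ, hW, hz]; simp
        rw [this] at hall ⊢; linarith
      have hp := (hs hz).goodProb_ge hI h.le hk
      have hMθ := one_le_mul_angle hφ (R k) (M := M)
        (hM.trans (mul_le_mul_of_nonneg_left hp (sq_nonneg _)))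
      set θ := angle (phase f g) (R k) with hθdef
      have hθ0 : 0 ≤ θ := angle_nonneg _ _
      have hk1 := hpow k
      have hWk : 0 ≤ W * (2 ^ k - 1) := mul_nonneg hW0 (by linarith)
      rcases lt_or_ge ((2 * (J : ℝ) + 1) * θ) (Real.pi / 6) with hlow | hhigh
      -- Otherwise `(2 J + 1) θ ≥ M θ ≥ 1 > π / 6`, so there is a next trial.
      · have hlt' : 2 * J + 1 < M := by
          by_contra hcon
          have h1 : (M : ℝ) ≤ 2 * J + 1 := by exact_mod_cast not_lt.1 hcon
          have h2 := mul_le_mul_of_nonneg_right h1 hθ0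
          linarith [Real.pi_lt_four]
        -- The angle at most triples, since `4 J + 3 ≤ 3 (2 J + 1)`.
        have hθ' : (2 * ((2 * J + 1 : ℕ) : ℝ) + 1) * θ ≤ Real.pi / 2 := by
          push_cast
          have : 0 ≤ (J : ℝ) * θ := mul_nonneg (Nat.cast_nonneg _) hθ0
          nlinarith
        calc ∑ u, ((G (F u)).map (pot n)).sum ≤ ∑ u, 7 / 8 * (W * (2 ^ k - 1)) * a u ^ 2 := by
              refine Finset.sum_le_sum fun u _ => ?_
              have h6 := (hP u).2.2.2.2.2
              by_cases hu : u ⬝ᵥ R k = 1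
              · refine (hle _ (hmem u)).trans ?_
                rcases hpot u with h | h
                · rw [if_pos hu] at h
                  nlinarith [mul_nonneg hWk (sq_nonneg (a u))]
                · exact absurd h.1 hk
              · rw [if_neg (by simp [hu])] at h6
                have := hlt _ (hmem u) hlt' hθ' h6.ptr
                nlinarith [hpot' u]
          _ = 7 / 8 * pot n σ := by rw [← Finset.mul_sum, hsum, mul_one, hpotσ]
      · have hgood : (∑ u, if u ⬝ᵥ R k = 1 then a u ^ 2 else 0) =
            Real.sin ((2 * J + 1) * θ) ^ 2 := sum_grover_good hφ (R k) (sin_angle_sq hφ (R k)) J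
        have hsin := sin_sq_ge hhigh hθ
        calc ∑ u, ((G (F u)).map (pot n)).sum ≤
              ∑ u, W * (2 ^ k - 1) * (a u ^ 2 - 1 / 2 * if u ⬝ᵥ R k = 1 then a u ^ 2 else 0) := by
              refine Finset.sum_le_sum fun u _ => (hle _ (hmem u)).trans ?_
              rcases hpot u with h | h
              · exact h
              · exact absurd h.1 hk
          _ = W * (2 ^ k - 1) * (1 - 1 / 2 * Real.sin ((2 * J + 1) * θ) ^ 2) := by
              rw [← Finset.mul_sum, Finset.sum_sub_distrib, ← Finset.mul_sum, hsum, hgood]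
          _ ≤ 7 / 8 * pot n σ := by
              rw [hpotσ]
              nlinarith

end

section

variable {n : ℕ} {f g : (Fin n → ZMod 2) → ZMod 2} {s : Fin n → ZMod 2}

open Program (block)

/-! ### The main loop -/

/-- One sweep. -/
def sweepProg : Program := block [.const 13 0, .sub 21 14 13, sweepLoop, .sub 15 15 10]

theorem sweepProg_runs (hI : IsInstance f g s) {M : ℕ}
    (hM : 1 ≤ (M : ℝ) ^ 2 * minInfluence f) :
    ∃ S, M ≤ S ∧ S ≤ 4 * M ∧ ∀ σ, Valid s σ → σ.regs 14 = M →
    ∃ B, Runs f g sweepProg σ (500 * (n + 1) ^ 2 * S + 8) B ∧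
      (∀ b ∈ B, Valid s b ∧ b.regs 14 = M ∧ b.regs 15 = σ.regs 15 - 1 ∧
        b.queries = σ.queries + 4 * S) ∧
      (B.map (pot n)).sum ≤ 7 / 8 * pot n σ := by
  obtain ⟨S, -, hS, h⟩ := sweepLoop_runs hI hM M 0 (by omega)
  have hMpos : 0 < M := by
    rcases Nat.eq_zero_or_pos M with h0 | h0
    · rw [h0] at hM; norm_num at hM
    · exact h0
  have hS' := hS hMpos
  refine ⟨S, hS'.1, by omega, fun σ ⟨k, R, z, hr, hs⟩ h14 => ?_⟩
  set pre := Program.seq (.const 13 0) (.sub 21 14 13) with hpre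
  have hready : Ready n k R z (pre.run f g σ) :=
    ⟨hr.consts.of_regs (s := [13, 21]) (fun r _ hs => by
      simp only [List.mem_cons, List.not_mem_nil, or_false, not_or] at hs
      simp [hpre, Program.run, hs]) (by simp), hr.le, hr.ptr, hr.rows, hr.qubits⟩
  obtain ⟨B, hB, hend, -, hpot⟩ := h (pre.run f g σ) k R z hready hs (by simp [hpre, Program.run])
    (by simp [hpre, Program.run, h14]) (by simp [hpre, Program.run, h14])
  -- The first trial is not amplified, so its angle is an arcsine.
  have hθ : (2 * ((0 : ℕ) : ℝ) + 1) * angle (phase f g) (R k) ≤ Real.pi / 2 := by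
    rw [Nat.cast_zero, mul_zero, zero_add, one_mul]
    exact Real.arcsin_le_pi_div_two _
  have hpot := hpot hMpos hθ
  have hfin : ∀ b ∈ B, Runs f g (.sub 15 15 10) b 1 {Program.run f g (.sub 15 15 10) b} :=
    fun b _ => Runs.of_simple rfl b
  have hall := (Runs.of_simple (f := f) (g := g) (p := .const 13 0) rfl σ).seq_det
    ((Runs.of_simple (p := .sub 21 14 13) rfl _).seq_det (hB.seq hfin))
  rw [Multiset.bind_singleton] at hall
  refine ⟨_, hall.mono (by simp only [Program.cost]; omega), ?_, ?_⟩
  · intro b' hb'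
    obtain ⟨b, hb, rfl⟩ := Multiset.mem_map.1 hb'
    have e := hend b hb
    obtain ⟨k', R', z', hr', hs'⟩ := e.valid
    have e14 : b.regs 14 = M := by rw [e.bound]; simp [hpre, Program.run, h14]
    have e15 : b.regs 15 = σ.regs 15 := by rw [e.counter]; simp [hpre, Program.run]
    have e10 := hr'.consts.one
    refine ⟨⟨k', R', z', ⟨hr'.consts.of_regs (s := [15]) (fun r _ hs => by
      simp only [List.mem_singleton] at hs
      simp [Program.run, hs]) (by simp), hr'.le, hr'.ptr, hr'.rows, hr'.qubits⟩, hs'⟩, ?_, ?_, ?_⟩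
    · simp [Program.run, e14]
    · simp [Program.run, e15, e10]
    · exact e.queries
  · rw [Multiset.map_map]
    refine le_trans (le_of_eq ?_) hpot
    rfl

/-- All sweeps. -/
def mainLoop : Program := .loop 15 sweepProg

/-- The contraction of a sweep is linear in the potential of its starting state, so it can be summed
over the branches and iterated; no independence of the sweeps is needed. -/
theorem mainLoop_runs (hI : IsInstance f g s) {M : ℕ}
    (hM : 1 ≤ (M : ℝ) ^ 2 * minInfluence f) :
    ∃ S, M ≤ S ∧ S ≤ 4 * M ∧ ∀ m σ, Valid s σ → σ.regs 14 = M → σ.regs 15 = m →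
    ∃ B, Runs f g mainLoop σ (m * (500 * (n + 1) ^ 2 * S + 9) + 1) B ∧
      (∀ b ∈ B, Valid s b ∧ b.queries = σ.queries + m * (4 * S)) ∧
      (B.map (pot n)).sum ≤ (7 / 8) ^ m * pot n σ := by
  obtain ⟨S, h1, h2, hS⟩ := sweepProg_runs hI hM
  refine ⟨S, h1, h2, fun m => ?_⟩
  induction m with
  | zero =>
    intro σ hv h14 h15
    refine ⟨{σ}, Runs.loop_done h15 _, fun b hb => ?_, by simp⟩
    rw [Multiset.mem_singleton.1 hb]
    exact ⟨hv, by ring⟩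
  | succ m ih =>
    intro σ hv h14 h15
    obtain ⟨B, hB, hP, hpot⟩ := hS σ hv h14
    have hnext : ∀ b ∈ B, ∃ B', Runs f g mainLoop b (m * (500 * (n + 1) ^ 2 * S + 9) + 1) B' ∧
        (∀ b' ∈ B', Valid s b' ∧ b'.queries = b.queries + m * (4 * S)) ∧
        (B'.map (pot n)).sum ≤ (7 / 8) ^ m * pot n b := by
      intro b hb
      obtain ⟨k1, k2, k3, -⟩ := hP b hb
      exact ih b k1 k2 (by omega)
    choose! G hG hv' hle using hnext
    refine ⟨B.bind G, (Runs.loop_step (by omega) hB hG).mono (le_of_eq (by ring)), ?_, ?_⟩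
    · intro b' hb'
      obtain ⟨b, hb, hb'⟩ := Multiset.mem_bind.1 hb'
      have := hv' b hb b' hb'
      refine ⟨this.1, ?_⟩
      rw [this.2, (hP b hb).2.2.2]; ring
    · rw [Multiset.map_bind, Multiset.sum_bind]
      calc (B.map fun b => ((G b).map (pot n)).sum).sum
          ≤ (B.map fun b => (7 / 8) ^ m * pot n b).sum := Multiset.sum_map_le_sum_map _ _ hle
        _ = (7 / 8) ^ m * (B.map (pot n)).sum := Multiset.sum_map_mul_left
        _ ≤ (7 / 8) ^ m * (7 / 8 * pot n σ) := mul_le_mul_of_nonneg_left hpot (by positivity)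
        _ = (7 / 8) ^ (m + 1) * pot n σ := by ring

/-! ### The setup -/

/-- The initial table. -/
def initRows (n : ℕ) (i : ℕ) (c : Fin (n + 1)) : ZMod 2 :=
  if (i = 0 ∧ (c : ℕ) = n) ∨ i = c + 1 then 1 else 0

/-- Row `0` is the last unit vector and the other rows are the remaining ones, so the coefficients
of the solution are the bits of `s`. -/
theorem sound_initRows (s : Fin n → ZMod 2) : Sound s n (initRows n) := by
  refine ⟨fun i _ => by simp [initRows], fun i j _ hj => ?_, fun i hi => ?_, ?_⟩
  · have : (j : ℕ) < i := hj
    simp only [initRows]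
    rw [if_neg (by omega)]
  · simp only [initRows, Fin.val_last]
    rw [if_neg (by omega)]
  · refine ⟨fun i => if h : i < n then s ⟨i, h⟩ else 0, ?_⟩
    funext c
    rw [Pi.add_apply, Finset.sum_apply]
    refine Fin.lastCases ?_ (fun c => ?_) c
    · rw [Finset.sum_eq_zero]
      · simp [extend, initRows]
      · intro i hi
        have := Finset.mem_range.1 hi
        simp only [Pi.smul_apply, initRows, Fin.val_last]
        rw [if_neg (by omega), smul_zero]
    · have hc := c.isLt
      rw [Finset.sum_eq_single (c : ℕ)]
      · simp only [extend, Fin.snoc_castSucc, Pi.smul_apply, initRows, Fin.val_castSucc]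
        simp [hc.ne, hc]
      · intro i _ hi
        simp only [Pi.smul_apply, initRows, Fin.val_castSucc]
        rw [if_neg (by omega), smul_zero]
      · intro h; exact absurd (Finset.mem_range.2 hc) h

/-- The result of the first part of the setup. -/
structure Prepared (n : ℕ) (σ : St) : Prop where
  consts : Consts n σ
  ptr : σ.regs 12 = n * (n + 1)
  rows : Rows n σ.mem (initRows n)
  qubits : σ.qubits = ket ∅
  queries : σ.queries = 0

theorem Prepared.ready {σ : St} (h : Prepared n σ) : Ready n n (initRows n) 1 σ :=
  ⟨h.consts, le_rfl, h.ptr, h.rows, by rw [h.qubits, one_smul]⟩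

theorem Prepared.update {σ : St} (h : Prepared n σ) {r : ℕ} (hr : r < 10 ∨ r = 14 ∨ r = 15)
    (v : ℕ) : Prepared n ⟨Function.update σ.regs r v, σ.mem, σ.qubits, σ.queries⟩ := by
  have hne : ∀ q ∈ [10, 11, 12, 16, 17, 18, 20], q ≠ r := by
    intro q hq
    simp only [List.mem_cons, List.not_mem_nil, or_false] at hq
    omega
  exact ⟨h.consts.of_regs (s := [r]) (fun q _ hq =>
    Function.update_of_ne (by simpa using hq) _ _) (fun q hq => by
      simp only [List.mem_singleton]
      refine hne q ?_
      simp only [List.mem_cons, List.not_mem_nil, or_false] at hq ⊢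
      tauto),
    (Function.update_of_ne (hne 12 (by simp)) _ _).trans h.ptr, h.rows, h.qubits, h.queries⟩

/-- Set the constants. -/
def constProg : Program :=
  block [.const 10 1, .add 11 0 10, .add 16 11 10, .add 20 11 16, .sub 3 11 10, .store 3 10,
    .add 3 11 18]

/-- Set up the table. -/
def tableProg : Program :=
  .seq (.loop 0 (block [.store 3 10, .add 3 3 16, .add 12 12 11, .sub 0 0 10])) (.add 17 12 11)

/-- The `1` of row `j + 1` lies in column `j`, at the address `(j + 1)(n + 1) + j = j (n + 2) + (n +
1)`, whence the stride `n + 2`. The `1` of row `0` has address `n`. -/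
theorem tableProg_reaches (D E : ℕ) :
    Reaches f g (.seq constProg tableProg) (startSt n D E) (8 * n + 20) fun σ =>
      Prepared n σ ∧ σ.regs 1 = D ∧ σ.regs 2 = E ∧ σ.regs 14 = 0 ∧ σ.regs 6 = 0 := by
  let I : ℕ → St → Prop := fun i σ => i ≤ n ∧ σ.regs 0 = i ∧
    σ.regs 3 = (n - i) * (n + 2) + (n + 1) ∧ σ.regs 12 = (n - i) * (n + 1) ∧
    (σ.mem = fun a => if a = n ∨ ∃ j < n - i, a = j * (n + 2) + (n + 1) then 1 else 0) ∧
    (σ.regs 1 = D ∧ σ.regs 2 = E ∧ σ.regs 6 = 0 ∧ σ.regs 14 = 0) ∧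
    (σ.regs 10 = 1 ∧ σ.regs 11 = n + 1 ∧ σ.regs 16 = n + 2 ∧ σ.regs 18 = 0 ∧
      σ.regs 20 = 2 * (n + 1) + 1) ∧
    σ.qubits = ket ∅ ∧ σ.queries = 0
  have s1 : Reaches f g constProg (startSt n D E) 13 (I n) := by
    refine Reaches.of_simple rfl ?_
    simp only [I]
    refine ⟨le_rfl, ?_, ?_, ?_, ?_, ⟨?_, ?_, ?_, ?_⟩, ⟨?_, ?_, ?_, ?_, ?_⟩, rfl, rfl⟩
    case refine_4 =>
      funext a
      simp [constProg, block, Program.run, startSt, Function.update_apply]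
    case refine_13 =>
      simp [constProg, block, Program.run, startSt]; ring
    all_goals simp [constProg, block, Program.run, startSt]
  have s2 : ∀ σ, I n σ → Reaches f g
      (.loop 0 (block [.store 3 10, .add 3 3 16, .add 12 12 11, .sub 0 0 10])) σ
      (n * 8 + 1) (I 0) := by
    refine fun σ hσ => Reaches.loop (t := 7) I ?_ (fun _ h => h.2.1) n σ hσ
    rintro i σ ⟨h1, h2, h3, h4, h5, ⟨a1, a2, a3, a4⟩, ⟨b1, b2, b3, b4, b5⟩, h6, h7⟩
    obtain ⟨d, hd⟩ : ∃ d, n - i = d + 1 ∧ n - (i + 1) = d := ⟨n - (i + 1), by omega, rfl⟩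
    rw [hd.2] at h3 h4 h5
    refine ⟨by omega, Reaches.of_simple rfl ?_⟩
    simp only [I, hd.1]
    refine ⟨by omega, ?_, ?_, ?_, ?_, ⟨?_, ?_, ?_, ?_⟩, ⟨?_, ?_, ?_, ?_, ?_⟩, h6, h7⟩
    case refine_2 => simp [block, Program.run, h3, b3]; ring
    case refine_3 => simp [block, Program.run, h4, b2]; ring
    case refine_4 =>
      funext a
      simp only [block, Program.run, h3, h5, b1, Function.update_apply]
      by_cases ha : a = d * (n + 2) + (n + 1)
      · rw [if_pos ha, if_pos (.inr ⟨d, Nat.lt_succ_self d, ha⟩)]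
      · rw [if_neg ha]
        refine if_congr (or_congr_right ?_) rfl rfl
        constructor
        · rintro ⟨j, hj, h⟩; exact ⟨j, by omega, h⟩
        · rintro ⟨j, hj, h⟩
          refine ⟨j, ?_, h⟩
          have : j ≠ d := fun e => ha (e ▸ h)
          omega
    all_goals simp [block, Program.run, h2, a1, a2, a3, a4, b1, b2, b3, b4, b5]
  refine (s1.seq fun σ hσ => (s2 σ hσ).seq (t' := 1) (Q' := fun σ =>
    Prepared n σ ∧ σ.regs 1 = D ∧ σ.regs 2 = E ∧ σ.regs 14 = 0 ∧ σ.regs 6 = 0) ?_).mono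
    (by omega) fun _ h => h
  rintro σ ⟨h1, h2, h3, h4, h5, ⟨a1, a2, a3, a4⟩, ⟨b1, b2, b3, b4, b5⟩, h6, h7⟩
  rw [Nat.sub_zero] at h4 h5
  refine Reaches.of_simple rfl ⟨⟨⟨?_, ?_, ?_, ?_, ?_, ?_⟩, ?_, ?_, h6, h7⟩, ?_, ?_, ?_, ?_⟩
  case refine_4 => simp [Program.run, h4, b2]; ring
  case refine_8 =>
    intro i hi c
    have hc := c.isLt
    have key : ∀ {a b a' b' : ℕ}, b < n + 1 → b' < n + 1 →
        a * (n + 1) + b = a' * (n + 1) + b' → a = a' ∧ b = b' := by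
      intro a b a' b' hb hb' h
      have e1 : a = a' := by
        have h1 := congrArg (· / (n + 1)) h
        simpa [Nat.add_div_of_dvd_right, Nat.add_comm, Nat.add_mul_div_right,
          Nat.div_eq_of_lt hb, Nat.div_eq_of_lt hb'] using h1
      subst e1
      exact ⟨rfl, by omega⟩
    simp only [Program.run, h5, initRows]
    have : (i * (n + 1) + (c : ℕ) = n ∨
        ∃ j < n, i * (n + 1) + (c : ℕ) = j * (n + 2) + (n + 1)) ↔
        (i = 0 ∧ (c : ℕ) = n) ∨ i = c + 1 := by
      refine or_congr ⟨fun h => ?_, fun h => by rw [h.1, h.2]; ring⟩ ⟨?_, fun h => ?_⟩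
      · exact key hc (Nat.lt_succ_self n) (h.trans (by ring : n = 0 * (n + 1) + n))
      · rintro ⟨j, hj, h⟩
        have := key (a' := j + 1) (b' := j) hc (by omega) (h.trans (by ring))
        omega
      · exact ⟨c, by omega, by rw [h]; ring⟩
    simp only [this]
    split_ifs <;> simp [ZMod.val_one]
  all_goals simp [Program.run, h4, a1, a2, a3, a4, b1, b2, b3, b4, b5]

/-- Compute the square root of register `1`, rounded up. -/
def sqrtProg : Program :=
  .seq (.const 3 1) (.loop 1 (block [.sub 1 1 3, .add 3 3 10, .add 3 3 10, .add 14 14 10]))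

/-- The odd numbers `1, 3, 5, …` are subtracted in turn: after `d` rounds `D - d ^ 2` is left, which
first vanishes at `d = M`. -/
theorem sqrtProg_reaches {σ : St} {D E M : ℕ} (hσ : Prepared n σ ∧ σ.regs 1 = D ∧ σ.regs 2 = E ∧
    σ.regs 14 = 0 ∧ σ.regs 6 = 0) (hM : D ≤ M ^ 2) (hmin : ∀ d < M, d ^ 2 < D) :
    Reaches f g sqrtProg σ (8 * M + 3) fun τ =>
      Prepared n τ ∧ τ.regs 2 = E ∧ τ.regs 14 = M ∧ τ.regs 6 = 0 := by
  let I : ℕ → St → Prop := fun i τ => i ≤ M ∧ Prepared n τ ∧ τ.regs 1 = D - (M - i) ^ 2 ∧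
    τ.regs 3 = 2 * (M - i) + 1 ∧ τ.regs 14 = M - i ∧ τ.regs 2 = E ∧ τ.regs 6 = 0
  obtain ⟨h1, h2, h3, h4, h5⟩ := hσ
  have s1 : Reaches f g (.const 3 1) σ 1 (I M) := by
    refine Reaches.of_simple rfl ⟨le_rfl, h1.update (by norm_num) _, ?_, ?_, ?_, ?_, ?_⟩ <;>
      simp [Program.run, h2, h3, h4, h5]
  refine (s1.seq (Reaches.loop (t := 7) I ?_ ?_ M)).mono (by omega) ?_
  · rintro i τ ⟨k1, k2, k3, k4, k5, k6, k7⟩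
    obtain ⟨d, hd⟩ : ∃ d, M - i = d + 1 ∧ M - (i + 1) = d := ⟨M - (i + 1), by omega, rfl⟩
    rw [hd.2] at k3 k4 k5
    have e10 := k2.consts.one
    refine ⟨by rw [k3]; have := hmin d (by omega); omega, Reaches.of_simple rfl
      ⟨by omega, (((k2.update (r := 1) (by norm_num) _).update (r := 3) (by norm_num) _).update
        (r := 3) (by norm_num) _).update (r := 14) (by norm_num) _, ?_, ?_, ?_, ?_, ?_⟩⟩
    · rw [hd.1]
      simp [block, Program.run, k3, k4]
      rw [Nat.sub_sub]
      congr 1; ring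
    · rw [hd.1]; simp [block, Program.run, k4, e10]; ring
    · rw [hd.1]; simp [block, Program.run, k5, e10]
    · simp [block, Program.run, k6]
    · simp [block, Program.run, k7]
  · rintro τ ⟨k1, k2, k3, -⟩
    rw [k3, Nat.sub_zero]; omega
  · rintro τ ⟨k1, k2, k3, k4, k5, k6, k7⟩
    exact ⟨k2, k6, k5, k7⟩

/-- Compute the binary logarithm of register `2`, rounded up. -/
def logProg : Program :=
  block [.const 4 1, .sub 5 2 4, .loop 5 (block [.add 4 4 4, .add 6 6 10, .sub 5 2 4])]

theorem logProg_reaches {σ : St} {E M l : ℕ} (hσ : Prepared n σ ∧ σ.regs 2 = E ∧ σ.regs 14 = M ∧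
    σ.regs 6 = 0) (hl : E ≤ 2 ^ l) (hmin : ∀ d < l, 2 ^ d < E) :
    Reaches f g logProg σ (6 * l + 5) fun τ =>
      Prepared n τ ∧ τ.regs 14 = M ∧ τ.regs 6 = l := by
  let I : ℕ → St → Prop := fun i τ => i ≤ l ∧ Prepared n τ ∧ τ.regs 4 = 2 ^ (l - i) ∧
    τ.regs 5 = E - 2 ^ (l - i) ∧ τ.regs 6 = l - i ∧ τ.regs 2 = E ∧ τ.regs 14 = M
  obtain ⟨h1, h2, h3, h4⟩ := hσ
  have s1 : Reaches f g (.const 4 1) σ 1 fun τ => Reaches f g (.sub 5 2 4) τ 1 (I l) := by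
    refine Reaches.of_simple rfl (Reaches.of_simple rfl ⟨le_rfl,
      (h1.update (r := 4) (by norm_num) _).update (r := 5) (by norm_num) _, ?_, ?_, ?_, ?_, ?_⟩) <;>
      simp [Program.run, h2, h3, h4]
  refine (s1.seq fun τ hτ => hτ.seq (Reaches.loop (t := 5) I ?_ ?_ l)).mono (by omega) ?_
  · rintro i τ ⟨k1, k2, k3, k4, k5, k6, k7⟩
    obtain ⟨d, hd⟩ : ∃ d, l - i = d + 1 ∧ l - (i + 1) = d := ⟨l - (i + 1), by omega, rfl⟩
    rw [hd.2] at k3 k4 k5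
    have e10 := k2.consts.one
    have e2 : 2 ^ d + 2 ^ d = 2 ^ (d + 1) := by ring
    refine ⟨by rw [k4]; have := hmin d (by omega); omega, Reaches.of_simple rfl
      ⟨by omega, ((k2.update (r := 4) (by norm_num) _).update (r := 6) (by norm_num) _).update
        (r := 5) (by norm_num) _, ?_, ?_, ?_, ?_, ?_⟩⟩
    · rw [hd.1]; simp [block, Program.run, k3, e2]
    · rw [hd.1]; simp [block, Program.run, k3, k6, e2]
    · rw [hd.1]; simp [block, Program.run, k5, e10]
    · simp [block, Program.run, k6]
    · simp [block, Program.run, k7]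
  · rintro τ ⟨k1, k2, k3, k4, -⟩
    rw [k4, Nat.sub_zero]; omega
  · rintro τ ⟨k1, k2, k3, k4, k5, k6, k7⟩
    exact ⟨k2, k7, k5⟩

/-- Compute the number of sweeps. -/
def countProg : Program :=
  block [.sub 7 11 10, .add 6 6 7, .add 7 6 6, .add 15 7 7, .add 15 15 7]

theorem countProg_reaches {σ : St} {M l : ℕ} (hσ : Prepared n σ ∧ σ.regs 14 = M ∧ σ.regs 6 = l) :
    Reaches f g countProg σ 9 fun τ =>
      Prepared n τ ∧ τ.regs 14 = M ∧ τ.regs 15 = 6 * (n + l) := by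
  obtain ⟨h1, h2, h3⟩ := hσ
  refine Reaches.of_simple rfl ⟨((((h1.update (r := 7) (by norm_num) _).update (r := 6)
    (by norm_num) _).update (r := 7) (by norm_num) _).update (r := 15) (by norm_num) _).update
    (r := 15) (by norm_num) _, ?_, ?_⟩
  · simp [countProg, block, Program.run, h2]
  · simp [countProg, block, Program.run, h3, h1.consts.one, h1.consts.size]; ring

/-- The algorithm. -/
def shiftProg : Program :=
  block [.seq constProg tableProg, sqrtProg, logProg, countProg, mainLoop]

theorem shiftProg_runs (hI : IsInstance f g s) {D E M l : ℕ}
    (hM : 1 ≤ (M : ℝ) ^ 2 * minInfluence f) (hD : D ≤ M ^ 2) (hDmin : ∀ d < M, d ^ 2 < D)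
    (hE : E ≤ 2 ^ l) (hEmin : ∀ d < l, 2 ^ d < E) :
    ∃ S, M ≤ S ∧ S ≤ 4 * M ∧
    ∃ B, Runs f g shiftProg (startSt n D E)
        (8 * (n + M + l) + 50 + 6 * (n + l) * (500 * (n + 1) ^ 2 * S + 9)) B ∧
      (∀ b ∈ B, Valid s b ∧ b.queries = 6 * (n + l) * (4 * S)) ∧
      (B.map (pot n)).sum ≤ (7 / 8) ^ (6 * (n + l)) * (2 ^ n - 1) := by
  obtain ⟨S, h1, h2, h⟩ := mainLoop_runs hI hM
  refine ⟨S, h1, h2, ?_⟩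
  obtain ⟨σ₁, r1, q1⟩ := tableProg_reaches (f := f) (g := g) D E
  obtain ⟨σ₂, r2, q2⟩ := sqrtProg_reaches (f := f) (g := g) q1 hD hDmin
  obtain ⟨σ₃, r3, q3⟩ := logProg_reaches (f := f) (g := g) q2 hE hEmin
  obtain ⟨σ₄, r4, q4, q5, q6⟩ := countProg_reaches (f := f) (g := g) q3
  obtain ⟨B, hB, hP, hpot⟩ := h _ σ₄ ⟨n, _, 1, q4.ready, fun _ => sound_initRows s⟩ q5 q6
  refine ⟨B, (r1.seq_det (r2.seq_det (r3.seq_det (r4.seq_det hB)))).mono (by omega), ?_, ?_⟩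
  · intro b hb
    refine ⟨(hP b hb).1, ?_⟩
    rw [(hP b hb).2, q4.queries, zero_add]
  · rw [q4.ready.pot_eq] at hpot
    simpa using hpot

end

section

variable {n : ℕ} {f g : (Fin n → ZMod 2) → ZMod 2} {s : Fin n → ZMod 2}

/-! ### Probabilities -/

theorem probability_cons (c : Config) (B : Multiset Config) (p : Config → Prop) [Decidable (p c)] :
    probability (c ::ₘ B) p =
      (if p c then (weight c.qubits : ℝ≥0∞) else 0) + probability B p := by
  classical
  unfold probability
  by_cases h : p c <;> simp [h]

theorem probability_add_compl (B : Multiset Config) (p : Config → Prop) :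
    probability B p + probability B (fun c => ¬ p c) =
      (((B.map fun c => weight c.qubits).sum : ℝ≥0) : ℝ≥0∞) := by
  classical
  induction B using Multiset.induction_on with
  | empty => simp [probability]
  | cons c B ih =>
    rw [probability_cons, probability_cons, Multiset.map_cons, Multiset.sum_cons, ENNReal.coe_add,
      ← ih]
    by_cases h : p c
    · simp [h, add_assoc]
    · simp [h, add_left_comm]

theorem probability_eq_zero {B : Multiset Config} {p : Config → Prop} (h : ∀ c ∈ B, ¬ p c) :
    probability B p = 0 := by
  classical
  unfold probability
  rw [Multiset.filter_eq_nil.2 h]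
  rfl

theorem sum_weight_branches (P : Program) (D E t : ℕ) :
    ((P.branches f g D E t).map fun c => weight c.qubits).sum = 1 := by
  rw [branches_eq_iter, weight_iter]
  exact weight_ket ∅

theorem probability_branches_le_one (P : Program) (D E t : ℕ) (p : Config → Prop) :
    probability (P.branches f g D E t) p ≤ 1 := by
  have := probability_add_compl (P.branches f g D E t) p
  rw [sum_weight_branches] at this
  exact le_self_add.trans this.le

theorem Valid.pot_nonneg {σ : St} (h : Valid s σ) : 0 ≤ pot n σ := by
  obtain ⟨k, R, z, h, -⟩ := h
  exact h.pot_nonneg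

/-- For `k ≥ 1` the factor `2 ^ k - 1` is at least `1`. For `k = 0` and nonzero amplitude, row `0`
is the extended solution and occupies the output cells, so the branch does not fail. -/
theorem Valid.weight_le_pot {σ : St} (h : Valid s σ) (hσ : ¬ (σ.push []).Outputs s) :
    (weight σ.qubits : ℝ) ≤ pot n σ := by
  obtain ⟨k, R, z, h, hs⟩ := h
  rw [h.pot_eq, h.qubits, weight_smul, weight_ket]
  by_cases hz : z = 0
  · simp [hz]
  rcases Nat.eq_zero_or_pos k with rfl | hk
  · refine absurd (fun i => ?_) hσ
    have := h.rows 0 (Nat.zero_le _) i.castSucc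
    rw [(hs hz).zero] at this
    simpa [extend, St.push] using this
  · have : (2 : ℝ) ^ 1 ≤ 2 ^ k := pow_le_pow_right₀ (by norm_num) hk
    have h2 := sq_nonneg ‖z‖
    push_cast
    nlinarith

theorem probability_fail_le {B : Multiset St} (hB : ∀ b ∈ B, Valid s b) :
    probability (B.map (St.push [])) (fun c => ¬ (c.Halted ∧ c.Outputs s)) ≤
      ENNReal.ofReal (B.map (pot n)).sum := by
  classical
  have h0 : ∀ B : Multiset St, (∀ b ∈ B, Valid s b) → 0 ≤ (B.map (pot n)).sum := fun B hB =>
    Multiset.sum_nonneg fun x hx => by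
      obtain ⟨b, hb, rfl⟩ := Multiset.mem_map.1 hx
      exact (hB b hb).pot_nonneg
  induction B using Multiset.induction_on with
  | empty => simp [probability]
  | cons b B ih =>
    have hb := hB b (Multiset.mem_cons_self b B)
    have hB' : ∀ b ∈ B, Valid s b := fun c hc => hB c (Multiset.mem_cons_of_mem hc)
    rw [Multiset.map_cons, Multiset.map_cons, Multiset.sum_cons, probability_cons,
      ENNReal.ofReal_add hb.pot_nonneg (h0 B hB')]
    refine add_le_add ?_ (ih hB')
    by_cases h : (b.push []).Halted ∧ (b.push []).Outputs s
    · rw [if_neg (not_not.2 h)]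
      exact zero_le
    · rw [if_pos h]
      have hw := hb.weight_le_pot fun ho => h ⟨rfl, ho⟩
      refine le_trans (le_of_eq ?_) (ENNReal.ofReal_le_ofReal hw)
      exact (ENNReal.ofReal_coe_nnreal).symm

theorem le_successProbability {P : Program} {D E T : ℕ} {B : Multiset St}
    (h : Runs f g P (startSt n D E) T B) (hB : ∀ b ∈ B, Valid s b) {ε : ℝ} (hε : 0 ≤ ε)
    (hpot : (B.map (pot n)).sum ≤ ε) :
    ENNReal.ofReal (1 - ε) ≤ P.successProbability f g D E s := by
  refine le_trans ?_ (le_iSup _ T)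
  have h1 := probability_add_compl (P.branches f g D E T) fun c => c.Halted ∧ c.Outputs s
  rw [sum_weight_branches] at h1
  have h2 := (probability_fail_le hB).trans (ENNReal.ofReal_le_ofReal hpot)
  rw [← h.branches_eq le_rfl] at h2
  rw [ENNReal.ofReal_sub _ hε, ENNReal.ofReal_one, tsub_le_iff_right, ← ENNReal.coe_one, ← h1]
  exact add_le_add le_rfl h2

theorem expectedTime_le {P : Program} {D E T : ℕ} {B : Multiset St}
    (h : Runs f g P (startSt n D E) T B) : P.expectedTime f g D E ≤ T := by
  unfold Program.expectedTime
  rw [tsum_eq_sum (s := Finset.range T)]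
  · refine (Finset.sum_le_sum fun t _ => probability_branches_le_one P D E t _).trans ?_
    simp
  · intro t ht
    rw [h.branches_eq (by simpa using ht)]
    refine probability_eq_zero fun c hc => ?_
    obtain ⟨b, -, rfl⟩ := Multiset.mem_map.1 hc
    exact not_not.2 rfl

/-- Every branch can be prolonged to a leaf without losing queries, so `q` is an upper bound. It is
attained on a leaf of nonzero weight, which exists because the weights sum to `1`. -/
theorem maxQueries_eq {P : Program} {D E T q : ℕ} {B : Multiset St}
    (h : Runs f g P (startSt n D E) T B) (hq : ∀ b ∈ B, b.queries = q) :
    P.maxQueries f g D E = q := by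
  refine le_antisymm ?_ ?_
  · refine iSup_le fun t => iSup₂_le fun c hc => iSup_le fun _ => ?_
    obtain ⟨c', hc', hle⟩ := exists_mem_branches hc T
    rw [h.branches_eq (Nat.le_add_left T t)] at hc'
    obtain ⟨b, hb, rfl⟩ := Multiset.mem_map.1 hc'
    rw [← hq b hb]
    exact_mod_cast hle
  · have hsum := sum_weight_branches (f := f) (g := g) P D E T
    have : ∃ c ∈ P.branches f g D E T, weight c.qubits ≠ 0 := by
      by_contra! hno
      rw [Multiset.map_congr rfl hno] at hsum
      simp at hsum
    obtain ⟨c, hc, hw⟩ := this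
    have hcq : c.queries = q := by
      have hc' := hc
      rw [h.branches_eq le_rfl] at hc'
      obtain ⟨b, hb, rfl⟩ := Multiset.mem_map.1 hc'
      exact hq b hb
    unfold Program.maxQueries
    rw [← hcq]
    exact le_iSup_of_le T (le_iSup₂_of_le c hc (le_iSup_of_le hw le_rfl))

/-! ### The parameters -/

theorem minInfluence_le_one (hn : 1 ≤ n) (f : (Fin n → ZMod 2) → ZMod 2) : minInfluence f ≤ 1 := by
  have hv : (fun _ => 1 : Fin n → ZMod 2) ≠ 0 := fun h => one_ne_zero (congrFun h ⟨0, hn⟩)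
  refine (minInfluence_le f hv).trans (div_le_one_of_le₀ ?_ (Nat.cast_nonneg _))
  exact_mod_cast Finset.card_le_univ _

theorem exists_sqrt {δ : ℝ} (hδ : 0 < δ) (hδ1 : δ ≤ 1) :
    ∃ M : ℕ, ⌈1 / δ⌉₊ ≤ M ^ 2 ∧ (∀ d < M, d ^ 2 < ⌈1 / δ⌉₊) ∧ 1 ≤ (M : ℝ) ^ 2 * δ ∧
      (M : ℝ) ≤ 3 / √δ := by
  have hex : ∃ M : ℕ, ⌈1 / δ⌉₊ ≤ M ^ 2 := ⟨_, Nat.le_self_pow two_ne_zero _⟩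
  refine ⟨Nat.find hex, Nat.find_spec hex, fun d hd => not_le.1 (Nat.find_min hex hd), ?_, ?_⟩
  · have h1 : 1 / δ ≤ (Nat.find hex : ℝ) ^ 2 :=
      (Nat.le_ceil _).trans (by exact_mod_cast Nat.find_spec hex)
    rwa [div_le_iff₀ hδ] at h1
  · have hs : 0 < √δ := Real.sqrt_pos.2 hδ
    have hs2 : √δ ^ 2 = δ := Real.sq_sqrt hδ.le
    have hs1 : √δ ≤ 1 := Real.sqrt_le_one.2 hδ1
    rw [le_div_iff₀ hs]
    rcases Nat.eq_zero_or_pos (Nat.find hex) with h | h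
    · rw [h]; norm_num
    obtain ⟨m, hm⟩ : ∃ m, Nat.find hex = m + 1 := ⟨_, (Nat.succ_pred_eq_of_pos h).symm⟩
    have h1 : m ^ 2 < ⌈1 / δ⌉₊ := not_le.1 (Nat.find_min hex (by omega))
    have h2 : (m : ℝ) ^ 2 < 1 / δ + 1 := by
      have := Nat.ceil_lt_add_one (a := 1 / δ) (by positivity)
      have h3 : ((m ^ 2 : ℕ) : ℝ) < (⌈1 / δ⌉₊ : ℝ) := by exact_mod_cast h1
      push_cast at h3
      linarith
    rw [hm]
    push_cast
    -- Here `m ^ 2 * δ < 1 + δ ≤ 2`. Passing from `m` to `M = m + 1` adds `√δ ≤ 1`, which gives the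
    -- constant `3`.
    have h4 : ((m : ℝ) * √δ) ^ 2 ≤ 2 ^ 2 := by
      have := mul_lt_mul_of_pos_right h2 hδ
      rw [add_mul, div_mul_cancel₀ _ hδ.ne'] at this
      rw [mul_pow, hs2]
      linarith
    have h5 := abs_le_of_sq_le_sq h4 (by norm_num)
    linarith [(abs_le.1 h5).2]

theorem exists_log {ε : ℝ} (hε : 0 < ε) (hε1 : ε < 1) :
    ∃ l : ℕ, ⌈1 / ε⌉₊ ≤ 2 ^ l ∧ (∀ d < l, 2 ^ d < ⌈1 / ε⌉₊) ∧ (1 / 2 : ℝ) ^ l ≤ ε ∧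
      (l : ℝ) ≤ 4 * max 1 (Real.log (1 / ε)) := by
  have hex : ∃ l : ℕ, ⌈1 / ε⌉₊ ≤ 2 ^ l := ⟨_, Nat.lt_two_pow_self.le⟩
  refine ⟨Nat.find hex, Nat.find_spec hex, fun d hd => not_le.1 (Nat.find_min hex hd), ?_, ?_⟩
  · have h1 : 1 / ε ≤ (2 : ℝ) ^ Nat.find hex :=
      (Nat.le_ceil _).trans (by exact_mod_cast Nat.find_spec hex)
    rw [one_div_pow]
    exact one_div_le hε (by positivity) |>.1 h1
  · rcases Nat.eq_zero_or_pos (Nat.find hex) with h | h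
    · rw [h, Nat.cast_zero]; positivity
    obtain ⟨m, hm⟩ : ∃ m, Nat.find hex = m + 1 := ⟨_, (Nat.succ_pred_eq_of_pos h).symm⟩
    have h1 : 2 ^ m < ⌈1 / ε⌉₊ := not_le.1 (Nat.find_min hex (by omega))
    -- The ceiling costs at most a factor `2`, as `1 ≤ 1 / ε`; so `m + 1 ≤ 2 + log (1 / ε) / log 2`.
    have h2 : (2 : ℝ) ^ m ≤ 2 * (1 / ε) := by
      have := Nat.ceil_lt_add_one (a := 1 / ε) (by positivity)
      have h3 : ((2 ^ m : ℕ) : ℝ) < (⌈1 / ε⌉₊ : ℝ) := by exact_mod_cast h1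
      have h4 : 1 ≤ 1 / ε := by rw [le_div_iff₀ hε]; linarith
      push_cast at h3
      linarith
    have h3 := Real.log_le_log (by positivity) h2
    rw [Real.log_pow, Real.log_mul two_ne_zero (by positivity)] at h3
    have h4 := Real.log_two_gt_d9
    have h5 := Real.log_two_lt_d9
    rw [hm]
    push_cast
    have h6 := le_max_left 1 (Real.log (1 / ε))
    have h7 := le_max_right 1 (Real.log (1 / ε))
    have hm0 : (0 : ℝ) ≤ m := Nat.cast_nonneg m
    nlinarith

/-- Six sweeps are made per unit of `n + l` because `(7 / 8) ^ 6 ≤ 1 / 2`. -/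
theorem pow_mul_le (n l : ℕ) : (7 / 8 : ℝ) ^ (6 * (n + l)) * (2 ^ n - 1) ≤ (1 / 2) ^ l := by
  calc (7 / 8 : ℝ) ^ (6 * (n + l)) * (2 ^ n - 1) ≤ (1 / 2) ^ (n + l) * 2 ^ n := by
        refine mul_le_mul ?_ (by linarith) ?_ (by positivity)
        · rw [pow_mul]
          exact pow_le_pow_left₀ (by norm_num) (by norm_num) _
        · linarith [one_le_pow₀ (M₀ := ℝ) (a := 2) (n := n) (by norm_num)]
    _ = (1 / 2) ^ l := by
        rw [pow_add, mul_right_comm, ← mul_pow]; norm_num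

/-- The query count `24 (n + l) S` dominates `n`, `l` and, as a sweep uses at least `M` queries,
also `M`. The leading term of the time is of order `(n + l) ^ 3 * S`, so a cube suffices. -/
theorem time_le {n M l S : ℕ} (hn : 1 ≤ n) (hM : M ≤ S) (hS : 1 ≤ S) :
    8 * (n + M + l) + 50 + 6 * (n + l) * (500 * (n + 1) ^ 2 * S + 9) ≤
      500 * (6 * (n + l) * (4 * S)) ^ 3 := by
  set m := n + l with hm
  have h1 : n + 1 ≤ 2 * m := by omega
  have h2 : (n + 1) ^ 2 ≤ 4 * m ^ 2 := by
    calc (n + 1) ^ 2 ≤ (2 * m) ^ 2 := Nat.pow_le_pow_left h1 2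
      _ = 4 * m ^ 2 := by ring
  have h3 : 1 ≤ m := by omega
  have h4 : 1 ≤ m * S := Nat.mul_pos h3 hS
  have h5 : m ≤ m * S := Nat.le_mul_of_pos_right _ hS
  have h6 : S ≤ m * S := Nat.le_mul_of_pos_left _ h3
  have h7 : m * S ≤ (m * S) ^ 3 := Nat.le_self_pow (by norm_num) _
  have h8 : (m * S) * (m * m) ≤ (m * S) * ((m * S) * (m * S)) :=
    Nat.mul_le_mul_left _ (Nat.mul_le_mul h5 h5)
  have h9 : 6 * m * (500 * (n + 1) ^ 2 * S + 9) ≤ 12000 * (m * S) ^ 3 + 54 * (m * S) := by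
    calc 6 * m * (500 * (n + 1) ^ 2 * S + 9) ≤ 6 * m * (500 * (4 * m ^ 2) * S + 9) := by gcongr
      _ = 12000 * ((m * S) * (m * m)) + 54 * m := by ring
      _ ≤ 12000 * ((m * S) * ((m * S) * (m * S))) + 54 * (m * S) := by gcongr
      _ = _ := by ring
  calc _ ≤ 120 * (m * S) + (12000 * (m * S) ^ 3 + 54 * (m * S)) := by
        refine Nat.add_le_add ?_ h9
        omega
    _ ≤ 6912000 * (m * S) ^ 3 := by omega
    _ = _ := by ring

end

end HiddenShift

end

theorem mainTheorem3 :
    ∃ (P : HiddenShift.Program) (C : ℝ) (p : Polynomial ℕ),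
      ∀ (n : ℕ), 1 ≤ n →
      ∀ (f g : (Fin n → ZMod 2) → ZMod 2) (s : Fin n → ZMod 2),
      HiddenShift.IsInstance f g s →
      ∀ (δ ε : ℝ), 0 < δ → δ ≤ HiddenShift.minInfluence f → 0 < ε → ε < 1 →
        ENNReal.ofReal (1 - ε) ≤ P.successProbability f g ⌈1 / δ⌉₊ ⌈1 / ε⌉₊ s ∧
        ∃ q : ℕ, P.maxQueries f g ⌈1 / δ⌉₊ ⌈1 / ε⌉₊ = (q : ℕ∞) ∧
          (q : ℝ) ≤ C * (n * max 1 (Real.log (1 / ε)) / Real.sqrt δ) ∧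
          P.expectedTime f g ⌈1 / δ⌉₊ ⌈1 / ε⌉₊ ≤ ((p.eval q : ℕ) : ℝ≥0∞) := by
  -- There are `6 (n + l)` sweeps of `4 S` queries, with `n + l ≤ 5 n max {1, log (1 / ε)}` and `S ≤
  -- 4 M ≤ 12 / √δ`; and `6 * 5 * 4 * 12 = 1440`.
  refine ⟨HiddenShift.shiftProg, 1440, Polynomial.C 500 * Polynomial.X ^ 3,
    fun n hn f g s hI δ ε hδ hδf hε hε1 => ?_⟩
  obtain ⟨M, hM1, hM2, hM3, hM4⟩ :=
    HiddenShift.exists_sqrt hδ (hδf.trans (HiddenShift.minInfluence_le_one hn f))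
  obtain ⟨l, hl1, hl2, hl3, hl4⟩ := HiddenShift.exists_log hε hε1
  have hM5 : 1 ≤ (M : ℝ) ^ 2 * HiddenShift.minInfluence f :=
    hM3.trans (mul_le_mul_of_nonneg_left hδf (sq_nonneg _))
  have hM0 : 1 ≤ M := by
    rcases Nat.eq_zero_or_pos M with h | h
    · rw [h] at hM3; norm_num at hM3
    · exact h
  obtain ⟨S, hS1, hS2, B, hB, hv, hpot⟩ := HiddenShift.shiftProg_runs hI hM5 hM1 hM2 hl1 hl2
  refine ⟨HiddenShift.le_successProbability hB (fun b hb => (hv b hb).1) hε.le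
    (hpot.trans ((HiddenShift.pow_mul_le n l).trans hl3)), _,
    HiddenShift.maxQueries_eq hB fun b hb => (hv b hb).2, ?_, ?_⟩
  · have hn' : (1 : ℝ) ≤ n := by exact_mod_cast hn
    have hL := le_max_left 1 (Real.log (1 / ε))
    have hS3 : (S : ℝ) ≤ 4 * (3 / √δ) := by
      have : (S : ℝ) ≤ 4 * M := by exact_mod_cast hS2
      linarith
    have hnl : (n + l : ℝ) ≤ 5 * (n * max 1 (Real.log (1 / ε))) := by nlinarith
    push_cast
    calc 6 * ((n : ℝ) + l) * (4 * S)
        ≤ 6 * (5 * (n * max 1 (Real.log (1 / ε)))) * (4 * (4 * (3 / √δ))) := by gcongr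
      _ = 1440 * (n * max 1 (Real.log (1 / ε)) / √δ) := by ring
  · refine (HiddenShift.expectedTime_le hB).trans ?_
    have := HiddenShift.time_le (l := l) hn hS1 (hM0.trans hS1)
    simp only [Polynomial.eval_mul, Polynomial.eval_C, Polynomial.eval_pow, Polynomial.eval_X]
    exact_mod_cast this
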